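/- Let $V$ be a finite-dimensional Euclidean space with inner product $(\cdot|\cdot)$, and let $\Phi\subset V$ be a root system, not necessarily crystallographic and with arbitrary root lengths: a finite set of nonzero vectors such that, for all $\alpha\in\Phi$, $\Phi\cap\mathbb{R}\alpha=\{\alpha,-\alpha\}$ and the orthogonal reflection in the hyperplane $\alpha^{\perp}$ maps $\Phi$ onto itself. Let $\alpha_1,\dots,\alpha_n$ be simple roots of $\Phi$, that is, linearly independent roots such that every root is a real linear combination of them with all coefficients $\ge 0$ or all coefficients $\le 0$. Let $\Phi^+$ be the set of roots $\sum_i c_i\alpha_i\in\Phi$ with all $c_i\ge 0$, ordered by $\beta\le\gamma$ if $\gamma-\beta=\sum_i c_i\alpha_i$ with real $c_i\ge 0$, and let $C=\{v\in V\mid (v|\alpha_i)>0 \text{ for all } i\}$ be the open dominant chamber. A dominant region is a connected component of $$V\setminus\bigcup_{\beta\in\Phi^+,\ c\in\{-1,0,1\}}\{v\in V\mid (v|\beta)=c\}$$ that is contained in $C$. An increasing set is a subset $I\subseteq\Phi^+$ such that $\beta\in I$, $\gamma\in\Phi^+$ and $\beta\le\gamma$ imply $\gamma\in I$. Every dominant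 region $R$ gives an increasing set $I_R=\{\beta\in\Phi^+\mid (v|\beta)>1\text{ for all }v\in R\}$. **Theorem 5.1.** The map $R\mapsto I_R$ from the set of dominant regions to the set of increasing sets is injective, and it is a bijection if and only if, for every nonempty antichain $\Lambda$ in $(\Phi^+,\le)$, there is $v\in C$ with $(v|\beta)=1$ for all $\beta\in\Lambda$. -/

import Mathlib

open scoped InnerProductSpace

namespace RootRegions

variable {V : Type*} [NormedAddCommGroup V] [InnerProductSpace ℝ V]

/-- A (finite, reduced, not necessarily crystallographic) root system in a Euclidean space: a finite
set of nonzero vectors that meets the line through each of its members `α` in `α` and `-α` only and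
that is stable under the orthogonal reflection in each of its members. -/
structure IsRootSystem (Φ : Set V) : Prop where
  finite : Φ.Finite
  zero_notMem : (0 : V) ∉ Φ
  inter_line : ∀ α ∈ Φ, Φ ∩ (Submodule.span ℝ {α} : Set V) = {α, -α}
  image_reflection : ∀ α ∈ Φ, (Submodule.span ℝ {α})ᗮ.reflection '' Φ = Φ

/-- `v` is a linear combination of the vectors `α i` with nonnegative real coefficients. -/
def IsNonnegComb {n : ℕ} (α : Fin n → V) (v : V) : Prop :=
  ∃ c : Fin n → ℝ, (∀ i, 0 ≤ c i) ∧ v = ∑ i, c i • α i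

/-- The vectors `α 0, …, α (n - 1)` form a system of simple roots of `Φ`: they are linearly
independent roots, and every root is a real linear combination of them whose coefficients all
have the same sign. -/
structure IsSimpleSystem (Φ : Set V) {n : ℕ} (α : Fin n → V) : Prop where
  mem : ∀ i, α i ∈ Φ
  linearIndependent : LinearIndependent ℝ α
  nonneg_or_nonpos : ∀ β ∈ Φ, IsNonnegComb α β ∨ IsNonnegComb α (-β)

/-- The set `Φ⁺` of positive roots with respect to the simple roots `α`. -/
def posRoots (Φ : Set V) {n : ℕ} (α : Fin n → V) : Set V :=
  {β ∈ Φ | IsNonnegComb α β}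

/-- The root order: `β ≤ γ` if `γ - β` is a nonnegative real combination of simple roots. -/
def rootLE {n : ℕ} (α : Fin n → V) (β γ : V) : Prop :=
  IsNonnegComb α (γ - β)

/-- The hyperplane `H_{β,c} = {v | (v | β) = c}`. -/
def hyperplane (β : V) (c : ℝ) : Set V := {v | ⟪v, β⟫_ℝ = c}

/-- The open dominant chamber `C`. -/
def chamber {n : ℕ} (α : Fin n → V) : Set V := {v | ∀ i, 0 < ⟪v, α i⟫_ℝ}

/-- The complement of the hyperplanes `H_{β,c}`, for `β` a positive root and `c = -1, 0, 1`. -/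
def arrangementCompl (Φ : Set V) {n : ℕ} (α : Fin n → V) : Set V :=
  (⋃ β ∈ posRoots Φ α, ⋃ c ∈ ({-1, 0, 1} : Set ℝ), hyperplane β c)ᶜ

/-- The dominant regions: the connected components of the complement of the arrangement that lie
in the dominant chamber. -/
def dominantRegions (Φ : Set V) {n : ℕ} (α : Fin n → V) : Set (Set V) :=
  {R | (∃ x ∈ arrangementCompl Φ α, R = connectedComponentIn (arrangementCompl Φ α) x) ∧
    R ⊆ chamber α}

/-- The increasing sets of the positive root poset. -/
def increasingSets (Φ : Set V) {n : ℕ} (α : Fin n → V) : Set (Set V) :=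
  {I | I ⊆ posRoots Φ α ∧
    ∀ β ∈ posRoots Φ α, ∀ γ ∈ posRoots Φ α, rootLE α β γ → β ∈ I → γ ∈ I}

/-- `I_R`: the positive roots `β` such that `(v | β) > 1` for all `v ∈ R`. -/
def rootsAbove (Φ : Set V) {n : ℕ} (α : Fin n → V) (R : Set V) : Set V :=
  {β ∈ posRoots Φ α | R ⊆ {v | 1 < ⟪v, β⟫_ℝ}}

theorem rootsAbove_mem_increasingSets (Φ : Set V) {n : ℕ} (α : Fin n → V) {R : Set V}
    (hR : R ∈ dominantRegions Φ α) : rootsAbove Φ α R ∈ increasingSets Φ α := by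
  refine ⟨fun β hβ => hβ.1, ?_⟩
  rintro β - γ hγ ⟨c, hc, hγβ⟩ hβ
  refine ⟨hγ, fun v hv => ?_⟩
  have h1 : 1 < ⟪v, β⟫_ℝ := hβ.2 hv
  have h2 : 0 ≤ ⟪v, γ - β⟫_ℝ := by
    rw [hγβ, inner_sum]
    refine Finset.sum_nonneg fun i _ => ?_
    rw [real_inner_smul_right]
    exact mul_nonneg (hc i) (hR.2 hv i).le
  rw [inner_sub_right] at h2
  show 1 < ⟪v, γ⟫_ℝ
  linarith

/-- The map `R ↦ I_R` from dominant regions to increasing sets. -/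
def regionMap (Φ : Set V) {n : ℕ} (α : Fin n → V) (R : dominantRegions Φ α) :
    increasingSets Φ α :=
  ⟨rootsAbove Φ α R, rootsAbove_mem_increasingSets Φ α R.2⟩

/-- `Int_C(Λ)`: the solutions in the dominant chamber of `(v | β) = 1` for all `β ∈ Λ`. -/
def intC {n : ℕ} (α : Fin n → V) (Λ : Set V) : Set V :=
  {v ∈ chamber α | ∀ β ∈ Λ, ⟪v, β⟫_ℝ = 1}

end RootRegions

/-! On the chamber only the walls of value 1 matter, so two points with the same roots above 1 are
joined by a segment that crosses no wall; this gives injectivity. Surjectivity means that each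
increasing set `I` is cut out by some `x` in the chamber with `(x|β) > 1` on `I` and `(x|β) < 1` on
the other positive roots (`regionMap_surjective_iff`).

If this holds, the increasing sets generated by the subsets of an antichain `Λ` give chamber points
realising every sign pattern of `(x|β) - 1` on `Λ`. By `gordan` a convex combination of them has
value 1 on all of `Λ`.

Conversely, if `I` is not cut out, `gordan` yields a relation `∑ a_i α_i + ∑ ε_β b_β β = 0` with `a,
b ≥ 0`, `b ≠ 0` and `∑ ε_β b_β ≥ 0`, where `ε` is 1 on `I` and -1 elsewhere. In `no_obstruction`
weight is moved along comparable pairs until the support of `b` is an antichain. Pairing with a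
chamber point of value 1 on the support forces `a = 0`. The rest of the relation is refuted by a
vector `u` whose products with the support have prescribed signs (`exists_inner_signs`).

The existence of `u` is the deep point. Put `λ = (v|·)`, let `S` be the positive roots of value 1 at
`v`, and let `T ⊆ S`. The claim is that some `w` in the reflection group makes `λ(wβ)` negative for
`β ∈ T` and positive for `β ∈ S \ T`; then `u = w⁻¹v`. For each `T` the functions on the group carry
a module `M_T` of the graded Hecke algebra, with the same diagonal weights for all `T`. It sits as
the constants in a module `I_T` of polynomial-valued functions. The indicator of the `w` at which
the sign of `λ(wβ)` agrees with `T` is a homomorphism from `M_T` to `M_{T Δ {β}}`. If the claim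
failed, these maps would jointly embed `M_T` in the product over `β`, and the inclusion in `I_T`
would extend to that product. But homomorphisms from `M_T` to `I_T` are scalar
(`heckeHom_const_eq`), and those factoring through one `M_{T Δ {β}}` vanish because the indicator
has a zero. So the inclusion would be zero (`exists_sign_pattern`).

The extension property (`exists_heckeHom_extend`) is a cohomology vanishing. Extensions are
controlled by group-equivariant alternating forms with a Koszul differential; dimension shifting
through coinduced modules reduces exactness to commuting operators, where it is the Poincaré lemma
for polynomials together with a dévissage (`koszulAcyclic_homAction_dirDeriv`). -/

namespace RootRegions

open AlternatingMap

/-! ### Koszul complexes of commuting operators -/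

section Koszul

variable {V N N' : Type*} [AddCommGroup V] [Module ℝ V] [AddCommGroup N] [Module ℝ N]
  [AddCommGroup N'] [Module ℝ N'] {k : ℕ}

/-- The bilinear map `v ↦ A v ∘ ω` underlying the Koszul differential. -/
def koszulPre (A : V →ₗ[ℝ] Module.End ℝ N) (ω : V [⋀^Fin k]→ₗ[ℝ] N) :
    V →ₗ[ℝ] V [⋀^Fin k]→ₗ[ℝ] N where
  toFun v := (A v).compAlternatingMap ω
  map_add' x y := by ext; simp
  map_smul' c x := by ext; simp

/-- The Koszul differential on alternating forms with values in a space on which the vectors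
of `V` act by operators `A v`. -/
def koszulD (A : V →ₗ[ℝ] Module.End ℝ N) (ω : V [⋀^Fin k]→ₗ[ℝ] N) :
    V [⋀^Fin (k + 1)]→ₗ[ℝ] N :=
  alternatizeUncurryFin (koszulPre A ω)

theorem koszulD_apply (A : V →ₗ[ℝ] Module.End ℝ N) (ω : V [⋀^Fin k]→ₗ[ℝ] N)
    (v : Fin (k + 1) → V) :
    koszulD A ω v = ∑ i : Fin (k + 1), (-1 : ℤ) ^ (i : ℕ) • A (v i) (ω (i.removeNth v)) := by
  simp [koszulD, alternatizeUncurryFin_apply, koszulPre]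

theorem koszulD_add (A : V →ₗ[ℝ] Module.End ℝ N) (ω η : V [⋀^Fin k]→ₗ[ℝ] N) :
    koszulD A (ω + η) = koszulD A ω + koszulD A η := by
  ext v; simp [koszulD_apply, Finset.sum_add_distrib]

theorem koszulD_sub (A : V →ₗ[ℝ] Module.End ℝ N) (ω η : V [⋀^Fin k]→ₗ[ℝ] N) :
    koszulD A (ω - η) = koszulD A ω - koszulD A η := by
  ext v; simp [koszulD_apply, Finset.sum_sub_distrib, smul_sub]

theorem koszulD_zero (A : V →ₗ[ℝ] Module.End ℝ N) :
    koszulD A (0 : V [⋀^Fin k]→ₗ[ℝ] N) = 0 := by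
  ext v; simp [koszulD_apply]

theorem alternatingMap_sum_apply {ι : Type*} (t : Finset ι) (f : ι → V [⋀^Fin k]→ₗ[ℝ] N)
    (v : Fin k → V) : (∑ j ∈ t, f j) v = ∑ j ∈ t, f j v := by
  classical
  induction t using Finset.induction_on with
  | empty => simp
  | insert a s ha ih => rw [Finset.sum_insert ha, Finset.sum_insert ha, AlternatingMap.add_apply, ih]

theorem koszulD_sum {ι : Type*} (t : Finset ι) (A : V →ₗ[ℝ] Module.End ℝ N)
    (ω : ι → V [⋀^Fin k]→ₗ[ℝ] N) :
    koszulD A (∑ j ∈ t, ω j) = ∑ j ∈ t, koszulD A (ω j) := by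
  classical
  induction t using Finset.induction_on with
  | empty => simp [koszulD_zero]
  | insert a s ha ih => rw [Finset.sum_insert ha, Finset.sum_insert ha, koszulD_add, ih]

theorem koszulD_comp (A : V →ₗ[ℝ] Module.End ℝ N) (A' : V →ₗ[ℝ] Module.End ℝ N')
    (f : N →ₗ[ℝ] N') (h : ∀ x n, f (A x n) = A' x (f n)) (ω : V [⋀^Fin k]→ₗ[ℝ] N) :
    koszulD A' (f.compAlternatingMap ω) = f.compAlternatingMap (koszulD A ω) := by
  ext v; simp [koszulD_apply, h]

/-- Because the operators commute, the second differential alternates a form that is symmetric in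
two arguments. -/
theorem koszulD_koszulD (A : V →ₗ[ℝ] Module.End ℝ N) (hA : ∀ x y, A x * A y = A y * A x)
    (ω : V [⋀^Fin k]→ₗ[ℝ] N) : koszulD A (koszulD A ω) = 0 := by
  let f : V →ₗ[ℝ] V →ₗ[ℝ] V [⋀^Fin k]→ₗ[ℝ] N :=
    LinearMap.mk₂ ℝ (fun x y => (A x * A y).compAlternatingMap ω)
      (fun _ _ _ => by ext; simp) (fun _ _ _ => by ext; simp)
      (fun _ _ _ => by ext; simp) (fun _ _ _ => by ext; simp)
  have hf : ∀ x y, f x y = f y x := fun x y => by simp [f, hA x y]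
  have := alternatizeUncurryFin_alternatizeUncurryFinLM_comp_of_symmetric hf
  rw [← this]
  unfold koszulD
  congr 1
  ext x v
  simp [koszulPre, f, alternatizeUncurryFin_apply]

/-- Cartan's formula `ι_y d + d ι_y = A y`, the source of the contracting homotopies below. -/
theorem koszulD_curryLeft (A : V →ₗ[ℝ] Module.End ℝ N) (ω : V [⋀^Fin (k + 1)]→ₗ[ℝ] N) (y : V) :
    (koszulD A ω).curryLeft y = (A y).compAlternatingMap ω - koszulD A (ω.curryLeft y) := by
  ext v
  simp only [curryLeft_apply_apply, koszulD_apply, AlternatingMap.sub_apply, LinearMap.compAlternatingMap_apply]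
  rw [Fin.sum_univ_succ]
  have h0 : (0 : Fin (k + 2)).removeNth (Matrix.vecCons y v) = v := by
    ext i; simp [Fin.removeNth]
  simp only [Fin.val_zero, pow_zero, one_smul, h0, Matrix.cons_val_zero, Matrix.cons_val_succ,
    Fin.val_succ, pow_succ, mul_neg, mul_one, neg_smul, Finset.sum_neg_distrib, sub_eq_add_neg]
  congr 2
  refine Finset.sum_congr rfl fun j _ => ?_
  congr 3
  ext i
  refine Fin.cases ?_ (fun i => ?_) i <;> simp [Fin.removeNth]

/-- Exactness of the Koszul cochain complex in positive degrees. -/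
def KoszulAcyclic (A : V →ₗ[ℝ] Module.End ℝ N) : Prop :=
  ∀ (k : ℕ) (ω : V [⋀^Fin (k + 1)]→ₗ[ℝ] N), koszulD A ω = 0 →
    ∃ η : V [⋀^Fin k]→ₗ[ℝ] N, koszulD A η = ω

/-- By Cartan's formula, contraction with `y` followed by the inverse of `A y` is a contracting
homotopy. -/
theorem KoszulAcyclic.of_bijective {A : V →ₗ[ℝ] Module.End ℝ N}
    (hA : ∀ x y, A x * A y = A y * A x) (y : V) (hy : Function.Bijective (A y)) :
    KoszulAcyclic A := by
  intro k ω hω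
  let e := LinearEquiv.ofBijective (A y) hy
  have he : ∀ x n, (e.symm : N →ₗ[ℝ] N) (A x n) = A x ((e.symm : N →ₗ[ℝ] N) n) := by
    intro x n
    apply e.injective
    have h1 : e (A x (e.symm n)) = A x (e (e.symm n)) := by
      simpa [e] using LinearMap.congr_fun (hA y x) (e.symm n)
    simp [h1]
  refine ⟨(e.symm : N →ₗ[ℝ] N).compAlternatingMap (ω.curryLeft y), ?_⟩
  rw [koszulD_comp A A _ he]
  have h := koszulD_curryLeft A ω y
  rw [hω] at h
  have h2 : koszulD A (ω.curryLeft y) = (A y).compAlternatingMap ω := by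
    rw [eq_comm, ← sub_eq_zero, ← h]; ext; simp
  rw [h2]
  ext v
  exact e.symm_apply_apply _

/-- The long exact sequence by hand: subtracting the coboundary of a lifted primitive makes a closed
form vanish under `g`, and the remainder comes from `N₁`. The splittings `σ` and `τ` need only be
linear, since they merely transport values of forms. -/
theorem KoszulAcyclic.of_exact {N₁ N₂ N₃ : Type*} [AddCommGroup N₁] [Module ℝ N₁]
    [AddCommGroup N₂] [Module ℝ N₂] [AddCommGroup N₃] [Module ℝ N₃]
    {A₁ : V →ₗ[ℝ] Module.End ℝ N₁} {A₂ : V →ₗ[ℝ] Module.End ℝ N₂} {A₃ : V →ₗ[ℝ] Module.End ℝ N₃}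
    (f : N₁ →ₗ[ℝ] N₂) (g : N₂ →ₗ[ℝ] N₃) (hf : ∀ x n, f (A₁ x n) = A₂ x (f n))
    (hg : ∀ x n, g (A₂ x n) = A₃ x (g n)) (hfi : Function.Injective f)
    (hgs : Function.Surjective g) (hfg : Function.Exact f g)
    (hA : ∀ x y, A₂ x * A₂ y = A₂ y * A₂ x) (h₁ : KoszulAcyclic A₁) (h₃ : KoszulAcyclic A₃) : KoszulAcyclic A₂ := by
  intro k ω hω
  obtain ⟨σ, hσ⟩ := g.exists_rightInverse_of_surjective (LinearMap.range_eq_top.2 hgs)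
  have hσ' : ∀ n, g (σ n) = n := fun n => LinearMap.congr_fun hσ n
  obtain ⟨η, hη⟩ := h₃ k (g.compAlternatingMap ω) (by
    rw [koszulD_comp A₂ A₃ g hg, hω]; ext; simp)
  set ω' := ω - koszulD A₂ (σ.compAlternatingMap η) with hω'
  have hgω' : ∀ v, g (ω' v) = 0 := by
    intro v
    have : g.compAlternatingMap (koszulD A₂ (σ.compAlternatingMap η)) = g.compAlternatingMap ω := by
      rw [← koszulD_comp A₂ A₃ g hg, ← hη]
      congr 1
      ext; simp [hσ']
    have h2 := AlternatingMap.congr_fun this v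
    simp only [LinearMap.compAlternatingMap_apply] at h2
    simp [hω', h2]
  obtain ⟨τ, hτ⟩ := f.exists_leftInverse_of_injective (LinearMap.ker_eq_bot.2 hfi)
  have hτ' : ∀ n, τ (f n) = n := fun n => LinearMap.congr_fun hτ n
  have hfτ : f.compAlternatingMap (τ.compAlternatingMap ω') = ω' := by
    ext v
    obtain ⟨n, hn⟩ := (hfg _).1 (hgω' v)
    simp [← hn, hτ']
  have hdω' : koszulD A₂ ω' = 0 := by
    rw [hω', koszulD_sub, hω, koszulD_koszulD A₂ hA, sub_zero]
  obtain ⟨θ, hθ⟩ := h₁ k (τ.compAlternatingMap ω') (by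
    ext v
    apply hfi
    have := AlternatingMap.congr_fun
      (koszulD_comp A₁ A₂ f hf (τ.compAlternatingMap ω')) v
    rw [hfτ, hdω'] at this
    simpa using this.symm)
  refine ⟨σ.compAlternatingMap η + f.compAlternatingMap θ, ?_⟩
  rw [koszulD_add, koszulD_comp A₁ A₂ f hf, hθ, hfτ, hω']
  abel

theorem KoszulAcyclic.pi {ι : Type*} {M : ι → Type*} [∀ i, AddCommGroup (M i)]
    [∀ i, Module ℝ (M i)] {A : V →ₗ[ℝ] Module.End ℝ (∀ i, M i)}
    {B : ∀ i, V →ₗ[ℝ] Module.End ℝ (M i)} (hAB : ∀ x m i, A x m i = B i x (m i))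
    (hB : ∀ i, KoszulAcyclic (B i)) : KoszulAcyclic A := by
  intro k ω hω
  have h : ∀ i, ∃ η : V [⋀^Fin k]→ₗ[ℝ] M i,
      koszulD (B i) η = (LinearMap.proj i).compAlternatingMap ω := fun i => by
    apply hB i
    rw [koszulD_comp A (B i) (LinearMap.proj i) (fun x m => hAB x m i), hω]
    ext; simp
  choose η hη using h
  refine ⟨AlternatingMap.pi η, ?_⟩
  ext v i
  have := AlternatingMap.congr_fun (hη i) v
  simp only [LinearMap.compAlternatingMap_apply, LinearMap.proj_apply] at this
  rw [← this, koszulD_apply, koszulD_apply]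
  simp [hAB, Finset.sum_apply]

theorem KoszulAcyclic.of_equiv {A : V →ₗ[ℝ] Module.End ℝ N} {A' : V →ₗ[ℝ] Module.End ℝ N'}
    (e : N ≃ₗ[ℝ] N') (he : ∀ x n, e (A x n) = A' x (e n)) (h : KoszulAcyclic A) :
    KoszulAcyclic A' := by
  intro k ω hω
  have he' : ∀ x n, (e.symm : N' →ₗ[ℝ] N) (A' x n) = A x ((e.symm : N' →ₗ[ℝ] N) n) := by
    intro x n
    apply e.injective
    simp [he]
  obtain ⟨η, hη⟩ := h k ((e.symm : N' →ₗ[ℝ] N).compAlternatingMap ω) (by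
    rw [koszulD_comp A' A _ he', hω]; ext; simp)
  refine ⟨(e : N →ₗ[ℝ] N').compAlternatingMap η, ?_⟩
  rw [koszulD_comp A A' (e : N →ₗ[ℝ] N') he, hη]
  ext v
  exact e.apply_symm_apply _

/-- If homotopy operators `X j` dual to the `A`-action along a basis exist, and the resulting Euler
operator can be inverted compatibly with the action, the Koszul complex is exact. -/
theorem KoszulAcyclic.of_euler {ι : Type*} [Fintype ι] (e : Module.Basis ι ℝ V)
    {A : V →ₗ[ℝ] Module.End ℝ N} (X : ι → Module.End ℝ N)
    (hX : ∀ y j n, A y (X j n) = X j (A y n) + e.repr y j • n)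
    (D : ℕ → Module.End ℝ N) (hD : ∀ k y n, A y (D k n) = D (k + 1) (A y n))
    (hE : ∀ k n, ∑ j, X j (A (e j) (D k n)) + (k + 1 : ℝ) • D k n = n) :
    KoszulAcyclic A := by
  intro k ω hω
  -- Inverting the Euler operator first keeps the form closed, because `D` passes through the
  -- differential with its index raised by one. Cartan's formula then reads `d ι_y θ = A y θ`.
  set θ := (D k).compAlternatingMap ω with hθ
  have hdθ : koszulD A θ = 0 := by
    have : koszulD A θ = (D (k + 1)).compAlternatingMap (koszulD A ω) := by
      ext v
      simp [koszulD_apply, hθ, hD]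
    rw [this, hω]; ext; simp
  have hι : ∀ y, koszulD A (θ.curryLeft y) = (A y).compAlternatingMap θ := by
    intro y
    have h := koszulD_curryLeft A θ y
    rw [hdθ] at h
    rw [eq_comm, ← sub_eq_zero, ← h]; ext; simp
  refine ⟨∑ j, (X j).compAlternatingMap (θ.curryLeft (e j)), ?_⟩
  ext v
  have h1 : ∀ j, koszulD A ((X j).compAlternatingMap (θ.curryLeft (e j))) v =
      X j (A (e j) (θ v)) + ∑ i : Fin (k + 1), (-1 : ℤ) ^ (i : ℕ) •
        e.repr (v i) j • θ.curryLeft (e j) (i.removeNth v) := by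
    intro j
    have := AlternatingMap.congr_fun (hι (e j)) v
    rw [LinearMap.compAlternatingMap_apply] at this
    rw [← this, koszulD_apply, koszulD_apply, map_sum, ← Finset.sum_add_distrib]
    refine Finset.sum_congr rfl fun i _ => ?_
    rw [LinearMap.compAlternatingMap_apply, hX, smul_add, map_zsmul]
  -- Contracting with a basis vector and wedging back with its dual, summed over the basis,
  -- multiplies a form by its degree; this is the term `k + 1` in `hE`.
  have h2 : ∑ j, ∑ i : Fin (k + 1), (-1 : ℤ) ^ (i : ℕ) •
        e.repr (v i) j • θ.curryLeft (e j) (i.removeNth v) = (k + 1) • θ v := by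
    have h3 := AlternatingMap.congr_fun (alternatizeUncurryFin_curryLeft θ) v
    rw [alternatizeUncurryFin_apply] at h3
    rw [Finset.sum_comm]
    refine Eq.trans (Finset.sum_congr rfl fun i _ => ?_) h3
    rw [← Finset.smul_sum]
    congr 1
    conv_rhs => rw [← e.sum_repr (v i)]
    rw [map_sum, alternatingMap_sum_apply]
    simp
  rw [koszulD_sum, alternatingMap_sum_apply, Finset.sum_congr rfl fun j _ => h1 j,
    Finset.sum_add_distrib, h2, ← hE k (ω v), hθ]
  simp [← Nat.cast_smul_eq_nsmul ℝ]

end Koszul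

end RootRegions

namespace RootRegions

open Module

/-! ### Actions on spaces of linear maps -/

section HomAction

variable {V L N : Type*} [AddCommGroup V] [Module ℝ V] [AddCommGroup L] [Module ℝ L]
  [AddCommGroup N] [Module ℝ N]

/-- The action `φ ↦ A x ∘ φ - φ ∘ B x` of `V` on `Hom(L, N)`. -/
def homAction (A : V →ₗ[ℝ] End ℝ N) (B : V →ₗ[ℝ] End ℝ L) : V →ₗ[ℝ] End ℝ (L →ₗ[ℝ] N) where
  toFun x :=
    { toFun := fun φ => A x ∘ₗ φ - φ ∘ₗ B x
      map_add' := fun φ ψ => by ext; simp; abel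
      map_smul' := fun c φ => by ext; simp [smul_sub] }
  map_add' x y := by ext; simp; abel
  map_smul' c x := by ext; simp [smul_sub]

@[simp]
theorem homAction_apply (A : V →ₗ[ℝ] End ℝ N) (B : V →ₗ[ℝ] End ℝ L) (x : V) (φ : L →ₗ[ℝ] N)
    (l : L) : homAction A B x φ l = A x (φ l) - φ (B x l) := rfl

theorem homAction_comm {A : V →ₗ[ℝ] End ℝ N} {B : V →ₗ[ℝ] End ℝ L}
    (hA : ∀ x y, A x * A y = A y * A x) (hB : ∀ x y, B x * B y = B y * B x) (x y : V) :
    homAction A B x * homAction A B y = homAction A B y * homAction A B x := by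
  ext φ l
  have h1 := LinearMap.congr_fun (hA x y) (φ l)
  have h2 := LinearMap.congr_fun (hB x y) l
  simp only [End.mul_apply] at h1 h2
  simp only [End.mul_apply, homAction_apply, map_sub, h1, h2]
  abel

end HomAction

/-- If `P` is locally nilpotent and commutes with the bijective `Q`, then `P - Q` is bijective. -/
theorem bijective_sub_of_locally_nilpotent {N : Type*} [AddCommGroup N] [Module ℝ N]
    (P Q : End ℝ N) (hPQ : Commute P Q) (hP : ∀ n, ∃ k, (P ^ k) n = 0)
    (hQ : Function.Bijective Q) : Function.Bijective (P - Q) := by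
  have hQk : ∀ k, Function.Bijective (Q ^ k : End ℝ N) := by
    intro k
    induction k with
    | zero => exact Function.bijective_id
    | succ k ih => rw [pow_succ]; exact ih.comp hQ
  -- On a vector killed by `P ^ k`, the factorisation of `P ^ k - Q ^ k` by `P - Q` leaves only the
  -- bijective `-Q ^ k`.
  have key : ∀ k, (P - Q) * (∑ i ∈ Finset.range k, P ^ i * Q ^ (k - 1 - i)) = P ^ k - Q ^ k :=
    fun k => hPQ.mul_geom_sum₂ k
  constructor
  · rw [← LinearMap.ker_eq_bot, LinearMap.ker_eq_bot']
    intro m hm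
    obtain ⟨k, hk⟩ := hP m
    have h1 := LinearMap.congr_fun (hPQ.geom_sum₂_mul k) m
    rw [End.mul_apply, hm, map_zero, LinearMap.sub_apply, hk, zero_sub] at h1
    exact (hQk k).1 (by rw [map_zero]; exact (neg_eq_zero.1 h1.symm))
  · intro m
    obtain ⟨k, hk⟩ := hP m
    obtain ⟨m', hm'⟩ := (hQk k).2 (-m)
    refine ⟨(∑ i ∈ Finset.range k, P ^ i * Q ^ (k - 1 - i)) m', ?_⟩
    have h1 := LinearMap.congr_fun (key k) m'
    rw [End.mul_apply] at h1
    rw [h1, LinearMap.sub_apply, hm']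
    have : (P ^ k) m' = 0 := by
      apply (hQk k).1
      have hc : (Q ^ k * P ^ k : End ℝ N) = P ^ k * Q ^ k := ((hPQ.pow_pow k k).eq).symm
      have := LinearMap.congr_fun hc m'
      simp only [End.mul_apply] at this
      rw [this, hm', map_neg, hk]; simp
    rw [this]; simp

/-! ### Derivatives of polynomials and the Poincaré lemma -/

section Polynomial

variable {V : Type*} [AddCommGroup V] [Module ℝ V] {ι : Type*} [Fintype ι]

/-- The directional derivative on polynomials, in the coordinates given by a basis. -/
noncomputable def dirDeriv (e : Basis ι ℝ V) : V →ₗ[ℝ] End ℝ (MvPolynomial ι ℝ) where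
  toFun y := ∑ j, e.repr y j • (MvPolynomial.pderiv j : Derivation ℝ _ _).toLinearMap
  map_add' x y := by simp [add_smul, Finset.sum_add_distrib]
  map_smul' c x := by simp [mul_smul, Finset.smul_sum]

theorem dirDeriv_apply (e : Basis ι ℝ V) (y : V) (p : MvPolynomial ι ℝ) :
    dirDeriv e y p = ∑ j, e.repr y j • MvPolynomial.pderiv j p := by
  simp [dirDeriv]

theorem dirDeriv_mul (e : Basis ι ℝ V) (y : V) (p q : MvPolynomial ι ℝ) :
    dirDeriv e y (p * q) = p * dirDeriv e y q + dirDeriv e y p * q := by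
  simp only [dirDeriv_apply, Derivation.leibniz, smul_add, Finset.sum_add_distrib,
    Finset.mul_sum, Finset.sum_mul, smul_eq_mul]
  congr 1 <;> refine Finset.sum_congr rfl fun j _ => ?_
  · rw [mul_smul_comm]
  · rw [mul_comm, smul_mul_assoc]

theorem dirDeriv_X (e : Basis ι ℝ V) (y : V) (j : ι) :
    dirDeriv e y (MvPolynomial.X j) = MvPolynomial.C (e.repr y j) := by
  classical
  rw [dirDeriv_apply, Finset.sum_eq_single j]
  · simp [MvPolynomial.smul_eq_C_mul]
  · intro b _ hb; simp [MvPolynomial.pderiv_X_of_ne hb.symm]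
  · simp

theorem dirDeriv_C (e : Basis ι ℝ V) (y : V) (c : ℝ) :
    dirDeriv e y (MvPolynomial.C c) = 0 := by
  simp [dirDeriv_apply]

theorem dirDeriv_basis (e : Basis ι ℝ V) (j : ι) (p : MvPolynomial ι ℝ) :
    dirDeriv e (e j) p = MvPolynomial.pderiv j p := by
  classical
  rw [dirDeriv_apply, Finset.sum_eq_single j]
  · simp
  · intro b _ hb; simp [Finsupp.single_eq_of_ne hb]
  · simp

theorem dirDeriv_comm (e : Basis ι ℝ V) (x y : V) :
    dirDeriv e x * dirDeriv e y = dirDeriv e y * dirDeriv e x := by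
  refine LinearMap.ext fun p => ?_
  simp only [End.mul_apply]
  induction p using MvPolynomial.induction_on with
  | C a => simp [dirDeriv_C]
  | add p q hp hq => simp [hp, hq]
  | mul_X p j hp =>
    simp only [dirDeriv_mul, dirDeriv_X, map_add, hp, dirDeriv_C]
    ring

theorem dirDeriv_locally_nilpotent (e : Basis ι ℝ V) (y : V) (p : MvPolynomial ι ℝ) :
    ∃ k, (dirDeriv e y ^ k) p = 0 := by
  induction p using MvPolynomial.induction_on with
  | C a => exact ⟨1, by simp [dirDeriv_C]⟩
  | add p q hp hq =>
    obtain ⟨k, hk⟩ := hp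
    obtain ⟨l, hl⟩ := hq
    refine ⟨k + l, ?_⟩
    have h1 : (dirDeriv e y ^ (k + l)) p = 0 := by
      rw [add_comm, pow_add, End.mul_apply, hk, map_zero]
    have h2 : (dirDeriv e y ^ (k + l)) q = 0 := by rw [pow_add, End.mul_apply, hl, map_zero]
    rw [map_add, h1, h2, add_zero]
  | mul_X p j hp =>
    obtain ⟨k, hk⟩ := hp
    have h : ∀ m : ℕ, (dirDeriv e y ^ m) (p * MvPolynomial.X j) =
        (dirDeriv e y ^ m) p * MvPolynomial.X j +
          (m * e.repr y j) • (dirDeriv e y ^ (m - 1)) p := by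
      intro m
      induction m with
      | zero => simp
      | succ m ih =>
        rw [pow_succ', End.mul_apply, ih, map_add, dirDeriv_mul, dirDeriv_X, map_smul,
          End.mul_apply, Nat.add_sub_cancel]
        rcases m with _ | m
        · simp [MvPolynomial.smul_eq_C_mul]; ring
        · have h' : dirDeriv e y ((dirDeriv e y ^ m) p) = (dirDeriv e y ^ (m + 1)) p := by
            rw [pow_succ', End.mul_apply]
          rw [Nat.add_sub_cancel, h']
          simp only [MvPolynomial.smul_eq_C_mul, map_mul, Nat.cast_add, Nat.cast_one, map_add,
            map_one]
          ring
    refine ⟨k + 1, ?_⟩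
    rw [h, Nat.add_sub_cancel, hk, pow_succ', End.mul_apply, hk]
    simp

/-- Integration by parts along a coordinate `j` in which `y` has nonzero entry `c`: the derivative
of `X_j ^ (m + 1) p` is `(m + 1) c X_j ^ m p` plus `X_j ^ (m + 1)` times the derivative of `p`. That
derivative is closer to zero, so local nilpotency ends the recursion. -/
theorem dirDeriv_surjective (e : Basis ι ℝ V) {y : V} (hy : y ≠ 0) :
    Function.Surjective (dirDeriv e y) := by
  obtain ⟨j, hj⟩ : ∃ j, e.repr y j ≠ 0 := by
    by_contra! h
    exact hy (e.repr.map_eq_zero_iff.1 (Finsupp.ext h))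
  set c := e.repr y j with hc
  have hpow : ∀ m : ℕ, dirDeriv e y (MvPolynomial.X j ^ (m + 1)) =
      ((m + 1 : ℝ) * c) • MvPolynomial.X j ^ m := by
    intro m
    induction m with
    | zero => simp [dirDeriv_X, MvPolynomial.smul_eq_C_mul, hc]
    | succ m ih =>
      rw [pow_succ, dirDeriv_mul, ih, dirDeriv_X, ← hc]
      simp only [MvPolynomial.smul_eq_C_mul, map_mul, Nat.cast_add, Nat.cast_one, map_add, map_one]
      ring
  have key : ∀ (k : ℕ) (p : MvPolynomial ι ℝ), (dirDeriv e y ^ k) p = 0 →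
      ∀ m : ℕ, ∃ q, dirDeriv e y q = MvPolynomial.X j ^ m * p := by
    intro k
    induction k with
    | zero => intro p hp m; exact ⟨0, by simp only [pow_zero, End.one_apply] at hp; simp [hp]⟩
    | succ k ih =>
      intro p hp m
      obtain ⟨q, hq⟩ := ih (dirDeriv e y p) (by rwa [pow_succ] at hp) (m + 1)
      have hm : ((m + 1 : ℝ) * c) ≠ 0 := mul_ne_zero (by positivity) hj
      refine ⟨((m + 1 : ℝ) * c)⁻¹ • (MvPolynomial.X j ^ (m + 1) * p - q), ?_⟩
      rw [map_smul, map_sub, dirDeriv_mul, hpow, hq, add_sub_cancel_left, smul_mul_assoc,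
        inv_smul_smul₀ hm]
  intro p
  obtain ⟨k, hk⟩ := dirDeriv_locally_nilpotent e y p
  obtain ⟨q, hq⟩ := key k p hk 0
  exact ⟨q, by simpa using hq⟩

theorem dirDeriv_add_const_bijective (e : Basis ι ℝ V) (y : V) {c : ℝ} (hc : c ≠ 0) :
    Function.Bijective (c • (1 : End ℝ (MvPolynomial ι ℝ)) + dirDeriv e y) := by
  have := bijective_sub_of_locally_nilpotent (dirDeriv e y) (-(c • 1))
    (by
      have : Commute (dirDeriv e y) (c • (1 : End ℝ (MvPolynomial ι ℝ))) :=
        (Commute.one_right _).smul_right c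
      exact this.neg_right) (dirDeriv_locally_nilpotent e y) ?_
  · rwa [sub_neg_eq_add, add_comm] at this
  · constructor
    · intro p q h
      simpa [hc] using h
    · intro p
      exact ⟨-(c⁻¹ • p), by simp [hc]⟩

theorem sum_X_mul_pderiv_monomial (m : ι →₀ ℕ) (c : ℝ) :
    ∑ j, MvPolynomial.X j * MvPolynomial.pderiv j (MvPolynomial.monomial m c) =
      (m.degree : ℝ) • MvPolynomial.monomial m c := by
  rw [(MvPolynomial.isHomogeneous_monomial c rfl).sum_X_mul_pderiv, Nat.cast_smul_eq_nsmul]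

theorem coeff_sum_X_mul_pderiv (p : MvPolynomial ι ℝ) (m : ι →₀ ℕ) :
    (∑ j, MvPolynomial.X j * MvPolynomial.pderiv j p).coeff m = m.degree * p.coeff m := by
  classical
  induction p using MvPolynomial.induction_on' with
  | monomial u a =>
    rw [sum_X_mul_pderiv_monomial, MvPolynomial.coeff_smul, MvPolynomial.coeff_monomial,
      smul_eq_mul]
    split_ifs with h
    · rw [h]
    · simp
  | add p q hp hq =>
    simp only [map_add, mul_add, Finset.sum_add_distrib, MvPolynomial.coeff_add, hp, hq]

/-- A polynomial all of whose directional derivatives vanish is constant. -/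
theorem eq_C_of_dirDeriv_eq_zero (e : Basis ι ℝ V) (p : MvPolynomial ι ℝ)
    (hp : ∀ y, dirDeriv e y p = 0) : ∃ c, p = MvPolynomial.C c := by
  classical
  refine ⟨p.coeff 0, ?_⟩
  ext m
  rw [MvPolynomial.coeff_C]
  split_ifs with h
  · rw [h]
  · have h1 := coeff_sum_X_mul_pderiv p m
    simp only [← dirDeriv_basis e, hp, mul_zero, Finset.sum_const_zero,
      MvPolynomial.coeff_zero] at h1
    refine (mul_eq_zero.1 h1.symm).resolve_left ?_
    rw [Nat.cast_eq_zero, Finsupp.degree_eq_zero_iff]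
    exact fun h' => h h'.symm

/-- The inverse of the shifted Euler operator. -/
noncomputable def eulerInv (ι : Type*) (k : ℕ) : End ℝ (MvPolynomial ι ℝ) :=
  (MvPolynomial.basisMonomials ι ℝ).constr ℝ fun m =>
    MvPolynomial.monomial m ((m.degree : ℝ) + k + 1)⁻¹

theorem eulerInv_monomial (k : ℕ) (m : ι →₀ ℕ) (c : ℝ) :
    eulerInv ι k (MvPolynomial.monomial m c) =
      MvPolynomial.monomial m (c * ((m.degree : ℝ) + k + 1)⁻¹) := by
  have : MvPolynomial.monomial m c = c • MvPolynomial.basisMonomials ι ℝ m := by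
    rw [MvPolynomial.coe_basisMonomials, MvPolynomial.smul_monomial, smul_eq_mul, mul_one]
  rw [this, map_smul, eulerInv, Basis.constr_basis, MvPolynomial.smul_monomial, smul_eq_mul]

theorem dirDeriv_monomial (e : Basis ι ℝ V) (y : V) (m : ι →₀ ℕ) (c : ℝ) :
    dirDeriv e y (MvPolynomial.monomial m c) = ∑ j, e.repr y j •
      MvPolynomial.monomial (m - Finsupp.single j 1) (c * m j) := by
  simp [dirDeriv_apply, MvPolynomial.pderiv_monomial]

/-- The derivative lowers the degree by one while the index rises by one, so `degree + k + 1` is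
unchanged. -/
theorem dirDeriv_eulerInv (e : Basis ι ℝ V) (k : ℕ) (y : V) (p : MvPolynomial ι ℝ) :
    dirDeriv e y (eulerInv ι k p) = eulerInv ι (k + 1) (dirDeriv e y p) := by
  classical
  induction p using MvPolynomial.induction_on' with
  | add p q hp hq => simp [hp, hq]
  | monomial m c =>
    rw [eulerInv_monomial, dirDeriv_monomial, dirDeriv_monomial, map_sum]
    refine Finset.sum_congr rfl fun j _ => ?_
    rw [map_smul, eulerInv_monomial]
    congr 1
    by_cases hj : m j = 0
    · simp [hj]
    · have hd : m.degree = (m - Finsupp.single j 1).degree + 1 := by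
        conv_lhs => rw [← Finsupp.sub_add_single_one_cancel hj]
        simp
      rw [hd]
      congr 1
      push_cast
      ring

theorem euler_eulerInv (e : Basis ι ℝ V) (k : ℕ) (p : MvPolynomial ι ℝ) :
    ∑ j, MvPolynomial.X j * dirDeriv e (e j) (eulerInv ι k p) + (k + 1 : ℝ) • eulerInv ι k p = p := by
  classical
  induction p using MvPolynomial.induction_on' with
  | add p q hp hq =>
    conv_rhs => rw [← hp, ← hq]
    simp only [map_add, mul_add, Finset.sum_add_distrib, smul_add]
    abel
  | monomial m c =>
    simp only [dirDeriv_basis]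
    rw [eulerInv_monomial, sum_X_mul_pderiv_monomial, ← add_smul, MvPolynomial.smul_monomial]
    congr 1
    have : (m.degree : ℝ) + k + 1 ≠ 0 := by positivity
    rw [smul_eq_mul]
    field_simp
    ring

theorem homAction_locally_nilpotent (e : Basis ι ℝ V) (y : V) {L : Type*} [AddCommGroup L]
    [Module ℝ L] [FiniteDimensional ℝ L] (φ : L →ₗ[ℝ] MvPolynomial ι ℝ) :
    ∃ k, ∀ l, (dirDeriv e y ^ k) (φ l) = 0 := by
  let b := Module.finBasis ℝ L
  choose k hk using fun i => dirDeriv_locally_nilpotent e y (φ (b i))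
  refine ⟨∑ i, k i, fun l => ?_⟩
  have h : (dirDeriv e y ^ (∑ i, k i)) ∘ₗ φ = 0 := by
    refine b.ext fun i => ?_
    rw [LinearMap.comp_apply, ← Finset.sum_erase_add _ _ (Finset.mem_univ i), pow_add,
      End.mul_apply, hk, map_zero, LinearMap.zero_apply]
  exact LinearMap.congr_fun h l

/-- The polynomials are an injective object for finite-dimensional modules with commuting actions
of the vectors of `V`. -/
theorem koszulAcyclic_homAction_dirDeriv.{u} (e : Basis ι ℝ V) (d : ℕ) :
    ∀ (L : Type u) [AddCommGroup L] [Module ℝ L] [FiniteDimensional ℝ L] (B : V →ₗ[ℝ] End ℝ L),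
      (∀ x y, B x * B y = B y * B x) → finrank ℝ L = d →
      KoszulAcyclic (homAction (dirDeriv e) B) := by
  induction d using Nat.strong_induction_on with
  | _ d ih =>
  intro L _ _ _ B hB hd
  by_cases h0 : ∀ x, B x = 0
  -- For the trivial action this is the Poincaré lemma, with multiplication by the coordinates as
  -- homotopy.
  · refine KoszulAcyclic.of_euler e
      (fun j => LinearMap.compRight ℝ (LinearMap.mulLeft ℝ (MvPolynomial.X j))) ?_
      (fun k => LinearMap.compRight ℝ (eulerInv ι k)) ?_ ?_
    · intro y j φ
      ext l : 1
      simp [h0, dirDeriv_mul, dirDeriv_X, MvPolynomial.smul_eq_C_mul]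
    · intro k y φ
      ext l : 1
      simp [h0, dirDeriv_eulerInv]
    · intro k φ
      ext l : 1
      simpa [h0] using euler_eulerInv e k (φ l)
  push Not at h0
  obtain ⟨x, hx⟩ := h0
  by_cases hb : LinearMap.ker (B x) = ⊥
  -- If `B x` is invertible, `x` acts on `Hom` as a locally nilpotent operator minus a commuting
  -- invertible one, hence invertibly.
  · have hbij : Function.Bijective (B x) :=
      ⟨LinearMap.ker_eq_bot.1 hb, LinearMap.injective_iff_surjective.1 (LinearMap.ker_eq_bot.1 hb)⟩
    refine KoszulAcyclic.of_bijective (homAction_comm (dirDeriv_comm e) hB) x ?_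
    let P : End ℝ (L →ₗ[ℝ] MvPolynomial ι ℝ) := LinearMap.compRight ℝ (dirDeriv e x)
    let Q : End ℝ (L →ₗ[ℝ] MvPolynomial ι ℝ) := LinearMap.lcomp ℝ _ (B x)
    have hPQ : homAction (dirDeriv e) B x = P - Q := by ext φ l : 2; simp [P, Q]
    rw [hPQ]
    have hPk : ∀ k φ l, (P ^ k) φ l = (dirDeriv e x ^ k) (φ l) := by
      intro k
      induction k with
      | zero => simp
      | succ k ih => intro φ l; rw [pow_succ, pow_succ, End.mul_apply, ih]; simp [P]
    refine bijective_sub_of_locally_nilpotent P Q ?_ ?_ ?_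
    · ext φ l : 2
      simp [P, Q]
    · intro φ
      obtain ⟨k, hk⟩ := homAction_locally_nilpotent e x φ
      exact ⟨k, LinearMap.ext fun l => by rw [hPk, hk]; rfl⟩
    · let b := LinearEquiv.ofBijective (B x) hbij
      constructor
      · intro φ ψ h
        ext l : 1
        obtain ⟨l, rfl⟩ := hbij.2 l
        exact LinearMap.congr_fun h l
      · intro φ
        refine ⟨φ ∘ₗ (b.symm : L →ₗ[ℝ] L), ?_⟩
        ext l : 1
        exact congrArg φ (b.symm_apply_apply l)
  -- Otherwise the kernel is a proper nonzero submodule, stable because the operators commute, and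
  -- the induction applies to it and to the quotient.
  · set K := LinearMap.ker (B x) with hK
    have hKB : ∀ y, ∀ l ∈ K, B y l ∈ K := by
      intro y l hl
      rw [hK, LinearMap.mem_ker] at hl ⊢
      have := LinearMap.congr_fun (hB x y) l
      simp only [End.mul_apply] at this
      rw [this, hl, map_zero]
    have hKtop : K ≠ ⊤ := fun h => hx (LinearMap.ker_eq_top.1 h)
    have hKlt : finrank ℝ K < d := hd ▸ Submodule.finrank_lt hKtop
    have hQlt : finrank ℝ (L ⧸ K) < d := by
      have h1 := K.finrank_quotient_add_finrank
      have h2 : 0 < finrank ℝ K := by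
        rw [Module.finrank_pos_iff]
        exact (Submodule.nontrivial_iff_ne_bot).2 hb
      omega
    let B₁ : V →ₗ[ℝ] End ℝ K :=
      { toFun := fun y => (B y).restrict (hKB y)
        map_add' := fun _ _ => by ext; simp
        map_smul' := fun _ _ => by ext; simp }
    let B₂ : V →ₗ[ℝ] End ℝ (L ⧸ K) :=
      { toFun := fun y => K.mapQ K (B y) (hKB y)
        map_add' := fun _ _ => by ext; simp
        map_smul' := fun _ _ => by ext; simp }
    have hB₁ : ∀ y z, B₁ y * B₁ z = B₁ z * B₁ y := fun y z => by
      ext l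
      exact LinearMap.congr_fun (hB y z) l
    have hB₂ : ∀ y z, B₂ y * B₂ z = B₂ z * B₂ y := fun y z => by
      ext l
      exact congrArg K.mkQ (LinearMap.congr_fun (hB y z) l)
    refine KoszulAcyclic.of_exact (A₁ := homAction (dirDeriv e) B₂) (A₃ := homAction (dirDeriv e) B₁)
      (LinearMap.lcomp ℝ _ K.mkQ) (LinearMap.lcomp ℝ _ K.subtype) ?_ ?_ ?_ ?_ ?_
      (homAction_comm (dirDeriv_comm e) hB) (ih _ hQlt _ B₂ hB₂ rfl) (ih _ hKlt _ B₁ hB₁ rfl)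
    · intro y φ; ext l : 1; simp [B₂]
    · intro y φ; ext l : 1; simp [B₁]
    · intro φ ψ h
      ext l : 2
      exact LinearMap.congr_fun h l
    · intro φ
      obtain ⟨ψ, hψ⟩ := LinearMap.exists_extend φ
      exact ⟨ψ, hψ⟩
    · intro φ
      constructor
      · intro h
        refine ⟨K.liftQ φ fun l hl => LinearMap.congr_fun h (⟨l, hl⟩ : K), ?_⟩
        rfl
      · rintro ⟨ψ, rfl⟩
        ext l : 1
        change ψ (K.mkQ l) = 0
        rw [Submodule.mkQ_apply, (Submodule.Quotient.mk_eq_zero K).2 l.2, map_zero]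

end Polynomial

end RootRegions

/-! ### Reflection data -/

namespace RootRegions

open Module

/-- A finite reflection group `W` acting on `V`, with one reflection `s r` for each positive root
`root r`; the simple reflections `s i` permute the positive roots other than the `i`-th one. -/
structure ReflectionDatum (V W R : Type*) [AddCommGroup V] [Module ℝ V] [Group W] where
  act : W →* End ℝ V
  root : R → V
  co : R → V →ₗ[ℝ] ℝ
  s : R → W
  act_s : ∀ r x, act (s r) x = x - co r x • root r
  s_mul_self : ∀ r, s r * s r = 1
  co_root : ∀ r, co r (root r) = 2
  simple : Set R
  perm : R → Equiv.Perm R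
  perm_self : ∀ i ∈ simple, perm i i = i
  s_perm : ∀ i ∈ simple, ∀ r, s (perm i r) = s i * s r * s i
  co_perm : ∀ i ∈ simple, ∀ r, r ≠ i → ∀ x, co (perm i r) x = co r (act (s i) x)
  closure_simple : Subgroup.closure (s '' simple) = ⊤

namespace ReflectionDatum

variable {V W R : Type*} [AddCommGroup V] [Module ℝ V] [Group W] (D : ReflectionDatum V W R)

theorem act_mul (u w : W) (x : V) : D.act (u * w) x = D.act u (D.act w x) := by
  rw [map_mul]; rfl

@[simp]
theorem act_one (x : V) : D.act 1 x = x := by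
  rw [map_one]; rfl

@[simp]
theorem act_inv_act (w : W) (x : V) : D.act w⁻¹ (D.act w x) = x := by
  rw [← act_mul, inv_mul_cancel, act_one]

@[simp]
theorem act_act_inv (w : W) (x : V) : D.act w (D.act w⁻¹ x) = x := by
  rw [← act_mul, mul_inv_cancel, act_one]

theorem s_inv (r : R) : (D.s r)⁻¹ = D.s r := inv_eq_of_mul_eq_one_left (D.s_mul_self r)

theorem s_mul_s_mul (r : R) (w : W) : D.s r * (D.s r * w) = w := by
  rw [← mul_assoc, D.s_mul_self, one_mul]

theorem co_act_s (r : R) (x : V) : D.co r (D.act (D.s r) x) = - D.co r x := by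
  rw [D.act_s, map_sub, map_smul, D.co_root, smul_eq_mul]; ring

theorem induction_simple {p : W → Prop} (h1 : p 1) (hs : ∀ i ∈ D.simple, p (D.s i))
    (hmul : ∀ u w, p u → p w → p (u * w)) (w : W) : p w := by
  have hw : w ∈ Subgroup.closure (D.s '' D.simple) := by rw [D.closure_simple]; trivial
  induction hw using Subgroup.closure_induction'' with
  | one => exact h1
  | mem x hx =>
    obtain ⟨i, hi, rfl⟩ := hx
    exact hs i hi
  | inv_mem x hx =>
    obtain ⟨i, hi, rfl⟩ := hx
    rw [D.s_inv]
    exact hs i hi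
  | mul x y _ _ hx hy => exact hmul x y hx hy

variable [Fintype R]

/-- The antisymmetrised coefficients of the commutation relation. -/
def omega (r r' : R) (x y : V) : ℝ := D.co r x * D.co r' y - D.co r y * D.co r' x

/-- Needed for the commutation relation in coinduced modules. It suffices to treat simple
reflections: `s i` permutes the positive roots but negates its own, and the two correction terms
caused by that sign cancel. -/
theorem sum_omega_act {M : Type*} [AddCommGroup M] [Module ℝ M] (w : W) :
    ∀ (x y : V) (f : W → M),
      ∑ r, ∑ r', D.omega r r' (D.act w x) (D.act w y) • f (D.s r' * D.s r) =
      ∑ r, ∑ r', D.omega r r' x y • f (w * (D.s r' * D.s r) * w⁻¹) := by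
  classical
  induction w using D.induction_simple with
  | h1 => intro x y f; simp
  | hmul u w hu hw =>
    intro x y f
    simp only [D.act_mul]
    rw [hu, hw x y fun v => f (u * v * u⁻¹)]
    simp only [mul_inv_rev, mul_assoc]
  | hs i hi =>
    intro x y f
    have hpi : ∀ r, D.perm i r = i ↔ r = i := fun r => by
      conv_lhs => rw [← D.perm_self i hi]
      rw [D.perm_self i hi, ← (D.perm i).injective.eq_iff (a := r) (b := i), D.perm_self i hi]
    have hco : ∀ r z, D.co (D.perm i r) (D.act (D.s i) z) =
        (if r = i then -1 else 1) * D.co r z := by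
      intro r z
      split_ifs with h
      · rw [h, D.perm_self i hi, D.co_act_s]; ring
      · rw [D.co_perm i hi r h, ← D.act_mul, D.s_mul_self, D.act_one, one_mul]
    have hfs : ∀ r r', D.s (D.perm i r') * D.s (D.perm i r) =
        D.s i * (D.s r' * D.s r) * (D.s i)⁻¹ := by
      intro r r'
      rw [D.s_perm i hi, D.s_perm i hi, D.s_inv]
      simp only [mul_assoc, D.s_mul_s_mul]
    have hom : ∀ r r', D.omega (D.perm i r) (D.perm i r') (D.act (D.s i) x) (D.act (D.s i) y) =
        D.omega r r' x y - 2 * (if r = i then D.omega i r' x y else 0)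
          - 2 * (if r' = i then D.omega r i x y else 0) := by
      intro r r'
      simp only [omega, hco]
      split_ifs with h h' h'
      · subst h; subst h'; ring
      · subst h; ring
      · subst h'; ring
      · ring
    set g : W → M := fun v => f (D.s i * v * (D.s i)⁻¹) with hg
    -- Reindexing by `perm i` changes `c_r` only by a multiple of `c_i`, which disappears on
    -- antisymmetrising against `c_i`.
    have h1 : ∑ r, D.omega r i x y • f (D.s r * D.s i) =
        ∑ r, D.omega r i x y • f (D.s i * D.s r) := by
      rw [← Equiv.sum_comp (D.perm i)]
      refine Finset.sum_congr rfl fun r _ => ?_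
      by_cases hr : r = i
      · rw [hr, D.perm_self i hi]
      · congr 1
        · simp only [omega, D.co_perm i hi r hr, D.act_s, map_sub, map_smul, smul_eq_mul]
          ring
        · rw [D.s_perm i hi]
          simp only [mul_assoc, D.s_mul_self, mul_one]
    have key : ∑ r, ∑ r', D.omega r r' (D.act (D.s i) x) (D.act (D.s i) y) • f (D.s r' * D.s r) =
        ∑ r, ∑ r', (D.omega r r' x y - 2 * (if r = i then D.omega i r' x y else 0)
          - 2 * (if r' = i then D.omega r i x y else 0)) • g (D.s r' * D.s r) := by
      rw [← Equiv.sum_comp (D.perm i)]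
      refine Finset.sum_congr rfl fun r _ => ?_
      rw [← Equiv.sum_comp (D.perm i)]
      refine Finset.sum_congr rfl fun r' _ => ?_
      rw [hom, hfs]
    rw [key]
    simp only [sub_smul, Finset.sum_sub_distrib, mul_smul, ite_smul, zero_smul]
    rw [sub_sub, sub_eq_self]
    have e1 : ∑ r, ∑ r', (2 : ℝ) • (if r = i then D.omega i r' x y • g (D.s r' * D.s r) else 0) =
        - (2 : ℝ) • ∑ r, D.omega r i x y • f (D.s i * D.s r) := by
      rw [Finset.sum_eq_single i (by intro b _ hb; simp [hb]) (by simp), Finset.smul_sum]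
      refine Finset.sum_congr rfl fun r _ => ?_
      rw [if_pos rfl, neg_smul, ← smul_neg, ← neg_smul]
      congr 2
      · simp only [omega]; ring
      · simp only [hg, D.s_inv, mul_assoc, D.s_mul_self, mul_one]
    have e2 : ∑ r, ∑ r', (2 : ℝ) • (if r' = i then D.omega r i x y • g (D.s r' * D.s r) else 0) =
        (2 : ℝ) • ∑ r, D.omega r i x y • f (D.s r * D.s i) := by
      rw [Finset.smul_sum]
      refine Finset.sum_congr rfl fun r _ => ?_
      rw [Finset.sum_eq_single i (by intro b _ hb; simp [hb]) (by simp), if_pos rfl]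
      congr 2
      simp only [hg, D.s_inv, mul_assoc, D.s_mul_s_mul]
    rw [e1, e2, h1, neg_smul, neg_add_cancel]

end ReflectionDatum

/-! ### Graded Hecke modules and their commuting operators -/

/-- The operators `½ ∑ c_r(x) s_r` of a representation of the reflection group. -/
noncomputable def reflSum {V W R : Type*} [AddCommGroup V] [Module ℝ V] [Group W] [Fintype R]
    (D : ReflectionDatum V W R) {L : Type*} [AddCommGroup L] [Module ℝ L] (ρ : W →* End ℝ L) :
    V →ₗ[ℝ] End ℝ L :=
  (2⁻¹ : ℝ) • ∑ r, (D.co r).smulRight (ρ (D.s r))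

/-- A module over the graded Hecke algebra of a reflection datum, in the presentation by operators
`X x` on which the group acts by conjugation. -/
structure HeckeModule {V W R : Type*} [AddCommGroup V] [Module ℝ V] [Group W] [Fintype R]
    (D : ReflectionDatum V W R) (L : Type*) [AddCommGroup L] [Module ℝ L] where
  rho : W →* End ℝ L
  X : V →ₗ[ℝ] End ℝ L
  rho_X : ∀ w x l, rho w (X x l) = X (D.act w x) (rho w l)
  comm : ∀ x y, X x * X y - X y * X x =
    reflSum D rho y * reflSum D rho x - reflSum D rho x * reflSum D rho y

section

variable {V W R : Type*} [AddCommGroup V] [Module ℝ V] [Group W] [Fintype R]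
  {D : ReflectionDatum V W R} {L : Type*} [AddCommGroup L] [Module ℝ L]

theorem reflSum_apply (ρ : W →* End ℝ L) (x : V) (l : L) :
    reflSum D ρ x l = (2⁻¹ : ℝ) • ∑ r, D.co r x • ρ (D.s r) l := by
  simp [reflSum]

theorem reflSum_comm_apply (ρ : W →* End ℝ L) (x y : V) (l : L) :
    (reflSum D ρ x * reflSum D ρ y - reflSum D ρ y * reflSum D ρ x) l =
      (4⁻¹ : ℝ) • ∑ r, ∑ r', D.omega r r' x y • ρ (D.s r * D.s r') l := by
  have h4 : (4⁻¹ : ℝ) = 2⁻¹ * 2⁻¹ := by norm_num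
  simp only [LinearMap.sub_apply, End.mul_apply, reflSum_apply, map_smul, map_sum, h4, mul_smul,
    ← smul_sub, map_mul]
  simp only [Finset.smul_sum, ← Finset.sum_sub_distrib]
  conv_rhs => rw [Finset.sum_comm]
  refine Finset.sum_congr rfl fun r _ => Finset.sum_congr rfl fun r' _ => ?_
  simp only [ReflectionDatum.omega]
  module

/-- The commutator equals `-½ ∑ c_r(x) c_r(y) s_r X(root r)`, which is symmetric in `x` and `y`. -/
theorem commutator_reflSum (ρ : W →* End ℝ L) (X : V →ₗ[ℝ] End ℝ L)
    (hX : ∀ w x l, ρ w (X x l) = X (D.act w x) (ρ w l)) (x y : V) :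
    X x * reflSum D ρ y - reflSum D ρ y * X x = X y * reflSum D ρ x - reflSum D ρ x * X y := by
  have hXs : ∀ z r l, X z (ρ (D.s r) l) =
      ρ (D.s r) (X z l) - D.co r z • ρ (D.s r) (X (D.root r) l) := by
    intro z r l
    have h : z = D.act (D.s r) (D.act (D.s r) z) := by
      rw [← D.act_mul, D.s_mul_self, D.act_one]
    conv_lhs => rw [h, ← hX, D.act_s]
    simp
  have key : ∀ x y l, (X x * reflSum D ρ y - reflSum D ρ y * X x) l =
      -(2⁻¹ : ℝ) • ∑ r, (D.co r y * D.co r x) • ρ (D.s r) (X (D.root r) l) := by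
    intro x y l
    simp only [LinearMap.sub_apply, End.mul_apply, reflSum_apply, map_smul, map_sum, hXs, neg_smul,
      ← smul_sub, ← smul_neg, ← Finset.sum_sub_distrib, ← Finset.sum_neg_distrib]
    congr 1
    refine Finset.sum_congr rfl fun r _ => ?_
    module
  refine LinearMap.ext fun l => ?_
  rw [key, key]
  simp only [mul_comm]

/-- The simple reflection permutes the other positive roots; the sign at its own root produces the
extra term. -/
theorem rho_reflSum (ρ : W →* End ℝ L) {i : R} (hi : i ∈ D.simple) (x : V) (l : L) :
    ρ (D.s i) (reflSum D ρ x l) =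
      reflSum D ρ (D.act (D.s i) x) (ρ (D.s i) l) + D.co i x • l := by
  classical
  have hρ : ∀ u w l, ρ u (ρ w l) = ρ (u * w) l := fun u w l => by rw [map_mul]; rfl
  have h1 : ∑ r, D.co r (D.act (D.s i) x) • ρ (D.s r * D.s i) l =
      ∑ r, (D.co r x - if r = i then 2 * D.co i x else 0) • ρ (D.s i * D.s r) l := by
    rw [← Equiv.sum_comp (D.perm i)]
    refine Finset.sum_congr rfl fun r _ => ?_
    rw [D.s_perm i hi]
    simp only [mul_assoc, D.s_mul_self, mul_one]
    congr 1
    split_ifs with hr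
    · rw [hr, D.perm_self i hi, D.co_act_s]; ring
    · rw [D.co_perm i hi r hr, ← D.act_mul, D.s_mul_self, D.act_one, sub_zero]
  simp only [reflSum_apply, map_smul, map_sum, hρ, h1]
  simp only [sub_smul, Finset.sum_sub_distrib, ite_smul, zero_smul, Finset.sum_ite_eq',
    Finset.mem_univ, if_true, D.s_mul_self, map_one, End.one_apply, mul_smul]
  module

end

namespace HeckeModule

variable {V W R : Type*} [AddCommGroup V] [Module ℝ V] [Group W] [Fintype R]
  {D : ReflectionDatum V W R} {L : Type*} [AddCommGroup L] [Module ℝ L] (M : HeckeModule D L)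

theorem rho_mul (u w : W) (l : L) : M.rho (u * w) l = M.rho u (M.rho w l) := by
  rw [map_mul]; rfl

@[simp]
theorem rho_one (l : L) : M.rho 1 l = l := by
  rw [map_one]; rfl

/-- The commuting operators `X x + σ / 2 ∑ c_r(x) s_r`, for `σ = 1` or `σ = -1`. -/
noncomputable def shift (σ : ℝ) : V →ₗ[ℝ] End ℝ L := M.X + σ • reflSum D M.rho

theorem shift_apply (σ : ℝ) (x : V) (l : L) :
    M.shift σ x l = M.X x l + σ • (2⁻¹ : ℝ) • ∑ r, D.co r x • M.rho (D.s r) l := by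
  simp [shift, reflSum_apply]

theorem X_reflSum (x y : V) : M.X x * reflSum D M.rho y - reflSum D M.rho y * M.X x =
    M.X y * reflSum D M.rho x - reflSum D M.rho x * M.X y :=
  commutator_reflSum M.rho M.X M.rho_X x y

/-- The mixed commutators cancel by symmetry and the rest is `σ ^ 2 - 1` times a commutator of
reflection sums. Both signs are used: 1 to embed a module in a coinduced one, -1 to define the
differential on forms. -/
theorem shift_comm {σ : ℝ} (hσ : σ ^ 2 = 1) (x y : V) :
    M.shift σ x * M.shift σ y = M.shift σ y * M.shift σ x := by
  have h1 := M.comm x y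
  have h2 := M.X_reflSum x y
  rw [← sub_eq_zero] at h1 h2 ⊢
  have h3 : M.shift σ x * M.shift σ y - M.shift σ y * M.shift σ x =
      (M.X x * M.X y - M.X y * M.X x - (reflSum D M.rho y * reflSum D M.rho x -
        reflSum D M.rho x * reflSum D M.rho y)) +
      σ • (M.X x * reflSum D M.rho y - reflSum D M.rho y * M.X x -
        (M.X y * reflSum D M.rho x - reflSum D M.rho x * M.X y)) +
      (σ ^ 2 - 1) • (reflSum D M.rho x * reflSum D M.rho y -
        reflSum D M.rho y * reflSum D M.rho x) := by
    simp only [shift, LinearMap.add_apply, LinearMap.smul_apply, add_mul, mul_add, smul_mul_assoc,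
      mul_smul_comm]
    module
  rw [h3, h1, h2, hσ]
  simp

/-- The relation between simple reflections and the commuting operators. -/
theorem rho_shift {σ : ℝ} (i : R) (hi : i ∈ D.simple) (x : V) (l : L) :
    M.rho (D.s i) (M.shift σ x l) =
      M.shift σ (D.act (D.s i) x) (M.rho (D.s i) l) + σ • D.co i x • l := by
  simp only [shift, LinearMap.add_apply, LinearMap.smul_apply, map_add, map_smul, M.rho_X,
    rho_reflSum M.rho hi]
  module

end HeckeModule

/-! ### Coinduced modules -/

section Coinduced

variable {V W R : Type*} [AddCommGroup V] [Module ℝ V] [Group W] [Fintype R]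
  (D : ReflectionDatum V W R) {L : Type*} [AddCommGroup L] [Module ℝ L]

/-- The right regular action on functions on a group. -/
def rightRegular (W L : Type*) [Group W] [AddCommGroup L] [Module ℝ L] : W →* End ℝ (W → L) where
  toFun u := LinearMap.funLeft ℝ L fun w => w * u
  map_one' := by ext; simp
  map_mul' u v := by ext; simp [mul_assoc]

@[simp]
theorem rightRegular_apply (u w : W) (q : W → L) : rightRegular W L u q w = q (w * u) := rfl

/-- The operators `X x` of the module coinduced from a commuting action `B` of `V`. -/
noncomputable def coinducedX (σ : ℝ) (B : V →ₗ[ℝ] End ℝ L) : V →ₗ[ℝ] End ℝ (W → L) where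
  toFun x := LinearMap.pi fun w => B (D.act w x) ∘ₗ LinearMap.proj w +
    σ • (2⁻¹ : ℝ) • ∑ r, D.co r (D.act w x) • LinearMap.proj (D.s r * w)
  map_add' x y := by
    ext q w
    simp only [map_add, LinearMap.pi_apply, LinearMap.add_apply, LinearMap.comp_apply, 
      add_smul, Finset.sum_add_distrib, smul_add, Pi.add_apply]
    abel
  map_smul' c x := by
    ext q w
    simp only [map_smul, LinearMap.pi_apply, LinearMap.add_apply, LinearMap.comp_apply, smul_eq_mul,
      mul_smul, smul_add, Pi.smul_apply, LinearMap.smul_apply, RingHom.id_apply,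
      LinearMap.sum_apply, Finset.smul_sum, smul_comm c]

theorem coinducedX_apply (σ : ℝ) (B : V →ₗ[ℝ] End ℝ L) (x : V) (q : W → L) (w : W) :
    coinducedX D σ B x q w = B (D.act w x) (q w) +
      σ • (2⁻¹ : ℝ) • ∑ r, D.co r (D.act w x) • q (D.s r * w) := by
  simp [coinducedX]

/-- The module coinduced from a commuting action `B` of `V`, realised on functions on `W`. -/
noncomputable def coinduced (σ : ℝ) (hσ : σ ^ 2 = 1) (B : V →ₗ[ℝ] End ℝ L)
    (hB : ∀ x y, B x * B y = B y * B x) : HeckeModule D (W → L) where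
  rho := rightRegular W L
  X := coinducedX D σ B
  rho_X w x q := by
    ext v
    simp only [rightRegular_apply, coinducedX_apply, D.act_mul, mul_assoc]
  comm x y := by
    refine LinearMap.ext fun q => funext fun w => ?_
    rw [reflSum_comm_apply]
    have hBw := LinearMap.congr_fun (hB (D.act w x) (D.act w y)) (q w)
    simp only [End.mul_apply] at hBw
    -- At the component `w` the operators involve left products `s_r' s_r w`, while the relation
    -- asks for the right regular action; equivariance converts the former into `w s_r' s_r`.
    have key := D.sum_omega_act w x y fun u => q (u * w)
    simp only [mul_assoc, inv_mul_cancel, mul_one] at key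
    have hexp : ∀ x y, coinducedX D σ B x (coinducedX D σ B y q) w =
        B (D.act w x) (B (D.act w y) (q w)) +
        σ • (2⁻¹ : ℝ) • ∑ r, (D.co r (D.act w y) • B (D.act w x) (q (D.s r * w)) +
          D.co r (D.act w x) • B (D.act w y) (q (D.s r * w)) -
          (D.co r (D.act w x) * D.co r (D.act w y)) • B (D.root r) (q (D.s r * w))) +
        (4⁻¹ : ℝ) • ∑ r, ∑ r', (D.co r (D.act w x) * D.co r' (D.act w y) -
          D.co r (D.act w x) * D.co r (D.act w y) * D.co r' (D.root r)) •
            q (D.s r' * (D.s r * w)) := by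
      intro x y
      have h4 : (4⁻¹ : ℝ) = σ * 2⁻¹ * (σ * 2⁻¹) := by
        have : σ * 2⁻¹ * (σ * 2⁻¹) = σ ^ 2 * 4⁻¹ := by ring
        rw [this, hσ, one_mul]
      rw [h4]
      simp only [coinducedX_apply, D.act_mul, D.act_s (_ : R) (D.act w y), map_sub,
        map_add, map_smul, map_sum, LinearMap.sub_apply, LinearMap.smul_apply]
      rw [add_assoc, add_assoc]
      congr 1
      simp only [Finset.smul_sum, ← Finset.sum_add_distrib]
      refine Finset.sum_congr rfl fun r _ => ?_
      have h5 : ∑ r', (σ * 2⁻¹ * (σ * 2⁻¹)) • (D.co r (D.act w x) * D.co r' (D.act w y) -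
          D.co r (D.act w x) * D.co r (D.act w y) * D.co r' (D.root r)) •
            q (D.s r' * (D.s r * w)) =
          σ • (2⁻¹ : ℝ) • D.co r (D.act w x) • ∑ r', σ • (2⁻¹ : ℝ) •
            (D.co r' (D.act w y) - D.co r (D.act w y) • D.co r' (D.root r)) •
              q (D.s r' * (D.s r * w)) := by
        simp only [Finset.smul_sum]
        refine Finset.sum_congr rfl fun r' _ => ?_
        rw [smul_eq_mul]
        module
      rw [h5]
      module
    simp only [LinearMap.sub_apply, End.mul_apply, Pi.sub_apply]
    rw [hexp, hexp, hBw, add_sub_add_comm, add_sub_add_comm, sub_self, zero_add, ← smul_sub,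
      ← smul_sub, ← smul_sub, ← Finset.sum_sub_distrib, ← Finset.sum_sub_distrib]
    -- The single sum is symmetric in `x` and `y`, so it drops out of the commutator.
    rw [Finset.sum_eq_zero (fun r _ => by module), smul_zero, smul_zero, zero_add]
    simp only [← Finset.sum_sub_distrib, Pi.smul_apply, Finset.sum_apply, rightRegular_apply]
    congr 1
    have h1 : ∑ r, ∑ r', D.omega r r' y x • q (w * (D.s r * D.s r')) =
        ∑ r, ∑ r', D.omega r r' x y • q (w * (D.s r' * D.s r)) := by
      rw [Finset.sum_comm]
      refine Finset.sum_congr rfl fun r _ => Finset.sum_congr rfl fun r' _ => ?_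
      simp only [ReflectionDatum.omega]
      module
    rw [h1, ← key]
    refine Finset.sum_congr rfl fun r _ => Finset.sum_congr rfl fun r' _ => ?_
    simp only [ReflectionDatum.omega]
    module

variable {D}

/-- Evaluation at the identity is the universal map out of a coinduced module. -/
theorem coinduced_shift_apply_one {σ τ : ℝ} (hσ : σ ^ 2 = 1) (B : V →ₗ[ℝ] End ℝ L)
    (hB : ∀ x y, B x * B y = B y * B x) (hτ : σ + τ = 0) (x : V) (q : W → L) :
    (coinduced D σ hσ B hB).shift τ x q 1 = B x (q 1) := by
  rw [HeckeModule.shift_apply]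
  simp only [coinduced, Pi.add_apply, coinducedX_apply, D.act_one, mul_one, Pi.smul_apply,
    Finset.sum_apply, rightRegular_apply, one_mul]
  rw [add_assoc, ← add_smul, hτ, zero_smul, add_zero]

/-- The functions supported at the identity. -/
theorem coinduced_shift_single [DecidableEq W] {σ : ℝ} (hσ : σ ^ 2 = 1) (B : V →ₗ[ℝ] End ℝ L)
    (hB : ∀ x y, B x * B y = B y * B x) (x : V) (l : L) :
    (coinduced D σ hσ B hB).shift σ x (Pi.single 1 l) = Pi.single 1 (B x l) := by
  rw [HeckeModule.shift_apply]
  funext w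
  simp only [coinduced, Pi.add_apply, coinducedX_apply, Pi.smul_apply,
    Finset.sum_apply, rightRegular_apply]
  rw [add_assoc, ← smul_add, ← smul_add, ← Finset.sum_add_distrib, Finset.sum_eq_zero,
    smul_zero, smul_zero, add_zero]
  · by_cases hw : w = 1
    · subst hw; simp
    · simp [Pi.single_eq_of_ne hw]
  · intro r _
    by_cases hw : w = D.s r
    -- At `w = s r` the left contribution has coefficient `c_r(s_r x) = -c_r(x)` and cancels the
    -- right one. Hence the coinduced module is also induced, with respect to the opposite shift.
    · rw [hw, D.s_mul_self, Pi.single_eq_same, D.co_act_s, neg_smul, neg_add_cancel]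
    · rw [Pi.single_eq_of_ne, Pi.single_eq_of_ne, smul_zero, smul_zero, add_zero]
      · intro h
        exact hw ((eq_inv_of_mul_eq_one_left h).trans (D.s_inv r))
      · intro h
        exact hw ((eq_inv_of_mul_eq_one_right h).trans (D.s_inv r))

end Coinduced

end RootRegions

namespace RootRegions

open Module

/-! ### Pullback of alternating forms along reflections -/

section Reflection

variable {V N : Type*} [AddCommGroup V] [Module ℝ V] [AddCommGroup N] [Module ℝ N]

theorem curryLeft_curryLeft_comm {k : ℕ} (ω : V [⋀^Fin (k + 2)]→ₗ[ℝ] N) (x y : V) :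
    (ω.curryLeft x).curryLeft y = -(ω.curryLeft y).curryLeft x := by
  have h := ω.curryLeft_same (x + y)
  have h1 : (ω.curryLeft (x + y)).curryLeft (x + y) =
      (ω.curryLeft x).curryLeft x + (ω.curryLeft x).curryLeft y +
        ((ω.curryLeft y).curryLeft x + (ω.curryLeft y).curryLeft y) := by
    simp only [map_add, AlternatingMap.curryLeft_add, LinearMap.add_apply]
    abel
  rw [h1, ω.curryLeft_same, ω.curryLeft_same, zero_add, add_zero] at h
  exact eq_neg_of_add_eq_zero_left h

theorem ext_curryLeft {k : ℕ} {ω η : V [⋀^Fin (k + 1)]→ₗ[ℝ] N}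
    (h : ∀ y, ω.curryLeft y = η.curryLeft y) : ω = η := by
  ext v
  have := AlternatingMap.congr_fun (h (v 0)) (Fin.tail v)
  simp only [AlternatingMap.curryLeft_apply_apply] at this
  have hv : Matrix.vecCons (v 0) (Fin.tail v) = v := Fin.cons_self_tail v
  rwa [hv] at this

/-- The pullback of an alternating form along a reflection. -/
theorem compLinearMap_reflection (c : V →ₗ[ℝ] ℝ) (a : V) (s : V →ₗ[ℝ] V)
    (hs : ∀ x, s x = x - c x • a) {k : ℕ} : ∀ ω : V [⋀^Fin (k + 1)]→ₗ[ℝ] N,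
      ω.compLinearMap s = ω - koszulD (c.smulRight (1 : End ℝ N)) (ω.curryLeft a) := by
  have hsub : ∀ {k : ℕ} (ω η : V [⋀^Fin (k + 1)]→ₗ[ℝ] N) (y : V),
      (ω - η).curryLeft y = ω.curryLeft y - η.curryLeft y := fun _ _ _ => rfl
  induction k with
  | zero =>
    intro ω
    refine ext_curryLeft fun y => ?_
    rw [AlternatingMap.curryLeft_compLinearMap, hs, map_sub, map_smul, hsub]
    ext v
    have hv : ∀ v' : Fin 0 → V, v' = v := fun v' => Subsingleton.elim _ _
    simp only [AlternatingMap.compLinearMap_apply, AlternatingMap.sub_apply, AlternatingMap.smul_apply,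
      AlternatingMap.curryLeft_apply_apply, koszulD_apply]
    rw [hv fun i => s (v i)]
    have hr : (0 : Fin 1).removeNth (Matrix.vecCons y v) = v := Subsingleton.elim _ _
    simp [hr]
  | succ k ih =>
    intro ω
    refine ext_curryLeft fun y => ?_
    rw [AlternatingMap.curryLeft_compLinearMap, hs, map_sub, map_smul, hsub, koszulD_curryLeft,
      curryLeft_curryLeft_comm ω a y]
    have h1 := ih (ω.curryLeft y)
    have h2 := ih (ω.curryLeft a)
    rw [ω.curryLeft_same, koszulD_zero, sub_zero] at h2
    have h3 : (ω.curryLeft y - c y • ω.curryLeft a).compLinearMap s =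
        (ω.curryLeft y).compLinearMap s - c y • (ω.curryLeft a).compLinearMap s := rfl
    have h4 : koszulD (c.smulRight (1 : End ℝ N)) (-((ω.curryLeft y).curryLeft a)) =
        - koszulD (c.smulRight (1 : End ℝ N)) ((ω.curryLeft y).curryLeft a) := by
      rw [← zero_sub, koszulD_sub, koszulD_zero, zero_sub]
    have h5 : (c.smulRight (1 : End ℝ N) y).compAlternatingMap (ω.curryLeft a) =
        c y • ω.curryLeft a := by ext; simp
    rw [h3, h1, h2, h4, h5]
    abel

/-- Wedging with the form defining a reflection kills the difference between a form and its
pullback. -/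
theorem koszulD_compLinearMap_reflection (c : V →ₗ[ℝ] ℝ) (a : V) (s : V →ₗ[ℝ] V)
    (hs : ∀ x, s x = x - c x • a) {k : ℕ} (ω : V [⋀^Fin k]→ₗ[ℝ] N) :
    koszulD (c.smulRight (1 : End ℝ N)) (ω.compLinearMap s) =
      koszulD (c.smulRight (1 : End ℝ N)) ω := by
  rcases k with _ | k
  · congr 1
    ext v
    exact congrArg ω (Subsingleton.elim _ _)
  · rw [compLinearMap_reflection c a s hs, koszulD_sub, koszulD_koszulD, sub_zero]
    intro x y
    refine LinearMap.ext fun n => ?_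
    simp only [End.mul_apply, LinearMap.smulRight_apply, LinearMap.smul_apply, End.one_apply]
    exact smul_comm _ _ _

end Reflection

/-! ### The complex of equivariant forms -/

section Forms

variable {V W R : Type*} [AddCommGroup V] [Module ℝ V] [Group W] [Fintype R]
  {D : ReflectionDatum V W R} {L L' N : Type*} [AddCommGroup L] [Module ℝ L]
  [AddCommGroup L'] [Module ℝ L'] [AddCommGroup N] [Module ℝ N]
  {M : HeckeModule D L} {M' : HeckeModule D L'} {I : HeckeModule D N} {k : ℕ}

/-- Alternating forms on `V` with values in `Hom(L, N)` that are equivariant under `W`. -/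
def IsEquivariantForm (M : HeckeModule D L) (I : HeckeModule D N)
    (ω : V [⋀^Fin k]→ₗ[ℝ] (L →ₗ[ℝ] N)) : Prop :=
  ∀ w v l, ω (fun j => D.act w (v j)) (M.rho w l) = I.rho w (ω v l)

/-- The differential on forms with values in `Hom(L, N)`. -/
noncomputable def formD (M : HeckeModule D L) (I : HeckeModule D N)
    (ω : V [⋀^Fin k]→ₗ[ℝ] (L →ₗ[ℝ] N)) : V [⋀^Fin (k + 1)]→ₗ[ℝ] (L →ₗ[ℝ] N) :=
  koszulD (homAction (I.shift (-1)) (M.shift (-1))) ω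

theorem koszulD_homAction_apply (A : V →ₗ[ℝ] End ℝ N) (B : V →ₗ[ℝ] End ℝ L)
    (ω : V [⋀^Fin k]→ₗ[ℝ] (L →ₗ[ℝ] N)) (v : Fin (k + 1) → V) (l : L) :
    koszulD (homAction A B) ω v l = ∑ i : Fin (k + 1), (-1 : ℤ) ^ (i : ℕ) •
      (A (v i) (ω (i.removeNth v) l) - ω (i.removeNth v) (B (v i) l)) := by
  simp [koszulD_apply, LinearMap.sum_apply]

/-- The reflection parts of the shifts drop out: by equivariance the part belonging to `r` is `c_r`
wedged with the difference between the pullback of `ω` along `s r` and `ω`, which vanishes. -/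
theorem IsEquivariantForm.formD_apply {ω : V [⋀^Fin k]→ₗ[ℝ] (L →ₗ[ℝ] N)}
    (hω : IsEquivariantForm M I ω) (v : Fin (k + 1) → V) (l : L) :
    formD M I ω v l = koszulD (homAction I.X M.X) ω v l := by
  have h1 : ∀ r, ∑ i : Fin (k + 1), (-1 : ℤ) ^ (i : ℕ) • D.co r (v i) •
      (I.rho (D.s r) (ω (i.removeNth v) l) - ω (i.removeNth v) (M.rho (D.s r) l)) = 0 := by
    intro r
    have h2 := koszulD_compLinearMap_reflection (D.co r) (D.root r) (D.act (D.s r))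
      (D.act_s r) ω
    rw [← sub_eq_zero, ← koszulD_sub] at h2
    have h3 := LinearMap.congr_fun (AlternatingMap.congr_fun h2 v) (M.rho (D.s r) l)
    simp only [koszulD_apply, LinearMap.sum_apply] at h3
    rw [AlternatingMap.zero_apply, LinearMap.zero_apply] at h3
    rw [← h3]
    refine Finset.sum_congr rfl fun i _ => ?_
    rw [← hω]
    simp
  rw [formD, koszulD_homAction_apply, koszulD_homAction_apply, ← sub_eq_zero,
    ← Finset.sum_sub_distrib]
  have h2 : ∀ i : Fin (k + 1), (-1 : ℤ) ^ (i : ℕ) • (I.shift (-1) (v i) (ω (i.removeNth v) l) -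
      ω (i.removeNth v) (M.shift (-1) (v i) l)) - (-1 : ℤ) ^ (i : ℕ) •
      (I.X (v i) (ω (i.removeNth v) l) - ω (i.removeNth v) (M.X (v i) l)) =
      (-2⁻¹ : ℝ) • ∑ r, (-1 : ℤ) ^ (i : ℕ) • D.co r (v i) •
      (I.rho (D.s r) (ω (i.removeNth v) l) - ω (i.removeNth v) (M.rho (D.s r) l)) := by
    intro i
    simp only [HeckeModule.shift_apply, map_add, map_smul, map_sum, smul_sub,
      Finset.sum_sub_distrib, Finset.smul_sum, smul_add]
    rw [← sub_eq_zero]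
    simp only [← Finset.smul_sum]
    module
  simp only [h2]
  rw [← Finset.smul_sum, Finset.sum_comm]
  simp only [h1, Finset.sum_const_zero, smul_zero]

/-- The group permutes the operators `X`, though not the shifted ones, so equivariance is visible
once the differential is written with `X`. -/
theorem IsEquivariantForm.formD {ω : V [⋀^Fin k]→ₗ[ℝ] (L →ₗ[ℝ] N)}
    (hω : IsEquivariantForm M I ω) : IsEquivariantForm M I (formD M I ω) := by
  intro w v l
  rw [hω.formD_apply, hω.formD_apply, koszulD_homAction_apply, koszulD_homAction_apply, map_sum]
  refine Finset.sum_congr rfl fun i _ => ?_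
  rw [map_zsmul, map_sub, I.rho_X, ← hω, ← hω, M.rho_X]
  rfl

/-- Homomorphisms of Hecke modules. -/
structure IsHeckeHom (M : HeckeModule D L) (M' : HeckeModule D L') (f : L →ₗ[ℝ] L') : Prop where
  rho : ∀ w l, f (M.rho w l) = M'.rho w (f l)
  X : ∀ x l, f (M.X x l) = M'.X x (f l)

theorem IsHeckeHom.shift {f : L →ₗ[ℝ] L'} (hf : IsHeckeHom M M' f) (σ : ℝ) (x : V) (l : L) :
    f (M.shift σ x l) = M'.shift σ x (f l) := by
  simp only [HeckeModule.shift_apply, map_add, map_smul, map_sum, hf.rho, hf.X]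

theorem IsHeckeHom.of_shift {f : L →ₗ[ℝ] L'} {σ : ℝ} (h1 : ∀ w l, f (M.rho w l) = M'.rho w (f l))
    (h2 : ∀ x l, f (M.shift σ x l) = M'.shift σ x (f l)) : IsHeckeHom M M' f := by
  refine ⟨h1, fun x l => ?_⟩
  have := h2 x l
  simpa only [HeckeModule.shift_apply, map_add, map_smul, map_sum, h1, add_left_inj] using this

theorem IsHeckeHom.comp {L'' : Type*} [AddCommGroup L''] [Module ℝ L''] {M'' : HeckeModule D L''}
    {g : L' →ₗ[ℝ] L''} {f : L →ₗ[ℝ] L'} (hg : IsHeckeHom M' M'' g) (hf : IsHeckeHom M M' f) :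
    IsHeckeHom M M'' (g ∘ₗ f) :=
  ⟨fun w l => by simp [hf.rho, hg.rho], fun x l => by simp [hf.X, hg.X]⟩

/-- The pullback of a form along a linear map in the first variable. -/
def formComp (f : L →ₗ[ℝ] L') (ω : V [⋀^Fin k]→ₗ[ℝ] (L' →ₗ[ℝ] N)) :
    V [⋀^Fin k]→ₗ[ℝ] (L →ₗ[ℝ] N) :=
  (LinearMap.lcomp ℝ N f).compAlternatingMap ω

@[simp]
theorem formComp_apply (f : L →ₗ[ℝ] L') (ω : V [⋀^Fin k]→ₗ[ℝ] (L' →ₗ[ℝ] N)) (v : Fin k → V)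
    (l : L) : formComp f ω v l = ω v (f l) := rfl

theorem koszulD_formComp {A : V →ₗ[ℝ] End ℝ N} {B : V →ₗ[ℝ] End ℝ L} {B' : V →ₗ[ℝ] End ℝ L'}
    {f : L →ₗ[ℝ] L'} (hf : ∀ x l, f (B x l) = B' x (f l))
    (ω : V [⋀^Fin k]→ₗ[ℝ] (L' →ₗ[ℝ] N)) :
    koszulD (homAction A B) (formComp f ω) = formComp f (koszulD (homAction A B') ω) := by
  refine koszulD_comp _ _ (LinearMap.lcomp ℝ N f) (fun x n => ?_) ω
  ext l
  simp [hf]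

theorem formD_formComp {f : L →ₗ[ℝ] L'} (hf : IsHeckeHom M M' f)
    (ω : V [⋀^Fin k]→ₗ[ℝ] (L' →ₗ[ℝ] N)) :
    formD M I (formComp f ω) = formComp f (formD M' I ω) :=
  koszulD_formComp (hf.shift _) ω

theorem formD_formD (ω : V [⋀^Fin k]→ₗ[ℝ] (L →ₗ[ℝ] N)) : formD M I (formD M I ω) = 0 :=
  koszulD_koszulD _ (homAction_comm (I.shift_comm (by norm_num)) (M.shift_comm (by norm_num))) ω

theorem formD_sub (ω η : V [⋀^Fin k]→ₗ[ℝ] (L →ₗ[ℝ] N)) :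
    formD M I (ω - η) = formD M I ω - formD M I η := koszulD_sub _ _ _

theorem IsEquivariantForm.formComp {f : L →ₗ[ℝ] L'} (hf : ∀ w l, f (M.rho w l) = M'.rho w (f l))
    {ω : V [⋀^Fin k]→ₗ[ℝ] (L' →ₗ[ℝ] N)} (hω : IsEquivariantForm M' I ω) :
    IsEquivariantForm M I (formComp f ω) := by
  intro w v l
  rw [formComp_apply, formComp_apply, hf, hω]

theorem IsEquivariantForm.sub {ω η : V [⋀^Fin k]→ₗ[ℝ] (L →ₗ[ℝ] N)}
    (hω : IsEquivariantForm M I ω) (hη : IsEquivariantForm M I η) :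
    IsEquivariantForm M I (ω - η) := by
  intro w v l
  simp [hω w v l, hη w v l]

/-- A form that vanishes on the kernel of a surjection descends along it. -/
theorem exists_formComp_eq {f : L →ₗ[ℝ] L'} (hf : Function.Surjective f)
    {ω : V [⋀^Fin k]→ₗ[ℝ] (L →ₗ[ℝ] N)} (hω : ∀ v l, f l = 0 → ω v l = 0) :
    ∃ η : V [⋀^Fin k]→ₗ[ℝ] (L' →ₗ[ℝ] N), formComp f η = ω := by
  obtain ⟨g, hg⟩ := f.exists_rightInverse_of_surjective (LinearMap.range_eq_top.2 hf)
  refine ⟨RootRegions.formComp g ω, ?_⟩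
  ext v l
  rw [formComp_apply, formComp_apply, ← sub_eq_zero, ← map_sub]
  apply hω
  rw [map_sub, sub_eq_zero]
  exact LinearMap.congr_fun hg (f l)

theorem formComp_injective {f : L →ₗ[ℝ] L'} (hf : Function.Surjective f)
    {ω η : V [⋀^Fin k]→ₗ[ℝ] (L' →ₗ[ℝ] N)} (h : formComp f ω = formComp f η) : ω = η := by
  ext v l
  obtain ⟨l, rfl⟩ := hf l
  exact LinearMap.congr_fun (AlternatingMap.congr_fun h v) l

theorem IsEquivariantForm.of_formComp {f : L →ₗ[ℝ] L'} (hf : Function.Surjective f)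
    (hfr : ∀ w l, f (M.rho w l) = M'.rho w (f l)) {ω : V [⋀^Fin k]→ₗ[ℝ] (L' →ₗ[ℝ] N)}
    (hω : IsEquivariantForm M I (RootRegions.formComp f ω)) : IsEquivariantForm M' I ω := by
  intro w v l
  obtain ⟨l, rfl⟩ := hf l
  rw [← hfr]
  exact hω w v l

/-- The quotient of a Hecke module by a submodule. -/
def HeckeModule.quot (M : HeckeModule D L) (K : Submodule ℝ L) (hρ : ∀ w, K ≤ K.comap (M.rho w))
    (hX : ∀ x, K ≤ K.comap (M.X x)) : HeckeModule D (L ⧸ K) where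
  rho :=
    { toFun := fun w => K.mapQ K (M.rho w) (hρ w)
      map_one' := by ext; simp
      map_mul' := fun u w => by ext; simp }
  X :=
    { toFun := fun x => K.mapQ K (M.X x) (hX x)
      map_add' := fun x y => by ext; simp
      map_smul' := fun c x => by ext; simp }
  rho_X w x l := by
    obtain ⟨l, rfl⟩ := K.mkQ_surjective l
    exact congrArg K.mkQ (M.rho_X w x l)
  comm x y := by
    ext l
    have := congrArg K.mkQ (LinearMap.congr_fun (M.comm x y) l)
    simp only [LinearMap.sub_apply, End.mul_apply, map_sub, reflSum_apply, map_smul, map_sum] at this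
    simpa [reflSum_apply] using this

theorem isHeckeHom_mkQ (M : HeckeModule D L) (K : Submodule ℝ L) (hρ : ∀ w, K ≤ K.comap (M.rho w))
    (hX : ∀ x, K ≤ K.comap (M.X x)) : IsHeckeHom M (M.quot K hρ hX) K.mkQ :=
  ⟨fun _ _ => rfl, fun _ _ => rfl⟩

end Forms

end RootRegions

namespace RootRegions

open Module

/-! ### Vanishing of cohomology and extension of homomorphisms -/

section Vanishing

universe u

variable {V R : Type*} {W : Type u} [AddCommGroup V] [Module ℝ V] [Group W] [Fintype R]
  {D : ReflectionDatum V W R} {N : Type*} [AddCommGroup N] [Module ℝ N]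

/-- The embedding of a Hecke module into a coinduced one. -/
def toCoinduced (W : Type*) [Group W] {L : Type*} [AddCommGroup L] [Module ℝ L]
    (ρ : W →* End ℝ L) : L →ₗ[ℝ] (W → L) := LinearMap.pi fun w => ρ w

/-- The reflection sum in `shift 1` cancels the one in the coinduced operators of sign -1, leaving
`X`. -/
theorem isHeckeHom_toCoinduced {L : Type*} [AddCommGroup L] [Module ℝ L] (M : HeckeModule D L) :
    IsHeckeHom M (coinduced D (-1) (by norm_num) (M.shift 1) (M.shift_comm (by norm_num)))
      (toCoinduced W M.rho) := by
  constructor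
  · intro w l
    ext v
    simp [toCoinduced, coinduced]
  · intro x l
    ext w
    simp only [toCoinduced, coinduced, coinducedX_apply, LinearMap.pi_apply, M.rho_X,
      HeckeModule.shift_apply, M.rho_mul]
    module

variable [Fintype W]

/-- The averaged left inverse of `toCoinduced`. -/
noncomputable def coinducedAverage {L : Type*} [AddCommGroup L] [Module ℝ L]
    (ρ : W →* End ℝ L) : (W → L) →ₗ[ℝ] L :=
  (Fintype.card W : ℝ)⁻¹ • ∑ w, ρ w⁻¹ ∘ₗ LinearMap.proj w

theorem coinducedAverage_apply {L : Type*} [AddCommGroup L] [Module ℝ L]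
    (ρ : W →* End ℝ L) (q : W → L) :
    coinducedAverage ρ q = (Fintype.card W : ℝ)⁻¹ • ∑ w, ρ w⁻¹ (q w) := by
  simp [coinducedAverage]

theorem coinducedAverage_toCoinduced {L : Type*} [AddCommGroup L] [Module ℝ L]
    (ρ : W →* End ℝ L) (l : L) : coinducedAverage ρ (toCoinduced W ρ l) = l := by
  have h : ∀ w, ρ w⁻¹ (ρ w l) = l := fun w => by
    rw [← End.mul_apply, ← map_mul, inv_mul_cancel, map_one, End.one_apply]
  rw [coinducedAverage_apply]
  simp only [toCoinduced, LinearMap.pi_apply, h, Finset.sum_const, Finset.card_univ]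
  rw [← Nat.cast_smul_eq_nsmul ℝ, inv_smul_smul₀ (Nat.cast_ne_zero.2 Fintype.card_ne_zero)]

theorem coinducedAverage_rightRegular {L : Type*} [AddCommGroup L] [Module ℝ L]
    (ρ : W →* End ℝ L) (u : W) (q : W → L) :
    coinducedAverage ρ (rightRegular W L u q) = ρ u (coinducedAverage ρ q) := by
  rw [coinducedAverage_apply, coinducedAverage_apply, map_smul, map_sum,
    ← Equiv.sum_comp (Equiv.mulRight u⁻¹)]
  congr 1
  refine Finset.sum_congr rfl fun w _ => ?_
  simp [← End.mul_apply, ← map_mul]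

/-- Closed forms on coinduced modules are exact. -/
theorem exists_formD_eq_coinduced {I : HeckeModule D N} {L : Type*} [AddCommGroup L] [Module ℝ L]
    {B : V →ₗ[ℝ] End ℝ L} (hB : ∀ x y, B x * B y = B y * B x) {σ : ℝ} (hσ : σ ^ 2 = 1)
    (hσ' : σ = -1) (hI : KoszulAcyclic (homAction (I.shift (-1)) B)) {k : ℕ}
    {ω : V [⋀^Fin (k + 1)]→ₗ[ℝ] ((W → L) →ₗ[ℝ] N)}
    (hω : IsEquivariantForm (coinduced D σ hσ B hB) I ω)
    (hd : formD (coinduced D σ hσ B hB) I ω = 0) :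
    ∃ η : V [⋀^Fin k]→ₗ[ℝ] ((W → L) →ₗ[ℝ] N),
      IsEquivariantForm (coinduced D σ hσ B hB) I η ∧ formD (coinduced D σ hσ B hB) I η = ω := by
  classical
  subst hσ'
  set Q := coinduced D (-1) hσ B hB with hQ
  let δ : L →ₗ[ℝ] (W → L) := LinearMap.single ℝ (fun _ => L) 1
  have hδ : ∀ x l, δ (B x l) = Q.shift (-1) x (δ l) := fun x l =>
    (coinduced_shift_single hσ B hB x l).symm
  have hrho : ∀ u q w, Q.rho u q w = q (w * u) := fun _ _ _ => rfl
  have hsingle : ∀ w l, (Pi.single w l : W → L) = Q.rho w⁻¹ (δ l) := by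
    intro w l
    ext v
    rw [hrho]
    by_cases h : v = w
    · subst h; simp [δ]
    · rw [Pi.single_eq_of_ne h]
      have : v * w⁻¹ ≠ 1 := fun h' => h (mul_inv_eq_one.1 h')
      simp [δ, Pi.single_eq_of_ne this]
  -- Translates of functions supported at 1 span, so an equivariant form is determined by its
  -- restriction along `δ`.
  have hext : ∀ {m : ℕ} (α β : V [⋀^Fin m]→ₗ[ℝ] ((W → L) →ₗ[ℝ] N)),
      IsEquivariantForm Q I α → IsEquivariantForm Q I β → formComp δ α = formComp δ β →
      α = β := by
    intro m α β hα hβ h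
    ext v : 1
    refine LinearMap.pi_ext fun w l => ?_
    have hv : v = fun j => D.act w⁻¹ (D.act w (v j)) := by ext; simp
    rw [hsingle, hv, hα, hβ]
    exact congrArg _ (LinearMap.congr_fun (AlternatingMap.congr_fun h _) l)
  obtain ⟨η₁, hη₁⟩ := hI k (formComp δ ω) (by
    rw [koszulD_formComp hδ]
    change formComp δ (formD Q I ω) = 0
    rw [hd]; rfl)
  -- Frobenius reciprocity: the equivariant form that restricts to `η₁` along `δ`.
  let η : V [⋀^Fin k]→ₗ[ℝ] ((W → L) →ₗ[ℝ] N) :=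
    ∑ w, (LinearMap.lcomp ℝ N (LinearMap.proj (R := ℝ) (φ := fun _ : W => L) w) ∘ₗ
      LinearMap.compRight ℝ (I.rho w⁻¹)).compAlternatingMap (η₁.compLinearMap (D.act w))
  have hη : ∀ v q, η v q = ∑ w, I.rho w⁻¹ (η₁ (fun j => D.act w (v j)) (q w)) := by
    intro v q
    simp only [η, alternatingMap_sum_apply, LinearMap.sum_apply]
    rfl
  have hηe : IsEquivariantForm Q I η := by
    intro u v q
    rw [hη, hη, map_sum, ← Equiv.sum_comp (Equiv.mulRight u⁻¹)]
    refine Finset.sum_congr rfl fun w _ => ?_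
    simp [hrho]
  refine ⟨η, hηe, hext _ _ hηe.formD hω ?_⟩
  have h1 : formComp δ η = η₁ := by
    ext v l
    rw [formComp_apply, hη, Finset.sum_eq_single 1]
    · simp [δ]
    · intro w _ hw
      simp [δ, Pi.single_eq_of_ne hw]
    · simp
  rw [formD, ← koszulD_formComp hδ, h1, hη₁]

/-- Closed forms with values in an acyclic Hecke module are exact. -/
theorem exists_formD_eq [FiniteDimensional ℝ V] (I : HeckeModule D N)
    (hI : ∀ (L : Type u) [AddCommGroup L] [Module ℝ L] [FiniteDimensional ℝ L]
      (B : V →ₗ[ℝ] End ℝ L), (∀ x y, B x * B y = B y * B x) →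
      KoszulAcyclic (homAction (I.shift (-1)) B)) (j : ℕ) :
    ∀ (k : ℕ), finrank ℝ V < k + 1 + j → ∀ (L : Type u) [AddCommGroup L] [Module ℝ L]
      [FiniteDimensional ℝ L] (M : HeckeModule D L) (ω : V [⋀^Fin (k + 1)]→ₗ[ℝ] (L →ₗ[ℝ] N)),
      IsEquivariantForm M I ω → formD M I ω = 0 →
      ∃ η : V [⋀^Fin k]→ₗ[ℝ] (L →ₗ[ℝ] N), IsEquivariantForm M I η ∧ formD M I η = ω := by
  induction j with
  | zero =>
    intro k hk L _ _ _ M ω hω hd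
    -- The degree exceeds the dimension of `V`, so `ω` is zero.
    refine ⟨0, fun w v l => by simp, ?_⟩
    rw [formD, koszulD_zero]
    ext v : 1
    rw [ω.map_linearDependent]
    · rfl
    · intro h
      have := h.fintype_card_le_finrank
      simp at this
      omega
  | succ j ih =>
    intro k hk L _ _ _ M ω hω hd
    set Q := coinduced D (-1) (by norm_num) (M.shift 1) (M.shift_comm (by norm_num)) with hQ
    set u := toCoinduced W M.rho with hu
    have huH : IsHeckeHom M Q u := isHeckeHom_toCoinduced M
    set p := coinducedAverage M.rho with hp
    have hpu : ∀ l, p (u l) = l := coinducedAverage_toCoinduced M.rho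
    have hpρ : ∀ w q, p (Q.rho w q) = M.rho w (p q) := coinducedAverage_rightRegular M.rho
    set K := LinearMap.range u with hK
    have hKρ : ∀ w, K ≤ K.comap (Q.rho w) := by
      rintro w _ ⟨l, rfl⟩
      exact ⟨M.rho w l, huH.rho w l⟩
    have hKX : ∀ x, K ≤ K.comap (Q.X x) := by
      rintro x _ ⟨l, rfl⟩
      exact ⟨M.X x l, huH.X x l⟩
    have hmk := isHeckeHom_mkQ Q K hKρ hKX
    have hs := K.mkQ_surjective
    have hmku : ∀ l, K.mkQ (u l) = 0 := fun l => (Submodule.Quotient.mk_eq_zero K).2 ⟨l, rfl⟩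
    -- Dimension shifting: the average `p` respects only the group, so the extension `c` of `ω` need
    -- not be closed. Its differential vanishes on the image of `u` and descends to a closed form of
    -- one degree more on the quotient, where the induction hypothesis applies.
    set c := formComp p ω with hc
    have hce : IsEquivariantForm Q I c := hω.formComp hpρ
    have hcu : formComp u c = ω := by ext v l; simp [hc, hpu]
    obtain ⟨e, he⟩ := exists_formComp_eq (ω := formD Q I c) hs (by
      intro v q hq
      obtain ⟨l, rfl⟩ := (Submodule.Quotient.mk_eq_zero K).1 hq
      have h1 : formComp u (formD Q I c) = 0 := by rw [← formD_formComp huH, hcu, hd]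
      exact LinearMap.congr_fun (AlternatingMap.congr_fun h1 v) l)
    obtain ⟨f, hfe, hf⟩ := ih (k + 1) (by omega) (( W → L) ⧸ K) (Q.quot K hKρ hKX) e
      (IsEquivariantForm.of_formComp hs hmk.rho (he ▸ hce.formD)) (by
        apply formComp_injective hs
        rw [← formD_formComp hmk, he, formD_formD]; rfl)
    -- The corrected extension is closed and still restricts to `ω`, since the quotient map kills
    -- the image of `u`.
    set c' := c - formComp K.mkQ f with hc'
    obtain ⟨η, hηe, hη⟩ := exists_formD_eq_coinduced (M.shift_comm (by norm_num)) (by norm_num) rfl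
      (hI L _ (M.shift_comm (by norm_num))) (ω := c') (hce.sub (hfe.formComp hmk.rho)) (by
        rw [hc', formD_sub]
        rw [formD_formComp hmk, hf, he, sub_self])
    refine ⟨formComp u η, hηe.formComp huH.rho, ?_⟩
    rw [formD_formComp huH]
    rw [hη, ← hcu, hc']
    ext v l
    simp [hmku]

/-- Homomorphisms into an acyclic Hecke module extend along injections of finite-dimensional
modules. -/
theorem exists_heckeHom_extend [FiniteDimensional ℝ V] (I : HeckeModule D N)
    (hI : ∀ (L : Type u) [AddCommGroup L] [Module ℝ L] [FiniteDimensional ℝ L]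
      (B : V →ₗ[ℝ] End ℝ L), (∀ x y, B x * B y = B y * B x) →
      KoszulAcyclic (homAction (I.shift (-1)) B))
    {A B : Type u} [AddCommGroup A] [Module ℝ A] [AddCommGroup B] [Module ℝ B]
    [FiniteDimensional ℝ B] {MA : HeckeModule D A} {MB : HeckeModule D B}
    {j : A →ₗ[ℝ] B} (hj : IsHeckeHom MA MB j) (hji : Function.Injective j)
    {g : A →ₗ[ℝ] N} (hg : IsHeckeHom MA I g) :
    ∃ g' : B →ₗ[ℝ] N, IsHeckeHom MB I g' ∧ ∀ a, g' (j a) = g a := by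
  obtain ⟨t, ht⟩ := j.exists_leftInverse_of_injective (LinearMap.ker_eq_bot.2 hji)
  have ht' : ∀ a, t (j a) = a := LinearMap.congr_fun ht
  -- A linear extension of `g`, averaged over the group. Viewed as a 0-form, its differential is the
  -- obstruction to being a Hecke homomorphism; it lives on the cokernel of `j` and is exact there.
  set g₁ : B →ₗ[ℝ] N := coinducedAverage I.rho ∘ₗ LinearMap.pi (fun w => g ∘ₗ t ∘ₗ MB.rho w) with hg₁
  have h1 : ∀ w b, g₁ (MB.rho w b) = I.rho w (g₁ b) := by
    intro w b
    rw [hg₁, LinearMap.comp_apply, LinearMap.comp_apply, ← coinducedAverage_rightRegular]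
    congr 1
    ext v
    simp
  have h2 : ∀ a, g₁ (j a) = g a := by
    intro a
    rw [hg₁, LinearMap.comp_apply]
    conv_rhs => rw [← coinducedAverage_toCoinduced I.rho (g a)]
    congr 1
    ext w
    simp [toCoinduced, ← hj.rho, ht', hg.rho]
  let ω : V [⋀^Fin 0]→ₗ[ℝ] (B →ₗ[ℝ] N) := AlternatingMap.constOfIsEmpty ℝ V (Fin 0) g₁
  have hω : IsEquivariantForm MB I ω := fun w v l => h1 w l
  set K := LinearMap.range j with hK
  have hKρ : ∀ w, K ≤ K.comap (MB.rho w) := by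
    rintro w _ ⟨l, rfl⟩
    exact ⟨MA.rho w l, hj.rho w l⟩
  have hKX : ∀ x, K ≤ K.comap (MB.X x) := by
    rintro x _ ⟨l, rfl⟩
    exact ⟨MA.X x l, hj.X x l⟩
  have hmk := isHeckeHom_mkQ MB K hKρ hKX
  have hs := K.mkQ_surjective
  have hd0 : ∀ (ω : V [⋀^Fin 0]→ₗ[ℝ] (B →ₗ[ℝ] N)) v b, formD MB I ω v b =
      I.shift (-1) (v 0) (ω 0 b) - ω 0 (MB.shift (-1) (v 0) b) := by
    intro ω v b
    rw [formD, koszulD_homAction_apply]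
    have hr : (0 : Fin 1).removeNth v = 0 := Subsingleton.elim _ _
    simp [hr]
  obtain ⟨e, he⟩ := exists_formComp_eq (ω := formD MB I ω) hs (by
    intro v q hq
    obtain ⟨a, rfl⟩ := (Submodule.Quotient.mk_eq_zero K).1 hq
    rw [hd0]
    change I.shift (-1) (v 0) (g₁ (j a)) - g₁ (MB.shift (-1) (v 0) (j a)) = 0
    rw [← hj.shift, h2, h2, hg.shift, sub_self])
  obtain ⟨f, hfe, hf⟩ := exists_formD_eq I hI (finrank ℝ V) 0 (by omega) (B ⧸ K)
    (MB.quot K hKρ hKX) e (IsEquivariantForm.of_formComp hs hmk.rho (he ▸ hω.formD)) (by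
      apply formComp_injective hs
      rw [← formD_formComp hmk, he, formD_formD]; rfl)
  have hz : formD MB I (ω - formComp K.mkQ f) = 0 := by
    rw [formD_sub, formD_formComp hmk, hf, he, sub_self]
  refine ⟨(ω - formComp K.mkQ f) 0, IsHeckeHom.of_shift (σ := -1) ?_ ?_, ?_⟩
  · intro w b
    have := (hω.sub (hfe.formComp hmk.rho)) w 0 b
    rwa [show (fun j : Fin 0 => D.act w ((0 : Fin 0 → V) j)) = 0 from Subsingleton.elim _ _] at this
  · intro x b
    have := LinearMap.congr_fun (AlternatingMap.congr_fun hz fun _ => x) b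
    rw [hd0] at this
    exact (sub_eq_zero.1 this).symm
  · intro a
    have hmku : K.mkQ (j a) = 0 := (Submodule.Quotient.mk_eq_zero K).2 ⟨a, rfl⟩
    change g₁ (j a) - f 0 (K.mkQ (j a)) = g a
    rw [hmku, map_zero, sub_zero, h2]

end Vanishing

end RootRegions

namespace RootRegions

open Module

/-! ### Hecke modules from simple reflections -/

section Construction

variable {V W R : Type*} [AddCommGroup V] [Module ℝ V] [Group W] [Fintype R]
  {D : ReflectionDatum V W R} {L L' : Type*} [AddCommGroup L] [Module ℝ L]
  [AddCommGroup L'] [Module ℝ L']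

/-- The Hecke module given by a representation of the group and commuting operators satisfying the
relations with the simple reflections. -/
noncomputable def HeckeModule.ofShift (ρ : W →* End ℝ L) (B : V →ₗ[ℝ] End ℝ L)
    (hB : ∀ x y, B x * B y = B y * B x)
    (hρB : ∀ i ∈ D.simple, ∀ x l,
      ρ (D.s i) (B x l) = B (D.act (D.s i) x) (ρ (D.s i) l) - D.co i x • l) :
    HeckeModule D L :=
  -- Adding the reflection sum cancels the inhomogeneous term in `hρB`, so compatibility passes from
  -- simple reflections to products.
  have h : ∀ w x l, ρ w ((B + reflSum D ρ) x l) = (B + reflSum D ρ) (D.act w x) (ρ w l) := by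
    intro w
    induction w using D.induction_simple with
    | h1 => intro x l; simp
    | hs i hi =>
      intro x l
      simp only [LinearMap.add_apply, map_add, hρB i hi, rho_reflSum ρ hi]
      abel
    | hmul u w hu hw =>
      intro x l
      simp only [map_mul, End.mul_apply, hu, hw]
  { rho := ρ
    X := B + reflSum D ρ
    rho_X := h
    comm := by
      intro x y
      have h1 := commutator_reflSum ρ _ h x y
      have h2 := hB x y
      simp only [LinearMap.add_apply] at h1 ⊢
      rw [← sub_eq_zero] at h1 h2 ⊢
      rw [← add_zero (0 : End ℝ L)]
      nth_rewrite 1 [← h1]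
      rw [← h2]
      noncomm_ring }

theorem HeckeModule.ofShift_shift (ρ : W →* End ℝ L) (B : V →ₗ[ℝ] End ℝ L)
    (hB : ∀ x y, B x * B y = B y * B x)
    (hρB : ∀ i ∈ D.simple, ∀ x l,
      ρ (D.s i) (B x l) = B (D.act (D.s i) x) (ρ (D.s i) l) - D.co i x • l) :
    (HeckeModule.ofShift ρ B hB hρB).shift (-1) = B := by
  simp only [HeckeModule.ofShift, HeckeModule.shift]
  module

omit [Fintype R] in
/-- A representation on a stable subspace descends along a surjection as soon as the simple
reflections do. -/
theorem exists_rep_of_surjective (ρ : W →* End ℝ L) (U : Submodule ℝ L)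
    (hU : ∀ w, ∀ q ∈ U, ρ w q ∈ U) (f : L →ₗ[ℝ] L') (hf : ∀ l', ∃ q ∈ U, f q = l')
    (T : R → End ℝ L') (hT : ∀ i ∈ D.simple, ∀ q ∈ U, f (ρ (D.s i) q) = T i (f q)) :
    ∃ ρ' : W →* End ℝ L', ∀ i ∈ D.simple, ρ' (D.s i) = T i := by
  have h : ∀ w, ∃ g : End ℝ L', ∀ q ∈ U, f (ρ w q) = g (f q) := by
    intro w
    induction w using D.induction_simple with
    | h1 => exact ⟨1, fun q _ => by simp⟩
    | hs i hi => exact ⟨T i, hT i hi⟩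
    | hmul u w hu hw =>
      obtain ⟨g, hg⟩ := hu
      obtain ⟨g', hg'⟩ := hw
      exact ⟨g * g', fun q hq => by
        rw [map_mul, End.mul_apply, hg _ (hU w q hq), hg' q hq, End.mul_apply]⟩
  choose g hg using h
  -- Uniqueness of the descended operators makes them multiplicative, so no relations among the `T
  -- i` have to be checked.
  have huniq : ∀ (a b : End ℝ L'), (∀ q ∈ U, a (f q) = b (f q)) → a = b := by
    intro a b hab
    ext l'
    obtain ⟨q, hq, rfl⟩ := hf l'
    exact hab q hq
  refine ⟨⟨⟨g, huniq _ _ fun q hq => by rw [← hg 1 q hq]; simp⟩, fun u w => huniq _ _ fun q hq => ?_⟩,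
    fun i hi => huniq _ _ fun q hq => ?_⟩
  · change g (u * w) (f q) = (g u * g w) (f q)
    rw [← hg _ q hq, map_mul, End.mul_apply, hg _ _ (hU w q hq), hg _ q hq, End.mul_apply]
  · change g (D.s i) (f q) = _
    rw [← hg _ q hq, hT i hi q hq]

omit [Fintype R] in
/-- A representation restricts along an injection as soon as the simple reflections do. -/
theorem exists_rep_of_injective (ρ : W →* End ℝ L) (f : L' →ₗ[ℝ] L) (hf : Function.Injective f)
    (T : R → End ℝ L') (hT : ∀ i ∈ D.simple, ∀ q, f (T i q) = ρ (D.s i) (f q)) :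
    ∃ ρ' : W →* End ℝ L', ∀ i ∈ D.simple, ρ' (D.s i) = T i := by
  have h : ∀ w, ∃ g : End ℝ L', ∀ q, f (g q) = ρ w (f q) := by
    intro w
    induction w using D.induction_simple with
    | h1 => exact ⟨1, fun q => by simp⟩
    | hs i hi => exact ⟨T i, hT i hi⟩
    | hmul u w hu hw =>
      obtain ⟨g, hg⟩ := hu
      obtain ⟨g', hg'⟩ := hw
      exact ⟨g * g', fun q => by rw [map_mul, End.mul_apply, hg, hg', End.mul_apply]⟩
  choose g hg using h
  have huniq : ∀ (a b : End ℝ L'), (∀ q, f (a q) = f (b q)) → a = b :=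
    fun a b hab => LinearMap.ext fun q => hf (hab q)
  refine ⟨⟨⟨g, huniq _ _ fun q => by rw [hg]; simp⟩, fun u w => huniq _ _ fun q => ?_⟩,
    fun i hi => huniq _ _ fun q => ?_⟩
  · change f (g (u * w) q) = f (g u (g w q))
    rw [hg, hg, hg, map_mul, End.mul_apply]
  · change f (g (D.s i) q) = _
    rw [hg, hT i hi q]

/-- Linear maps compatible with the simple reflections are equivariant. -/
theorem IsHeckeHom.of_simple {M : HeckeModule D L} {M' : HeckeModule D L'} {f : L →ₗ[ℝ] L'}
    (h1 : ∀ i ∈ D.simple, ∀ l, f (M.rho (D.s i) l) = M'.rho (D.s i) (f l))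
    (h2 : ∀ x l, f (M.shift (-1) x l) = M'.shift (-1) x (f l)) : IsHeckeHom M M' f := by
  refine IsHeckeHom.of_shift (fun w => ?_) h2
  induction w using D.induction_simple with
  | h1 => intro l; simp
  | hs i hi => exact h1 i hi
  | hmul u w hu hw => intro l; simp only [M.rho_mul, M'.rho_mul, hu, hw]

/-- Direct products of Hecke modules. -/
def HeckeModule.pi {ι : Type*} {P : ι → Type*} [∀ i, AddCommGroup (P i)] [∀ i, Module ℝ (P i)]
    (M : ∀ i, HeckeModule D (P i)) : HeckeModule D (∀ i, P i) where
  rho :=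
    { toFun := fun w => LinearMap.pi fun i => (M i).rho w ∘ₗ LinearMap.proj i
      map_one' := by ext; simp
      map_mul' := fun u w => by ext; simp }
  X :=
    { toFun := fun x => LinearMap.pi fun i => (M i).X x ∘ₗ LinearMap.proj i
      map_add' := fun x y => by ext; simp
      map_smul' := fun c x => by ext; simp }
  rho_X w x l := by
    ext i
    exact (M i).rho_X w x (l i)
  comm x y := by
    refine LinearMap.ext fun l => funext fun i => ?_
    have h := LinearMap.congr_fun ((M i).comm x y) (l i)
    have hP : ∀ (ρ : W →* End ℝ (∀ i, P i)), (∀ w l, ρ w l i = (M i).rho w (l i)) →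
        ∀ x l, reflSum D ρ x l i = reflSum D (M i).rho x (l i) := by
      intro ρ hρ x l
      simp [reflSum_apply, hρ]
    simp only [LinearMap.sub_apply, End.mul_apply, Pi.sub_apply] at h ⊢
    rw [hP _ fun _ _ => rfl, hP _ fun _ _ => rfl, hP _ fun _ _ => rfl, hP _ fun _ _ => rfl]
    exact h

end Construction

end RootRegions

namespace RootRegions

open Module

/-! ### The operators `λ(y) + ∂_y` and their inverses -/

section ShiftDeriv

variable {V ι : Type*} [AddCommGroup V] [Module ℝ V] [Fintype ι] (e : Basis ι ℝ V)
  (lam : V →ₗ[ℝ] ℝ)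

/-- The operators `λ(y) + ∂_y` on polynomials. -/
noncomputable def shiftDeriv : V →ₗ[ℝ] End ℝ (MvPolynomial ι ℝ) :=
  lam.smulRight 1 + dirDeriv e

theorem shiftDeriv_eq (y : V) : shiftDeriv e lam y = lam y • 1 + dirDeriv e y := rfl

theorem commute_dirDeriv (x y : V) : Commute (dirDeriv e x) (dirDeriv e y) :=
  dirDeriv_comm e x y

theorem commute_shiftDeriv_dirDeriv (x y : V) : Commute (shiftDeriv e lam x) (dirDeriv e y) :=
  ((Commute.one_left _).smul_left _).add_left (commute_dirDeriv e x y)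

theorem commute_shiftDeriv (x y : V) : Commute (shiftDeriv e lam x) (shiftDeriv e lam y) :=
  ((Commute.one_right _).smul_right _).add_right (commute_shiftDeriv_dirDeriv e lam x y)

theorem shiftDeriv_C (y : V) (c : ℝ) :
    shiftDeriv e lam y (MvPolynomial.C c) = MvPolynomial.C (lam y * c) := by
  simp [shiftDeriv_eq, dirDeriv_C, MvPolynomial.smul_eq_C_mul]

theorem shiftDeriv_bijective {y : V} (hy : lam y ≠ 0) : Function.Bijective (shiftDeriv e lam y) :=
  dirDeriv_add_const_bijective e y hy

theorem isUnit_shiftDeriv {y : V} (hy : lam y ≠ 0) : IsUnit (shiftDeriv e lam y) :=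
  (End.isUnit_iff _).2 (shiftDeriv_bijective e lam hy)

theorem commute_ringInverse_right {M : Type*} [MonoidWithZero M] {a b : M}
    (h : Commute a b) : Commute a (Ring.inverse b) := by
  by_cases hb : IsUnit b
  · obtain ⟨u, rfl⟩ := hb
    rw [Ring.inverse_unit]
    exact h.units_inv_right
  · rw [Ring.inverse_non_unit _ hb]
    exact Commute.zero_right a

/-- The inverse of `λ(y) + ∂_y`. -/
noncomputable def shiftInv (y : V) : End ℝ (MvPolynomial ι ℝ) := Ring.inverse (shiftDeriv e lam y)

theorem shiftInv_mul {y : V} (hy : lam y ≠ 0) : shiftInv e lam y * shiftDeriv e lam y = 1 :=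
  Ring.inverse_mul_cancel _ (isUnit_shiftDeriv e lam hy)

theorem mul_shiftInv {y : V} (hy : lam y ≠ 0) : shiftDeriv e lam y * shiftInv e lam y = 1 :=
  Ring.mul_inverse_cancel _ (isUnit_shiftDeriv e lam hy)

theorem shiftInv_C {y : V} (hy : lam y ≠ 0) (c : ℝ) :
    shiftInv e lam y (MvPolynomial.C c) = MvPolynomial.C ((lam y)⁻¹ * c) := by
  have h : MvPolynomial.C c = shiftDeriv e lam y (MvPolynomial.C ((lam y)⁻¹ * c)) := by
    rw [shiftDeriv_C, mul_inv_cancel_left₀ hy]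
  rw [h, ← End.mul_apply, shiftInv_mul e lam hy, End.one_apply]

open Classical in
/-- The off-diagonal coefficients of the action of the simple reflections. -/
noncomputable def modelCoeff (T : Set V) (γ : V) : End ℝ (MvPolynomial ι ℝ) :=
  if γ ∈ T then shiftInv e lam γ * dirDeriv e γ * (1 + shiftDeriv e lam γ)
  else if -γ ∈ T then shiftInv e lam (-γ) else 1 + shiftInv e lam γ

theorem commute_modelCoeff {A : End ℝ (MvPolynomial ι ℝ)} (hA : ∀ y, Commute A (dirDeriv e y))
    (T : Set V) (γ : V) :
    Commute A (modelCoeff e lam T γ) ∧ ∀ y, Commute A (shiftInv e lam y) := by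
  have h1 : ∀ y, Commute A (shiftDeriv e lam y) := fun y =>
    ((Commute.one_right _).smul_right _).add_right (hA y)
  have h2 : ∀ y, Commute A (shiftInv e lam y) := fun y => commute_ringInverse_right (h1 y)
  refine ⟨?_, h2⟩
  rw [modelCoeff]
  split_ifs
  · exact ((h2 _).mul_right (hA _)).mul_right ((Commute.one_right _).add_right (h1 _))
  · exact h2 _
  · exact (Commute.one_right _).add_right (h2 _)

end ShiftDeriv

/-! ### The polynomial model -/

section Model

variable {V W R ι : Type*} [AddCommGroup V] [Module ℝ V] [Group W]
  (D : ReflectionDatum V W R) [Fintype ι] (e : Basis ι ℝ V) (lam : V →ₗ[ℝ] ℝ)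

/-- The commuting operators on the model: `x` acts by `λ(w⁻¹ x) + ∂_{w⁻¹ x}` on the `w`-component. -/
noncomputable def modelB : V →ₗ[ℝ] End ℝ (W → MvPolynomial ι ℝ) where
  toFun x := LinearMap.pi fun w => shiftDeriv e lam (D.act w⁻¹ x) ∘ₗ LinearMap.proj w
  map_add' x y := by
    refine LinearMap.ext fun g => funext fun w => ?_
    simp
  map_smul' c x := by
    refine LinearMap.ext fun g => funext fun w => ?_
    simp

@[simp]
theorem modelB_apply (x : V) (g : W → MvPolynomial ι ℝ) (w : W) :
    modelB D e lam x g w = shiftDeriv e lam (D.act w⁻¹ x) (g w) := rfl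

theorem modelB_comm (x y : V) :
    modelB D e lam x * modelB D e lam y = modelB D e lam y * modelB D e lam x := by
  refine LinearMap.ext fun g => funext fun w => ?_
  exact LinearMap.congr_fun (commute_shiftDeriv e lam (D.act w⁻¹ x) (D.act w⁻¹ y)).eq (g w)

/-- The action of the simple reflections on the model. -/
noncomputable def modelT (T : Set V) (i : R) : End ℝ (W → MvPolynomial ι ℝ) :=
  LinearMap.pi fun w => modelCoeff e lam T (D.act w⁻¹ (D.root i)) ∘ₗ LinearMap.proj (D.s i * w) -
    shiftInv e lam (D.act w⁻¹ (D.root i)) ∘ₗ LinearMap.proj w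

@[simp]
theorem modelT_apply (T : Set V) (i : R) (g : W → MvPolynomial ι ℝ) (w : W) :
    modelT D e lam T i g w = modelCoeff e lam T (D.act w⁻¹ (D.root i)) (g (D.s i * w)) -
      shiftInv e lam (D.act w⁻¹ (D.root i)) (g w) := rfl

/-- A functional for which the reflection group acts regularly, together with a set `S` of vectors
of value `1` whose sign is changed by a simple reflection only if they are moved to the
simple root. -/
structure IsRegularFunctional (S : Set V) : Prop where
  pos : ∀ i ∈ D.simple, 0 < lam (D.root i)
  ne_zero : ∀ i ∈ D.simple, ∀ w, lam (D.act w (D.root i)) ≠ 0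
  separating : ∀ w w', (∀ x, lam (D.act w x) = lam (D.act w' x)) → w = w'
  eq_one : ∀ β ∈ S, lam β = 1
  sign : ∀ i ∈ D.simple, ∀ w, ∀ β ∈ S, D.act w β ≠ D.root i → D.act w β ≠ -D.root i →
    (0 < lam (D.act (D.s i * w) β) ↔ 0 < lam (D.act w β))
  exists_neg : ∀ β ∈ S, ∃ w, lam (D.act w β) < 0

variable {D lam} {S : Set V}

/-- With `γ = w⁻¹ α_i`, the vectors `w⁻¹ x` and `w⁻¹ s_i x` differ by `c_i(x) γ`, and the diagonal
term, the inverse of `λ(γ) + ∂_γ`, turns this difference into `c_i(x)`. Of the off-diagonal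
coefficient only commutation with the derivatives matters, so `T` is arbitrary. -/
theorem modelT_modelB (h : IsRegularFunctional D lam S) (T : Set V) {i : R} (hi : i ∈ D.simple)
    (x : V) (g : W → MvPolynomial ι ℝ) :
    modelT D e lam T i (modelB D e lam x g) =
      modelB D e lam (D.act (D.s i) x) (modelT D e lam T i g) - D.co i x • g := by
  funext w
  set γ := D.act w⁻¹ (D.root i) with hγ
  have h1 : D.act (D.s i * w)⁻¹ x = D.act w⁻¹ (D.act (D.s i) x) := by
    rw [mul_inv_rev, D.act_mul, D.s_inv]
  have h2 : D.act w⁻¹ x = D.act w⁻¹ (D.act (D.s i) x) + D.co i x • γ := by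
    rw [D.act_s, map_sub, map_smul]; abel
  have h3 := (commute_modelCoeff e lam (commute_shiftDeriv_dirDeriv e lam
    (D.act w⁻¹ (D.act (D.s i) x))) T γ)
  have h4 := LinearMap.congr_fun h3.1.eq (g (D.s i * w))
  have h5 := LinearMap.congr_fun (h3.2 γ).eq (g w)
  have h6 := LinearMap.congr_fun (shiftInv_mul e lam (h.ne_zero i hi w⁻¹)) (g w)
  simp only [End.mul_apply, End.one_apply] at h4 h5 h6
  rw [← hγ] at h6
  simp only [modelT_apply, modelB_apply, Pi.sub_apply, Pi.smul_apply, h1, ← hγ]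
  rw [h2, map_add, map_smul, LinearMap.add_apply, LinearMap.smul_apply, map_add, map_smul, h6,
    map_sub, h4, h5]
  abel

/-- The model is acyclic. -/
theorem koszulAcyclic_modelB {L : Type*} [AddCommGroup L] [Module ℝ L] [FiniteDimensional ℝ L]
    (B : V →ₗ[ℝ] End ℝ L) (hB : ∀ x y, B x * B y = B y * B x) :
    KoszulAcyclic (homAction (modelB D e lam) B) := by
  let E := MvPolynomial ι ℝ
  let lamw : W → V →ₗ[ℝ] ℝ := fun w => lam ∘ₗ D.act w⁻¹
  -- On each component the scalar `λ(w⁻¹ x)` is moved to the side of `L`, leaving pure derivatives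
  -- in a transported basis.
  let Bw : W → V →ₗ[ℝ] End ℝ L := fun w => B - (lamw w).smulRight 1
  let actEquiv : W → V ≃ₗ[ℝ] V := fun w =>
    LinearEquiv.ofLinearMap (D.act w) (D.act w⁻¹) (by ext; simp) (by ext; simp)
  have hw : ∀ w, KoszulAcyclic (homAction (dirDeriv (e.map (actEquiv w))) (Bw w)) := by
    intro w
    refine koszulAcyclic_homAction_dirDeriv _ _ L (Bw w) (fun x y => ?_) rfl
    have hc : ∀ (a : ℝ) (Z : End ℝ L), Commute (a • (1 : End ℝ L)) Z := fun a Z =>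
      (Commute.one_left Z).smul_left a
    exact ((show Commute (B x) (B y) from hB x y).sub_right (hc _ _).symm).sub_left
      ((hc _ _).sub_right (hc _ _))
  have hpi : KoszulAcyclic (N := ∀ _ : W, L →ₗ[ℝ] E)
      { toFun := fun x => LinearMap.pi fun w =>
          homAction (dirDeriv (e.map (actEquiv w))) (Bw w) x ∘ₗ LinearMap.proj w
        map_add' := fun x y => by
          refine LinearMap.ext fun m => funext fun w => ?_
          simp
        map_smul' := fun c x => by
          refine LinearMap.ext fun m => funext fun w => ?_
          simp } :=
    KoszulAcyclic.pi (fun _ _ _ => rfl) hw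
  refine hpi.of_equiv (LinearEquiv.ofLinearMap
    { toFun := fun m => LinearMap.pi m
      map_add' := fun _ _ => rfl
      map_smul' := fun _ _ => rfl }
    { toFun := fun φ w => LinearMap.proj w ∘ₗ φ
      map_add' := fun _ _ => rfl
      map_smul' := fun _ _ => rfl } rfl rfl) fun x m => ?_
  refine LinearMap.ext fun l => funext fun w => ?_
  have hd : dirDeriv (e.map (actEquiv w)) x = dirDeriv e (D.act w⁻¹ x) := rfl
  change dirDeriv (e.map (actEquiv w)) x (m w l) - m w (Bw w x l) =
    shiftDeriv e lam (D.act w⁻¹ x) (m w l) - m w (B x l)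
  rw [hd, shiftDeriv_eq]
  simp only [Bw, lamw, LinearMap.sub_apply, LinearMap.add_apply, LinearMap.smul_apply, End.one_apply,
    LinearMap.smulRight_apply, LinearMap.comp_apply, map_sub, map_smul]
  abel

theorem modelCoeff_empty (γ : V) : modelCoeff e lam ∅ γ = 1 + shiftInv e lam γ := by
  simp [modelCoeff]

/-- Applying an operator to all values of a function. -/
def mapValues {E : Type*} [AddCommGroup E] [Module ℝ E] (W : Type*) (A : End ℝ E) :
    End ℝ (W → E) := LinearMap.pi fun w => A ∘ₗ LinearMap.proj w

omit [Group W] in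
@[simp]
theorem mapValues_apply {E : Type*} [AddCommGroup E] [Module ℝ E] (A : End ℝ E) (g : W → E)
    (w : W) : mapValues W A g w = A (g w) := rfl

variable [Fintype R] [Fintype W]

/-- The simple reflections act on the model for the empty set through a representation. -/
theorem exists_modelRep_empty (h : IsRegularFunctional D lam S) :
    ∃ ρ : W →* End ℝ (W → MvPolynomial ι ℝ), ∀ i ∈ D.simple, ρ (D.s i) = modelT D e lam ∅ i := by
  classical
  set B := modelB D e lam with hB
  set Q := coinduced D 1 (by norm_num) B (modelB_comm D e lam) with hQ
  have hrho : ∀ u q w, Q.rho u q w = q (w * u) := fun _ _ _ => rfl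
  have hQ1 : ∀ x q, Q.shift (-1) x q 1 = B x (q 1) := fun x q =>
    coinduced_shift_apply_one (by norm_num) B (modelB_comm D e lam) (by norm_num) x q
  let P : R → (W → W → MvPolynomial ι ℝ) →ₗ[ℝ] (W → MvPolynomial ι ℝ) := fun i =>
    LinearMap.proj 1 ∘ₗ Q.rho (D.s i) - modelT D e lam ∅ i ∘ₗ LinearMap.proj 1
  have hP : ∀ i q, P i q = Q.rho (D.s i) q 1 - modelT D e lam ∅ i (q 1) := fun _ _ => rfl
  -- The largest stable subspace on which evaluation at 1 turns each simple reflection into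
  -- `modelT`. Once evaluation maps it onto the model, the representation descends, which replaces a
  -- check of the braid relations.
  let U : Submodule ℝ (W → W → MvPolynomial ι ℝ) :=
    ⨅ w, ⨅ i ∈ D.simple, LinearMap.ker (P i ∘ₗ Q.rho w)
  have hU : ∀ q, q ∈ U ↔ ∀ w, ∀ i ∈ D.simple, P i (Q.rho w q) = 0 := by
    intro q
    simp [U, Submodule.mem_iInf]
  have hUρ : ∀ u, ∀ q ∈ U, Q.rho u q ∈ U := by
    intro u q hq
    rw [hU] at hq ⊢
    intro w i hi
    rw [← Q.rho_mul]
    exact hq _ i hi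
  have hUP : ∀ q ∈ U, ∀ i ∈ D.simple, P i q = 0 := fun q hq i hi => by
    simpa using (hU q).1 hq 1 i hi
  have hPB : ∀ x, ∀ q ∈ U, ∀ i ∈ D.simple, P i (Q.shift (-1) x q) = 0 := by
    intro x q hq i hi
    have h1 := hUP q hq i hi
    rw [hP, sub_eq_zero] at h1
    rw [hP, Q.rho_shift i hi, Pi.add_apply, hQ1, hQ1, h1, modelT_modelB e h ∅ hi]
    simp only [Pi.smul_apply]
    module
  have hUr : ∀ x, ∀ q ∈ U, reflSum D Q.rho x q ∈ U := by
    intro x q hq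
    rw [reflSum_apply]
    exact U.smul_mem _ (U.sum_mem fun r _ => U.smul_mem _ (hUρ _ q hq))
  have hUB : ∀ x, ∀ q ∈ U, Q.shift (-1) x q ∈ U := by
    intro x q hq
    rw [hU]
    intro w i hi
    have h1 : Q.rho w (Q.shift (-1) x q) = Q.shift (-1) (D.act w x) (Q.rho w q) +
        (reflSum D Q.rho (D.act w x) (Q.rho w q) - Q.rho w (reflSum D Q.rho x q)) := by
      simp only [HeckeModule.shift, LinearMap.add_apply, LinearMap.smul_apply, map_add, map_smul,
        Q.rho_X]
      module
    rw [h1, map_add, map_sub, hPB _ _ (hUρ w q hq) i hi, hUP _ (hUr _ _ (hUρ w q hq)) i hi,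
      hUP _ (hUρ w _ (hUr x q hq)) i hi, sub_zero, add_zero]
  have hUA : ∀ y, ∀ q ∈ U, (mapValues W (mapValues W (shiftDeriv e lam y))) q ∈ U := by
    intro y q hq
    rw [hU]
    intro w i hi
    have h1 : ∀ q, P i (mapValues W (mapValues W (shiftDeriv e lam y)) q) =
        mapValues W (shiftDeriv e lam y) (P i q) := by
      intro q
      funext v
      have hc := commute_modelCoeff e lam (commute_shiftDeriv_dirDeriv e lam y) ∅
        (D.act v⁻¹ (D.root i))
      have h2 := LinearMap.congr_fun hc.1.eq (q 1 (D.s i * v))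
      have h3 := LinearMap.congr_fun (hc.2 (D.act v⁻¹ (D.root i))).eq (q 1 v)
      simp only [End.mul_apply] at h2 h3
      simp only [hP, hrho, mapValues_apply, Pi.sub_apply, modelT_apply, map_sub, h2, h3]
    have h2 : Q.rho w (mapValues W (mapValues W (shiftDeriv e lam y)) q) =
      mapValues W (mapValues W (shiftDeriv e lam y)) (Q.rho w q) := rfl
    rw [h2, h1, (hU q).1 hq w i hi, map_zero]
  -- A supply of elements of `U`: for the empty set the two coefficients of `modelT` add up to 1, so
  -- it fixes constant functions.
  have hconst : ∀ p : MvPolynomial ι ℝ, (fun _ _ => p) ∈ U := by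
    intro p
    rw [hU]
    intro w i hi
    funext v
    simp [hP, hrho, modelCoeff_empty]
  have hsep : ∀ (w₀ : W) (F : Finset W), w₀ ∉ F → ∀ p : MvPolynomial ι ℝ,
      ∃ q ∈ U, q 1 w₀ = p ∧ ∀ w ∈ F, q 1 w = 0 := by
    intro w₀ F
    induction F using Finset.induction_on with
    | empty => exact fun _ p => ⟨fun _ _ => p, hconst p, rfl, by simp⟩
    | insert w' F _ ih =>
      intro hw p
      rw [Finset.mem_insert, not_or] at hw
      obtain ⟨x, hx⟩ : ∃ x, lam (D.act w₀⁻¹ x) ≠ lam (D.act w'⁻¹ x) := by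
        by_contra! hx
        exact hw.1 (inv_injective (h.separating _ _ hx))
      have hne : lam (D.act w₀⁻¹ x - D.act w'⁻¹ x) ≠ 0 := by
        rw [map_sub]; exact sub_ne_zero.2 hx
      obtain ⟨p', hp'⟩ := (shiftDeriv_bijective e lam hne).2 p
      obtain ⟨q, hq, hq0, hqF⟩ := ih hw.2 p'
      -- This operator kills the component `w'`; on `w₀` it is `λ(y) + ∂_y` with `y = w₀⁻¹ x - w'⁻¹
      -- x`, which is invertible as `λ(y) ≠ 0`.
      refine ⟨Q.shift (-1) x q - mapValues W (mapValues W (shiftDeriv e lam (D.act w'⁻¹ x))) q,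
        U.sub_mem (hUB x q hq) (hUA _ q hq), ?_, ?_⟩
      all_goals simp only [Pi.sub_apply, hQ1, mapValues_apply]
      · rw [hB, modelB_apply, hq0, ← hp', map_sub, LinearMap.sub_apply]
      · intro w hwF
        rw [hB, modelB_apply]
        rcases Finset.mem_insert.1 hwF with rfl | hwF
        · exact sub_self _
        · rw [hqF w hwF, map_zero, map_zero, sub_self]
  refine exists_rep_of_surjective (D := D) Q.rho U hUρ (LinearMap.proj 1) ?_ _ ?_
  · intro g
    choose q hqU hq0 hq using fun w => hsep w (Finset.univ.erase w) (by simp) (g w)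
    refine ⟨∑ w, q w, U.sum_mem fun w _ => hqU w, ?_⟩
    funext v
    rw [LinearMap.proj_apply, Finset.sum_apply, Finset.sum_apply, Finset.sum_eq_single v, hq0]
    · intro w _ hwv
      exact hq w v (by simp [hwv.symm])
    · simp
  · intro i hi q hq
    have := hUP q hq i hi
    rw [hP, sub_eq_zero] at this
    exact this

/-- The simple reflections act on the model through a representation. -/
theorem exists_modelRep (h : IsRegularFunctional D lam S) {T : Set V} (hT : T.Finite)
    (hTS : T ⊆ S) :
    ∃ ρ : W →* End ℝ (W → MvPolynomial ι ℝ), ∀ i ∈ D.simple, ρ (D.s i) = modelT D e lam T i := by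
  classical
  induction T, hT using Set.Finite.induction_on with
  | empty => exact exists_modelRep_empty e h
  | @insert β T hβ _ ih =>
    obtain ⟨ρ, hρ⟩ := ih ((Set.subset_insert _ _).trans hTS)
    have hβS := hTS (Set.mem_insert β T)
    have hβ1 := h.eq_one β hβS
    have hβne : lam β ≠ 0 := by rw [hβ1]; exact one_ne_zero
    have hβ0 : β ≠ 0 := by rintro rfl; simp at hβ1
    have hnegT : ∀ δ ∈ insert β T, -δ ∉ insert β T := by
      intro δ hδ hδ'
      have h1 := h.eq_one _ (hTS hδ)
      have h2 := h.eq_one _ (hTS hδ')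
      rw [map_neg, h1] at h2
      norm_num at h2
    have hDβ : shiftDeriv e lam β = 1 + dirDeriv e β := by rw [shiftDeriv_eq, hβ1, one_smul]
    let f : W → End ℝ (MvPolynomial ι ℝ) := fun w =>
      if 0 < lam (D.act w β) then dirDeriv e β else 1
    refine exists_rep_of_surjective (D := D) ρ ⊤ (fun _ _ _ => trivial)
      (LinearMap.pi fun w => f w ∘ₗ LinearMap.proj w) ?_ _ ?_
    · intro g
      have hf : ∀ w, Function.Surjective (f w) := by
        intro w
        simp only [f]
        split_ifs
        · exact dirDeriv_surjective e hβ0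
        · exact fun p => ⟨p, rfl⟩
      choose q hq using fun w => hf w (g w)
      exact ⟨q, trivial, funext hq⟩
    · intro i hi q _
      rw [hρ i hi]
      funext w
      have hγ0 := h.ne_zero i hi w⁻¹
      set γ := D.act w⁻¹ (D.root i) with hγ
      have hwγ : D.act w γ = D.root i := by rw [hγ, D.act_act_inv]
      have hfc : ∀ T' δ, Commute (f w) (modelCoeff e lam T' δ) ∧ Commute (f w) (shiftInv e lam δ) := by
        intro T' δ
        have : ∀ y, Commute (f w) (dirDeriv e y) := by
          intro y
          simp only [f]
          split_ifs
          · exact commute_dirDeriv e β y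
          · exact Commute.one_left _
        exact ⟨(commute_modelCoeff e lam this T' δ).1, (commute_modelCoeff e lam this T' δ).2 δ⟩
      -- Only `γ = ±β` changes. There `λ(β) = 1` gives `D = 1 + ∂_β`, and the identities are `∂ (1 +
      -- D⁻¹) = D⁻¹ ∂ (1 + D)` and `1 - D⁻¹ = D⁻¹ ∂`.
      have key : f w * modelCoeff e lam T γ = modelCoeff e lam (insert β T) γ * f (D.s i * w) := by
        have hpos := h.pos i hi
        by_cases h1 : γ = β
        · have hwβ : D.act w β = D.root i := by rw [← h1, hwγ]
          have e1 : f w = dirDeriv e β := if_pos (by rw [hwβ]; exact hpos)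
          have e2 : f (D.s i * w) = 1 := if_neg (by
            rw [D.act_mul, hwβ, D.act_s, D.co_root, map_sub, map_smul, smul_eq_mul]; linarith)
          have e3 : modelCoeff e lam T γ = 1 + shiftInv e lam β := by
            rw [h1, modelCoeff, if_neg hβ, if_neg]
            exact fun h' => hnegT β (Set.mem_insert _ _) (Set.mem_insert_of_mem _ h')
          have e4 : modelCoeff e lam (insert β T) γ =
              shiftInv e lam β * dirDeriv e β * (1 + shiftDeriv e lam β) := by
            rw [h1, modelCoeff, if_pos (Set.mem_insert _ _)]
          have hc := ((commute_modelCoeff e lam (commute_dirDeriv e β) T β).2 β).eq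
          rw [e1, e2, e3, e4, mul_one, ← hc, mul_assoc, mul_add (shiftInv e lam β),
            shiftInv_mul e lam hβne, mul_one, add_comm]
        · by_cases h2 : γ = -β
          · have hwβ : D.act w β = -D.root i := by rw [← hwγ, h2, map_neg, neg_neg]
            have e1 : f w = 1 := if_neg (by rw [hwβ, map_neg]; linarith)
            have e2 : f (D.s i * w) = dirDeriv e β := if_pos (by
              rw [D.act_mul, hwβ, map_neg, D.act_s, D.co_root, map_neg, map_sub, map_smul,
                smul_eq_mul]; linarith)
            have e3 : modelCoeff e lam T γ = 1 + shiftInv e lam (-β) := by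
              rw [h2, modelCoeff, if_neg, if_neg (by rwa [neg_neg])]
              exact fun h' => hnegT β (Set.mem_insert _ _) (Set.mem_insert_of_mem _ h')
            have e4 : modelCoeff e lam (insert β T) γ = shiftInv e lam β := by
              rw [h2, modelCoeff, if_neg (hnegT β (Set.mem_insert _ _)), neg_neg,
                if_pos (Set.mem_insert _ _)]
            have e5 : shiftInv e lam (-β) = - shiftInv e lam β := by
              have hn : lam (-β) ≠ 0 := by rw [map_neg]; exact neg_ne_zero.2 hβne
              have h6 : shiftDeriv e lam (-β) * -shiftInv e lam β = 1 := by
                rw [map_neg]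
                exact (neg_mul_neg _ _).trans (mul_shiftInv e lam hβne)
              calc shiftInv e lam (-β) = shiftInv e lam (-β) *
                    (shiftDeriv e lam (-β) * -shiftInv e lam β) := by rw [h6, mul_one]
                _ = _ := by rw [← mul_assoc, shiftInv_mul e lam hn, one_mul]
            have h7 := shiftInv_mul e lam hβne
            rw [hDβ, mul_add, mul_one] at h7
            rw [e1, e2, e3, e4, e5, one_mul, ← h7]
            abel
          · have hs : (0 < lam (D.act (D.s i * w) β) ↔ 0 < lam (D.act w β)) := by
              refine h.sign i hi w β hβS (fun h' => h1 ?_) (fun h' => h2 ?_)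
              · rw [hγ, ← h', D.act_inv_act]
              · rw [hγ, ← neg_neg (D.root i), ← h', map_neg, D.act_inv_act]
            have e2 : f (D.s i * w) = f w := by simp only [f, hs]
            have e3 : modelCoeff e lam (insert β T) γ = modelCoeff e lam T γ := by
              have h3 : γ ∈ insert β T ↔ γ ∈ T := by simp [h1]
              have h4 : -γ ∈ insert β T ↔ -γ ∈ T := by
                rw [Set.mem_insert_iff, or_iff_right]
                exact fun h' => h2 (by rw [← h', neg_neg])
              simp only [modelCoeff, h3, h4]
            rw [e2, e3, (hfc T γ).1.eq]
      have k1 := LinearMap.congr_fun key (q (D.s i * w))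
      have k2 := LinearMap.congr_fun (hfc T γ).2.eq (q w)
      simp only [End.mul_apply] at k1 k2
      simp only [LinearMap.pi_apply, LinearMap.comp_apply, LinearMap.proj_apply, modelT_apply,
        map_sub, ← hγ, k1, k2]

end Model

end RootRegions

namespace RootRegions

open Module

/-! ### The submodule of constants and its homomorphisms -/

section Constants

variable {V W R : Type*} [AddCommGroup V] [Module ℝ V] [Group W]
  (D : ReflectionDatum V W R) (lam : V →ₗ[ℝ] ℝ)

open Classical in
/-- The off-diagonal coefficients of the simple reflections on constants. -/
noncomputable def constCoeff (T : Set V) (γ : V) : ℝ :=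
  if γ ∈ T then 0 else if -γ ∈ T then 1 else 1 + (lam γ)⁻¹

/-- The commuting operators on the constants of the model. -/
def constB : V →ₗ[ℝ] End ℝ (W → ℝ) where
  toFun x := LinearMap.pi fun w => lam (D.act w⁻¹ x) • LinearMap.proj w
  map_add' x y := by
    refine LinearMap.ext fun g => funext fun w => ?_
    simp [add_mul]
  map_smul' c x := by
    refine LinearMap.ext fun g => funext fun w => ?_
    simp [mul_assoc]

@[simp]
theorem constB_apply (x : V) (a : W → ℝ) (w : W) :
    constB D lam x a w = lam (D.act w⁻¹ x) * a w := rfl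

/-- The simple reflections on the constants of the model. -/
noncomputable def constT (T : Set V) (i : R) : End ℝ (W → ℝ) :=
  LinearMap.pi fun w => constCoeff lam T (D.act w⁻¹ (D.root i)) • LinearMap.proj (D.s i * w) -
    (lam (D.act w⁻¹ (D.root i)))⁻¹ • LinearMap.proj w

@[simp]
theorem constT_apply (T : Set V) (i : R) (a : W → ℝ) (w : W) :
    constT D lam T i a w = constCoeff lam T (D.act w⁻¹ (D.root i)) * a (D.s i * w) -
      (lam (D.act w⁻¹ (D.root i)))⁻¹ * a w := rfl

/-- The inclusion of the constants. -/
noncomputable def constMap (W ι : Type*) : (W → ℝ) →ₗ[ℝ] (W → MvPolynomial ι ℝ) :=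
  LinearMap.pi fun w => Algebra.linearMap ℝ (MvPolynomial ι ℝ) ∘ₗ LinearMap.proj w

@[simp]
theorem constMap_apply {W ι : Type*} (a : W → ℝ) (w : W) :
    constMap W ι a w = MvPolynomial.C (a w) := rfl

theorem constMap_injective (W ι : Type*) : Function.Injective (constMap W ι) := fun _ _ h =>
  funext fun w => MvPolynomial.C_injective ι ℝ (congrFun h w)

variable {D lam} {S : Set V} {T : Set V} {ι : Type*} [Fintype ι] (e : Basis ι ℝ V)

/-- For `γ ∈ T` the factor `∂_γ` kills constants; for `-γ ∈ T` the scalar is 1 because `λ(-γ) = 1`.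
-/
theorem modelCoeff_C (h : IsRegularFunctional D lam S) (hTS : T ⊆ S) {γ : V} (hγ : lam γ ≠ 0)
    (c : ℝ) :
    modelCoeff e lam T γ (MvPolynomial.C c) = MvPolynomial.C (constCoeff lam T γ * c) := by
  rw [modelCoeff, constCoeff]
  split_ifs with h1 h2
  · simp only [End.mul_apply, LinearMap.add_apply, End.one_apply, shiftDeriv_C, map_add, dirDeriv_C]
    simp
  · have := h.eq_one _ (hTS h2)
    rw [shiftInv_C e lam (by rw [this]; exact one_ne_zero), this, inv_one]
  · rw [LinearMap.add_apply, End.one_apply, shiftInv_C e lam hγ, add_mul, one_mul, map_add]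

theorem constMap_constT (h : IsRegularFunctional D lam S) (hTS : T ⊆ S) {i : R}
    (hi : i ∈ D.simple) (a : W → ℝ) :
    constMap W ι (constT D lam T i a) = modelT D e lam T i (constMap W ι a) := by
  funext w
  have hγ := h.ne_zero i hi w⁻¹
  simp [modelCoeff_C e h hTS hγ, shiftInv_C e lam hγ]

theorem constMap_constB (x : V) (a : W → ℝ) :
    constMap W ι (constB D lam x a) = modelB D e lam x (constMap W ι a) := by
  funext w
  simp [shiftDeriv_C]

theorem constT_constB (h : IsRegularFunctional D lam S) (T : Set V) {i : R} (hi : i ∈ D.simple)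
    (x : V) (a : W → ℝ) :
    constT D lam T i (constB D lam x a) =
      constB D lam (D.act (D.s i) x) (constT D lam T i a) - D.co i x • a := by
  funext w
  have hγ := h.ne_zero i hi w⁻¹
  have h1 : D.act (D.s i * w)⁻¹ x = D.act w⁻¹ (D.act (D.s i) x) := by
    rw [mul_inv_rev, D.act_mul, D.s_inv]
  simp only [constT_apply, constB_apply, Pi.sub_apply, Pi.smul_apply, h1, smul_eq_mul]
  rw [D.act_s, map_sub, map_sub, map_smul, map_smul, smul_eq_mul]
  field_simp
  ring

variable [Fintype R] [Fintype W]

/-- The constants are stable in the model, so they inherit its group representation. -/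
theorem exists_constModule (h : IsRegularFunctional D lam S) (hT : T.Finite) (hTS : T ⊆ S)
    (e : Basis ι ℝ V) :
    ∃ M : HeckeModule D (W → ℝ), (∀ i ∈ D.simple, M.rho (D.s i) = constT D lam T i) ∧
      M.shift (-1) = constB D lam := by
  obtain ⟨ρ, hρ⟩ := exists_modelRep e h hT hTS
  obtain ⟨ρ', hρ'⟩ := exists_rep_of_injective (D := D) ρ (constMap W ι) (constMap_injective W ι)
    (constT D lam T) (fun i hi q => by rw [hρ i hi, constMap_constT e h hTS hi])
  have hB : ∀ x y, constB D lam x * constB D lam y = constB D lam y * constB D lam x := by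
    intro x y
    refine LinearMap.ext fun a => funext fun w => ?_
    simp only [End.mul_apply, constB_apply]
    ring
  have hrel : ∀ i ∈ D.simple, ∀ x l, ρ' (D.s i) (constB D lam x l) =
      constB D lam (D.act (D.s i) x) (ρ' (D.s i) l) - D.co i x • l := by
    intro i hi x l
    rw [hρ' i hi, constT_constB h T hi]
  exact ⟨HeckeModule.ofShift ρ' (constB D lam) hB hrel, hρ', HeckeModule.ofShift_shift _ _ _ _⟩

theorem exists_modelModule (h : IsRegularFunctional D lam S) (hT : T.Finite) (hTS : T ⊆ S) :
    ∃ M : HeckeModule D (W → MvPolynomial ι ℝ),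
      (∀ i ∈ D.simple, M.rho (D.s i) = modelT D e lam T i) ∧ M.shift (-1) = modelB D e lam := by
  obtain ⟨ρ, hρ⟩ := exists_modelRep e h hT hTS
  have hrel : ∀ i ∈ D.simple, ∀ x l, ρ (D.s i) (modelB D e lam x l) =
      modelB D e lam (D.act (D.s i) x) (ρ (D.s i) l) - D.co i x • l := by
    intro i hi x l
    rw [hρ i hi, modelT_modelB e h T hi]
  exact ⟨HeckeModule.ofShift ρ (modelB D e lam) (modelB_comm D e lam) hrel, hρ,
    HeckeModule.ofShift_shift _ _ _ _⟩

/-- Homomorphisms from the constants to the model are scalar. -/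
theorem heckeHom_const_eq (h : IsRegularFunctional D lam S) (hTS : T ⊆ S)
    {M : HeckeModule D (W → ℝ)} (hM : ∀ i ∈ D.simple, M.rho (D.s i) = constT D lam T i)
    (hMB : M.shift (-1) = constB D lam) {I : HeckeModule D (W → MvPolynomial ι ℝ)}
    (hI : ∀ i ∈ D.simple, I.rho (D.s i) = modelT D e lam T i)
    (hIB : I.shift (-1) = modelB D e lam) {F : (W → ℝ) →ₗ[ℝ] (W → MvPolynomial ι ℝ)}
    (hF : IsHeckeHom M I F) : ∃ c : ℝ, ∀ a, F a = c • constMap W ι a := by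
  classical
  have h1 : ∀ w, ∃ c : ℝ, F (Pi.single w 1) = Pi.single w (MvPolynomial.C c) := by
    intro w
    -- The image of `Pi.single w 1` is a joint eigenvector of weight `λ(w⁻¹ ·)`. Other components
    -- vanish as the weights are distinct, and all derivatives of the component `w` vanish.
    have h2 : ∀ x w', shiftDeriv e lam (D.act w'⁻¹ x) (F (Pi.single w 1) w') =
        lam (D.act w⁻¹ x) • F (Pi.single w 1) w' := by
      intro x w'
      have h3 := hF.shift (-1) x (Pi.single w 1)
      have h4 : constB D lam x (Pi.single w 1) = lam (D.act w⁻¹ x) • (Pi.single w 1 : W → ℝ) := by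
        funext v
        by_cases hv : v = w
        · subst hv; simp
        · simp [Pi.single_eq_of_ne hv]
      rw [hMB, hIB, h4, map_smul] at h3
      exact (congrFun h3 w').symm
    obtain ⟨c, hc⟩ := eq_C_of_dirDeriv_eq_zero e (F (Pi.single w 1) w) (by
      intro y
      have := h2 (D.act w y) w
      rw [D.act_inv_act, shiftDeriv_eq] at this
      simpa using this)
    refine ⟨c, funext fun w' => ?_⟩
    by_cases hw : w' = w
    · subst hw; rw [hc, Pi.single_eq_same]
    · rw [Pi.single_eq_of_ne hw]
      obtain ⟨x, hx⟩ : ∃ x, lam (D.act w'⁻¹ x) ≠ lam (D.act w⁻¹ x) := by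
        by_contra! hx
        exact hw (inv_injective (h.separating _ _ hx))
      refine (dirDeriv_add_const_bijective e (D.act w'⁻¹ x) (sub_ne_zero.2 hx)).1 ?_
      have := h2 x w'
      rw [shiftDeriv_eq, LinearMap.add_apply, LinearMap.smul_apply, End.one_apply] at this
      rw [map_zero, LinearMap.add_apply, LinearMap.smul_apply, End.one_apply, sub_smul, ← this]
      abel
  choose f hf using h1
  have hFa : ∀ a w, F a w = MvPolynomial.C (f w * a w) := by
    intro a w
    have ha : a = ∑ v, a v • (Pi.single v 1 : W → ℝ) := by
      funext u
      simp [Finset.sum_apply, Pi.single_apply]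
    conv_lhs => rw [ha]
    rw [map_sum, Finset.sum_apply, Finset.sum_eq_single w]
    · rw [map_smul, hf, Pi.smul_apply, Pi.single_eq_same, MvPolynomial.smul_eq_C_mul, ← map_mul,
        mul_comm]
    · intro v _ hv
      rw [map_smul, hf, Pi.smul_apply, Pi.single_eq_of_ne hv.symm, smul_zero]
    · simp
  have h3 : ∀ i ∈ D.simple, ∀ w,
      constCoeff lam T (D.act w⁻¹ (D.root i)) * (f w - f (D.s i * w)) = 0 := by
    intro i hi w
    have hγ := h.ne_zero i hi w⁻¹
    have h4 := congrFun (hF.rho (D.s i) fun _ => 1) w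
    rw [hM i hi, hI i hi, hFa, modelT_apply, hFa, hFa, modelCoeff_C e h hTS hγ,
      shiftInv_C e lam hγ, ← map_sub] at h4
    have h5 := MvPolynomial.C_injective _ _ h4
    simp only [constT_apply] at h5
    linarith
  have h4 : ∀ i ∈ D.simple, ∀ w, f (D.s i * w) = f w := by
    intro i hi w
    have hγ := h.ne_zero i hi w⁻¹
    have e1 := h3 i hi w
    have e2 := h3 i hi (D.s i * w)
    have e3 : D.act (D.s i * w)⁻¹ (D.root i) = - D.act w⁻¹ (D.root i) := by
      rw [mul_inv_rev, D.act_mul, D.s_inv, D.act_s, D.co_root, two_smul, sub_add_cancel_left,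
        map_neg]
    rw [e3, D.s_mul_s_mul] at e2
    set γ := D.act w⁻¹ (D.root i)
    -- The coefficients at `γ` and `-γ` never vanish together: they are 0 and 1 if `γ` or `-γ` lies
    -- in `T`, and `1 ± 1/λ(γ)` otherwise.
    by_contra hne
    have e4 : constCoeff lam T γ = 0 :=
      (mul_eq_zero.1 e1).resolve_right (sub_ne_zero.2 (Ne.symm hne))
    have e5 : constCoeff lam T (-γ) = 0 :=
      (mul_eq_zero.1 e2).resolve_right (sub_ne_zero.2 hne)
    have hnot : γ ∈ T → -γ ∉ T := by
      intro h6 h7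
      have h8 := h.eq_one _ (hTS h6)
      have h9 := h.eq_one _ (hTS h7)
      rw [map_neg, h8] at h9
      norm_num at h9
    rw [constCoeff] at e4 e5
    rw [neg_neg, map_neg] at e5
    by_cases h6 : γ ∈ T
    · rw [if_neg (hnot h6), if_pos h6] at e5
      exact one_ne_zero e5
    · by_cases h7 : -γ ∈ T
      · rw [if_neg h6, if_pos h7] at e4
        exact one_ne_zero e4
      · rw [if_neg h6, if_neg h7] at e4
        rw [if_neg h7, if_neg h6, inv_neg] at e5
        linarith
  have h5 : ∀ u w, f (u * w) = f w := by
    intro u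
    induction u using D.induction_simple with
    | h1 => simp
    | hs i hi => exact h4 i hi
    | hmul u v hu hv => intro w; rw [mul_assoc, hu, hv]
  refine ⟨f 1, fun a => funext fun w => ?_⟩
  have h6 := h5 w 1
  rw [mul_one] at h6
  rw [hFa, h6, Pi.smul_apply, constMap_apply, MvPolynomial.smul_eq_C_mul, map_mul]

open Classical in
/-- The indicator of the group elements at which the sign of `β` agrees with `T`. -/
noncomputable def signDiag (D : ReflectionDatum V W R) (lam : V →ₗ[ℝ] ℝ) (T : Set V) (β : V)
    (w : W) : ℝ :=
  if (β ∈ T ↔ 0 < lam (D.act w β)) then 1 else 0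

-- If `γ = ±β` both sides are zero: wherever an indicator is 1, the coefficient next to it is 0. For
-- other `γ` neither the sign of `λ(wβ)` nor the coefficient changes.
omit [Fintype R] [Fintype W] in
theorem signDiag_mul_constCoeff (h : IsRegularFunctional D lam S) (hTS : T ⊆ S) {β : V}
    (hβ : β ∈ S) {i : R} (hi : i ∈ D.simple) (w : W) :
    signDiag D lam T β w * constCoeff lam T (D.act w⁻¹ (D.root i)) =
      constCoeff lam (symmDiff T {β}) (D.act w⁻¹ (D.root i)) * signDiag D lam T β (D.s i * w) := by
  classical
  have hpos := h.pos i hi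
  have hβ1 := h.eq_one β hβ
  have hneg : -β ∉ T := by
    intro h'
    have := h.eq_one _ (hTS h')
    rw [map_neg, hβ1] at this
    norm_num at this
  have hβne : -β ≠ β := by
    intro h'
    have := congrArg lam h'
    rw [map_neg, hβ1] at this
    norm_num at this
  have hmem : ∀ δ, δ ∈ symmDiff T {β} ↔ (δ ∈ T ∧ δ ≠ β ∨ δ = β ∧ δ ∉ T) := fun δ => Iff.rfl
  set γ := D.act w⁻¹ (D.root i) with hγ
  have hwγ : D.act w γ = D.root i := by rw [hγ, D.act_act_inv]
  by_cases h1 : γ = β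
  · have hwβ : D.act w β = D.root i := by rw [← h1, hwγ]
    have e1 : 0 < lam (D.act w β) := by rw [hwβ]; exact hpos
    have e2 : ¬ 0 < lam (D.act (D.s i * w) β) := by
      rw [D.act_mul, hwβ, D.act_s, D.co_root, map_sub, map_smul, smul_eq_mul]; linarith
    rw [h1]
    by_cases hT : β ∈ T <;> simp [signDiag, constCoeff, e1, e2, hT, hmem, -map_mul]
  · by_cases h2 : γ = -β
    · have hwβ : D.act w β = -D.root i := by rw [← hwγ, h2, map_neg, neg_neg]
      have e1 : ¬ 0 < lam (D.act w β) := by rw [hwβ, map_neg]; linarith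
      have e2 : 0 < lam (D.act (D.s i * w) β) := by
        rw [D.act_mul, hwβ, map_neg, D.act_s, D.co_root, map_neg, map_sub, map_smul, smul_eq_mul]
        linarith
      rw [h2]
      by_cases hT : β ∈ T <;> simp [signDiag, constCoeff, e1, e2, hT, hmem, hneg, hβne, hβ1, -map_mul]
    · have hs : (0 < lam (D.act (D.s i * w) β) ↔ 0 < lam (D.act w β)) := by
        refine h.sign i hi w β hβ (fun h' => h1 ?_) (fun h' => h2 ?_)
        · rw [hγ, ← h', D.act_inv_act]
        · rw [hγ, ← neg_neg (D.root i), ← h', map_neg, D.act_inv_act]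
      have h2' : -γ ≠ β := fun h' => h2 (by rw [← h', neg_neg])
      have e3 : constCoeff lam (symmDiff T {β}) γ = constCoeff lam T γ := by
        have h3 : γ ∈ symmDiff T {β} ↔ γ ∈ T := by simp [hmem, h1]
        have h4 : -γ ∈ symmDiff T {β} ↔ -γ ∈ T := by simp [hmem, h2']
        exact if_congr h3 rfl (if_congr h4 rfl rfl)
      have e4 : signDiag D lam T β (D.s i * w) = signDiag D lam T β w :=
        if_congr (by rw [hs]) rfl rfl
      rw [e3, e4, mul_comm]

end Constants

/-! ### Realising all sign patterns -/

/-- Every sign pattern on the vectors of value `1` is realised by an element of the group. -/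
theorem exists_sign_pattern.{u} {V W : Type u} {R : Type*} [AddCommGroup V] [Module ℝ V]
    [FiniteDimensional ℝ V] [Group W] [Fintype W] [Fintype R] {D : ReflectionDatum V W R}
    {lam : V →ₗ[ℝ] ℝ} {S : Set V} (h : IsRegularFunctional D lam S) (hS : S.Finite) {T : Set V}
    (hTS : T ⊆ S) : ∃ w, ∀ β ∈ S, ¬ (β ∈ T ↔ 0 < lam (D.act w β)) := by
  classical
  by_contra! hcon
  have := hS.fintype
  let e := finBasis ℝ V
  have hsub : ∀ β : S, symmDiff T {β.1} ⊆ S := by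
    rintro β δ (⟨h1, -⟩ | ⟨rfl, -⟩)
    exacts [hTS h1, β.2]
  obtain ⟨M, hM, hMB⟩ := exists_constModule h (hS.subset hTS) hTS e
  obtain ⟨I, hI, hIB⟩ := exists_modelModule e h (hS.subset hTS) hTS
  choose N hN hNB using fun β : S => exists_constModule h (hS.subset (hsub β)) (hsub β) e
  -- Jointly injective because, by the contrary assumption, each `w` agrees with `T` at some `β`.
  let j : S → (W → ℝ) →ₗ[ℝ] (W → ℝ) := fun β =>
    LinearMap.pi fun w => signDiag D lam T β w • LinearMap.proj w
  have hj : ∀ β a w, j β a w = signDiag D lam T β w * a w := fun _ _ _ => rfl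
  have hjH : ∀ β, IsHeckeHom M (N β) (j β) := by
    intro β
    refine IsHeckeHom.of_simple (fun i hi a => ?_) fun x a => ?_
    · rw [hM i hi, hN β i hi]
      funext w
      have := signDiag_mul_constCoeff h hTS β.2 hi w
      simp only [hj, constT_apply]
      linear_combination a (D.s i * w) * this
    · rw [hMB, hNB]
      funext w
      simp only [hj, constB_apply]
      ring
  have hjpi : IsHeckeHom M (HeckeModule.pi N) (LinearMap.pi j) := by
    constructor
    · intro w a
      funext β
      exact (hjH β).rho w a
    · intro x a
      funext β
      exact (hjH β).X x a
  have hinj : Function.Injective (LinearMap.pi j) := by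
    intro a b hab
    funext w
    obtain ⟨β, hβ, hw⟩ := hcon w
    have := congrFun (congrFun hab ⟨β, hβ⟩) w
    simpa [hj, signDiag, hw] using this
  have hιH : IsHeckeHom M I (constMap W (Fin (finrank ℝ V))) := by
    refine IsHeckeHom.of_simple (fun i hi a => ?_) fun x a => ?_
    · rw [hM i hi, hI i hi, constMap_constT e h hTS hi]
    · rw [hMB, hIB, constMap_constB]
  obtain ⟨g, hgH, hg⟩ := exists_heckeHom_extend I (fun L _ _ _ B hB => by
    rw [hIB]; exact koszulAcyclic_modelB e B hB) hjpi hinj hιH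
  have hsH : ∀ β, IsHeckeHom (N β) (HeckeModule.pi N)
      (LinearMap.single ℝ (fun _ : S => W → ℝ) β) := by
    intro β
    constructor
    · intro w a
      funext δ
      change (Pi.single β (((N β).rho w) a) : S → W → ℝ) δ = (N δ).rho w ((Pi.single β a : S → W → ℝ) δ)
      by_cases hδ : δ = β
      · subst hδ; simp
      · rw [Pi.single_eq_of_ne hδ, Pi.single_eq_of_ne hδ, map_zero]
    · intro x a
      funext δ
      change (Pi.single β (((N β).X x) a) : S → W → ℝ) δ = (N δ).X x ((Pi.single β a : S → W → ℝ) δ)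
      by_cases hδ : δ = β
      · subst hδ; simp
      · rw [Pi.single_eq_of_ne hδ, Pi.single_eq_of_ne hδ, map_zero]
  have hF : ∀ β a, g (Pi.single β (j β a)) = 0 := by
    intro β
    obtain ⟨c, hc⟩ := heckeHom_const_eq e h hTS hM hMB hI hIB
      ((hgH.comp (hsH β)).comp (hjH β))
    have hc' : ∀ a, g (Pi.single β (j β a)) = c • constMap W _ a := hc
    -- At such a `w` the composite through the factor `β` kills `Pi.single w 1`, so its scalar `c`
    -- is zero.
    obtain ⟨w, hw⟩ : ∃ w, signDiag D lam T β w = 0 := by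
      by_cases hβ : β.1 ∈ T
      · obtain ⟨w, hw⟩ := h.exists_neg β β.2
        exact ⟨w, by simp [signDiag, hβ, hw.le]⟩
      · exact ⟨1, by simp [signDiag, hβ, h.eq_one β β.2]⟩
    have h1 : j β (Pi.single w 1) = 0 := by
      funext v
      rw [hj]
      by_cases hv : v = w
      · subst hv; rw [hw, zero_mul]; rfl
      · rw [Pi.single_eq_of_ne hv, mul_zero]; rfl
    have h2 := congrFun (hc' (Pi.single w 1)) w
    rw [h1, Pi.single_zero, map_zero, Pi.smul_apply, constMap_apply, Pi.single_eq_same,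
      Pi.zero_apply, map_one, eq_comm, smul_eq_zero] at h2
    have h3 : c = 0 := h2.resolve_right one_ne_zero
    intro a
    rw [hc', h3, zero_smul]
  have h1 : constMap W (Fin (finrank ℝ V)) (fun _ => 1) = 0 := by
    rw [← hg, ← Finset.univ_sum_single (LinearMap.pi j fun _ => 1), map_sum]
    exact Finset.sum_eq_zero fun β _ => hF β _
  have := congrFun h1 1
  simp at this

end RootRegions

namespace RootRegions

open Module

/-! ### The reflection group of a root system -/

section Reflections

variable {V : Type*} [NormedAddCommGroup V] [InnerProductSpace ℝ V]

theorem isometry_mul_apply (u w : V ≃ₗᵢ[ℝ] V) (x : V) : (u * w) x = u (w x) := rfl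

/-- The orthogonal reflection in the hyperplane orthogonal to `β`. -/
noncomputable def rootReflection (β : V) : V ≃ₗᵢ[ℝ] V := (Submodule.span ℝ {β})ᗮ.reflection

/-- The linear form `x ↦ 2 (β|x) / (β|β)`. -/
noncomputable def corootForm (β : V) : V →ₗ[ℝ] ℝ := (2 / ⟪β, β⟫_ℝ) • (innerSL ℝ β : V →ₗ[ℝ] ℝ)

theorem corootForm_apply (β x : V) : corootForm β x = 2 / ⟪β, β⟫_ℝ * ⟪β, x⟫_ℝ := by
  simp [corootForm]

theorem corootForm_self {β : V} (hβ : β ≠ 0) : corootForm β β = 2 := by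
  rw [corootForm_apply, div_mul_cancel₀]
  exact inner_self_ne_zero.2 hβ

theorem rootReflection_apply (β x : V) : rootReflection β x = x - corootForm β x • β := by
  rw [rootReflection, Submodule.reflection_orthogonal_apply, Submodule.reflection_singleton_apply,
    corootForm_apply, real_inner_self_eq_norm_sq, neg_sub, two_smul, ← add_smul]
  congr 2
  simp
  ring

theorem rootReflection_self (β : V) : rootReflection β β = -β :=
  Submodule.reflection_orthogonalComplement_singleton_eq_neg β

theorem rootReflection_mul_self (β : V) : rootReflection β * rootReflection β = 1 :=
  Submodule.reflection_mul_reflection _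

@[simp]
theorem rootReflection_rootReflection (β x : V) : rootReflection β (rootReflection β x) = x :=
  Submodule.reflection_reflection _ x

theorem corootForm_map (w : V ≃ₗᵢ[ℝ] V) (β x : V) : corootForm (w β) (w x) = corootForm β x := by
  simp [corootForm_apply]

theorem rootReflection_map (w : V ≃ₗᵢ[ℝ] V) (β : V) :
    rootReflection (w β) = w * rootReflection β * w⁻¹ := by
  ext x
  obtain ⟨x, rfl⟩ := w.surjective x
  have h : w⁻¹ (w x) = x := w.symm_apply_apply x
  rw [isometry_mul_apply, isometry_mul_apply, h, rootReflection_apply,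
    rootReflection_apply, corootForm_map, map_sub, map_smul]

variable {n : ℕ}

/-- The group generated by the simple reflections. -/
def weylGroup (α : Fin n → V) : Subgroup (V ≃ₗᵢ[ℝ] V) :=
  Subgroup.closure (Set.range fun i => rootReflection (α i))

theorem rootReflection_mem_weylGroup (α : Fin n → V) (i : Fin n) :
    rootReflection (α i) ∈ weylGroup α := Subgroup.subset_closure ⟨i, rfl⟩

theorem exists_list_of_mem_weylGroup {α : Fin n → V} {w : V ≃ₗᵢ[ℝ] V} (hw : w ∈ weylGroup α) :
    ∃ l : List (Fin n), w = (l.map fun i => rootReflection (α i)).prod := by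
  induction hw using Subgroup.closure_induction'' with
  | one => exact ⟨[], rfl⟩
  | mem x hx => obtain ⟨i, rfl⟩ := hx; exact ⟨[i], by simp⟩
  | inv_mem x hx =>
    obtain ⟨i, rfl⟩ := hx
    exact ⟨[i], by simp [inv_eq_of_mul_eq_one_left (rootReflection_mul_self (α i))]⟩
  | mul x y _ _ hx hy =>
    obtain ⟨l, rfl⟩ := hx
    obtain ⟨l', rfl⟩ := hy
    exact ⟨l ++ l', by simp⟩

variable {Φ : Set V} {α : Fin n → V} (hΦ : IsRootSystem Φ) (hα : IsSimpleSystem Φ α)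

include hΦ

theorem IsRootSystem.rootReflection_mem {β γ : V} (hβ : β ∈ Φ) (hγ : γ ∈ Φ) :
    rootReflection β γ ∈ Φ := by
  rw [← hΦ.image_reflection β hβ]
  exact ⟨γ, hγ, rfl⟩

theorem IsRootSystem.ne_zero {β : V} (hβ : β ∈ Φ) : β ≠ 0 := fun h => hΦ.zero_notMem (h ▸ hβ)

theorem posRoots_finite : (posRoots Φ α).Finite := hΦ.finite.subset fun _ h => h.1

include hα

theorem weylGroup_apply_mem {w : V ≃ₗᵢ[ℝ] V} (hw : w ∈ weylGroup α) :
    ∀ {β : V}, β ∈ Φ → w β ∈ Φ := by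
  obtain ⟨l, rfl⟩ := exists_list_of_mem_weylGroup hw
  clear hw
  induction l with
  | nil => exact fun h => h
  | cons i l ih =>
    intro β hβ
    rw [List.map_cons, List.prod_cons, isometry_mul_apply]
    exact hΦ.rootReflection_mem (hα.mem i) (ih hβ)

/-- The action on `Φ` is faithful even if `Φ` does not span: if `w` and `w'` agree on `Φ`, then `w x
- w' x` lies in the span of `Φ` and is orthogonal to `Φ`. -/
theorem finite_weylGroup : Finite (weylGroup α) := by
  have := hΦ.finite.to_subtype
  have hspan : ∀ w ∈ weylGroup α, ∀ x, w x - x ∈ Submodule.span ℝ Φ := by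
    intro w hw
    obtain ⟨l, rfl⟩ := exists_list_of_mem_weylGroup hw
    clear hw
    induction l with
    | nil => intro x; simp
    | cons i l ih =>
      intro x
      rw [List.map_cons, List.prod_cons, isometry_mul_apply, rootReflection_apply,
        sub_right_comm]
      exact Submodule.sub_mem _ (ih x) (Submodule.smul_mem _ _ (Submodule.subset_span (hα.mem i)))
  let f : weylGroup α → (Φ → Φ) := fun w β => ⟨w.1 β, weylGroup_apply_mem hΦ hα w.2 β.2⟩
  refine Finite.of_injective f fun w w' h => Subtype.ext ?_
  have h1 : ∀ β ∈ Φ, w.1 β = w'.1 β := fun β hβ =>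
    congrArg Subtype.val (congrFun h ⟨β, hβ⟩)
  ext x
  rw [← sub_eq_zero]
  have h2 : w.1 x - w'.1 x ∈ Submodule.span ℝ Φ := by
    have := Submodule.sub_mem _ (hspan w.1 w.2 x) (hspan w'.1 w'.2 x)
    rwa [sub_sub_sub_cancel_right] at this
  have h3 : ∀ β ∈ Φ, ⟪β, w.1 x - w'.1 x⟫_ℝ = 0 := by
    intro β hβ
    have e1 : w.1⁻¹ β = w'.1⁻¹ β := by
      have hm := weylGroup_apply_mem hΦ hα (inv_mem w.2) hβ
      have := h1 _ hm
      have e2 : w.1 (w.1⁻¹ β) = β := w.1.apply_symm_apply β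
      rw [e2] at this
      apply w'.1.injective
      rw [← this]
      exact (w'.1.apply_symm_apply β).symm
    have e3 : ∀ u : V ≃ₗᵢ[ℝ] V, ⟪β, u x⟫_ℝ = ⟪u⁻¹ β, x⟫_ℝ := by
      intro u
      rw [← u.inner_map_map (u⁻¹ β) x]
      congr 1
      exact (u.apply_symm_apply β).symm
    rw [inner_sub_right, e3, e3, e1, sub_self]
  have h4 : Submodule.span ℝ Φ ≤ (Submodule.span ℝ {w.1 x - w'.1 x})ᗮ := by
    rw [Submodule.span_le]
    intro β hβ
    rw [SetLike.mem_coe, Submodule.mem_orthogonal_singleton_iff_inner_left]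
    exact h3 β hβ
  exact inner_self_eq_zero.1 ((Submodule.mem_orthogonal_singleton_iff_inner_left).1 (h4 h2))

variable {v : V} (hv : v ∈ chamber α)

include hv

omit hΦ hα in
theorem inner_pos_of_isNonnegComb {β : V} (hβ : IsNonnegComb α β) (h0 : β ≠ 0) : 0 < ⟪v, β⟫_ℝ := by
  obtain ⟨c, hc, rfl⟩ := hβ
  rw [inner_sum]
  have h1 : ∀ i ∈ Finset.univ, 0 ≤ ⟪v, c i • α i⟫_ℝ := fun i _ => by
    rw [real_inner_smul_right]
    exact mul_nonneg (hc i) (hv i).le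
  refine lt_of_le_of_ne (Finset.sum_nonneg h1) fun h => h0 ?_
  refine Finset.sum_eq_zero fun i hi => ?_
  have h2 := (Finset.sum_eq_zero_iff_of_nonneg h1).1 h.symm i hi
  rw [real_inner_smul_right] at h2
  rw [(mul_eq_zero.1 h2).resolve_right (hv i).ne', zero_smul]

theorem mem_posRoots_iff {β : V} (hβ : β ∈ Φ) : β ∈ posRoots Φ α ↔ 0 < ⟪v, β⟫_ℝ := by
  refine ⟨fun h => inner_pos_of_isNonnegComb hv h.2 (hΦ.ne_zero hβ), fun h => ⟨hβ, ?_⟩⟩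
  refine (hα.nonneg_or_nonpos β hβ).resolve_right fun h' => ?_
  have := inner_pos_of_isNonnegComb hv h' (neg_ne_zero.2 (hΦ.ne_zero hβ))
  rw [inner_neg_right] at this
  linarith

theorem inner_root_ne_zero {β : V} (hβ : β ∈ Φ) : ⟪v, β⟫_ℝ ≠ 0 := by
  rcases hα.nonneg_or_nonpos β hβ with h | h
  · exact (inner_pos_of_isNonnegComb hv h (hΦ.ne_zero hβ)).ne'
  · have := inner_pos_of_isNonnegComb hv h (neg_ne_zero.2 (hΦ.ne_zero hβ))
    rw [inner_neg_right] at this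
    linarith

/-- Only the coefficient of `α i` changes, so a positive root sent to a negative one would be a
multiple of `α i`. -/
theorem rootReflection_simple_mem_posRoots (i : Fin n) {β : V} (hβ : β ∈ posRoots Φ α)
    (hne : β ≠ α i) : rootReflection (α i) β ∈ posRoots Φ α := by
  classical
  have hmem := hΦ.rootReflection_mem (hα.mem i) hβ.1
  refine ⟨hmem, (hα.nonneg_or_nonpos _ hmem).resolve_right fun h => ?_⟩
  obtain ⟨c, hc, hcβ⟩ := hβ.2
  obtain ⟨d, hd, hdβ⟩ := h
  rw [rootReflection_apply, neg_sub, sub_eq_iff_eq_add] at hdβ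
  set t := corootForm (α i) β
  have h1 : ∑ j, (d j + c j - (Pi.single i t : Fin n → ℝ) j) • α j = 0 := by
    simp only [sub_smul, add_smul, Finset.sum_sub_distrib, Finset.sum_add_distrib]
    rw [← hcβ, ← hdβ, sub_eq_zero, Finset.sum_eq_single i]
    · rw [Pi.single_eq_same]
    · intro j _ hj
      rw [Pi.single_eq_of_ne hj, zero_smul]
    · simp
  have h2 := Fintype.linearIndependent_iff.1 hα.linearIndependent _ h1
  have h3 : β = c i • α i := by
    rw [hcβ, Finset.sum_eq_single i]
    · intro j _ hj
      have := h2 j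
      rw [Pi.single_eq_of_ne hj, sub_zero] at this
      have h4 : c j = 0 := by linarith [hc j, hd j]
      rw [h4, zero_smul]
    · simp
  have h4 : β ∈ Φ ∩ (Submodule.span ℝ {α i} : Set V) :=
    ⟨hβ.1, Submodule.mem_span_singleton.2 ⟨c i, h3.symm⟩⟩
  rw [hΦ.inter_line _ (hα.mem i)] at h4
  rcases h4 with h4 | h4
  · exact hne h4
  · have h5 := (mem_posRoots_iff hΦ hα hv hβ.1).1 hβ
    rw [Set.mem_singleton_iff.1 h4, inner_neg_right] at h5
    linarith [hv i]

/-- Take a counterexample with `(v|β)` minimal. Some simple root has positive product with `β`, and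
reflecting in it gives a positive root of smaller value. -/
theorem exists_weylGroup_simple {β : V} (hβ : β ∈ posRoots Φ α) :
    ∃ w ∈ weylGroup α, ∃ i, w (α i) = β := by
  by_contra hcon
  set B := {β ∈ posRoots Φ α | ¬ ∃ w ∈ weylGroup α, ∃ i, w (α i) = β} with hB
  have hfin : B.Finite := (posRoots_finite hΦ).subset fun _ h => h.1
  obtain ⟨β, hβB, hmin⟩ := Set.exists_min_image B (fun β => ⟪v, β⟫_ℝ) hfin ⟨β, hβ, hcon⟩
  obtain ⟨c, hc, hcβ⟩ := hβB.1.2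
  obtain ⟨i, hi⟩ : ∃ i, 0 < ⟪α i, β⟫_ℝ := by
    by_contra! hle
    have h1 : ⟪β, β⟫_ℝ ≤ 0 := by
      nth_rewrite 1 [hcβ]
      rw [sum_inner]
      refine Finset.sum_nonpos fun i _ => ?_
      rw [real_inner_smul_left]
      exact mul_nonpos_of_nonneg_of_nonpos (hc i) (hle i)
    exact hΦ.ne_zero hβB.1.1 (real_inner_self_nonpos.1 h1)
  have hne : β ≠ α i := fun h => hβB.2 ⟨1, one_mem _, i, h.symm⟩
  have hpos := rootReflection_simple_mem_posRoots hΦ hα hv i hβB.1 hne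
  have hlt : ⟪v, rootReflection (α i) β⟫_ℝ < ⟪v, β⟫_ℝ := by
    rw [rootReflection_apply, inner_sub_right, real_inner_smul_right, corootForm_apply]
    have h1 : 0 < ⟪α i, α i⟫_ℝ := real_inner_self_pos.2 (hΦ.ne_zero (hα.mem i))
    have h2 := hv i
    have : 0 < 2 / ⟪α i, α i⟫_ℝ * ⟪α i, β⟫_ℝ * ⟪v, α i⟫_ℝ := by positivity
    linarith
  have hnot : rootReflection (α i) β ∉ B := fun h => absurd (hmin _ h) (not_le.2 hlt)
  have : ∃ w ∈ weylGroup α, ∃ j, w (α j) = rootReflection (α i) β := by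
    by_contra h
    exact hnot ⟨hpos, h⟩
  obtain ⟨w, hw, j, hj⟩ := this
  refine hβB.2 ⟨rootReflection (α i) * w, mul_mem (rootReflection_mem_weylGroup α i) hw, j, ?_⟩
  rw [isometry_mul_apply, hj, rootReflection_rootReflection]

theorem rootReflection_mem_weylGroup_of_mem {β : V} (hβ : β ∈ posRoots Φ α) :
    rootReflection β ∈ weylGroup α := by
  obtain ⟨w, hw, i, rfl⟩ := exists_weylGroup_simple hΦ hα hv hβ
  rw [rootReflection_map]
  exact mul_mem (mul_mem hw (rootReflection_mem_weylGroup α i)) (inv_mem hw)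

/-- The exchange property. -/
theorem exchange (l : List (Fin n)) (i : Fin n)
    (h : ⟪v, (l.map fun i => rootReflection (α i)).prod (α i)⟫_ℝ < 0) :
    ∃ l' : List (Fin n), l'.length < l.length ∧
      (l'.map fun i => rootReflection (α i)).prod =
        (l.map fun i => rootReflection (α i)).prod * rootReflection (α i) := by
  induction l with
  | nil => exact absurd h (not_lt.2 (hv i).le)
  | cons j l ih =>
    simp only [List.map_cons, List.prod_cons, isometry_mul_apply] at h ⊢
    set w := (l.map fun i => rootReflection (α i)).prod with hw
    have hwW : w ∈ weylGroup α := list_prod_mem (by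
      intro x hx
      obtain ⟨k, -, rfl⟩ := List.mem_map.1 hx
      exact rootReflection_mem_weylGroup α k)
    have hwi := weylGroup_apply_mem hΦ hα hwW (hα.mem i)
    rcases lt_or_gt_of_ne (inner_root_ne_zero hΦ hα hv hwi) with h1 | h1
    · obtain ⟨l', hl', hl⟩ := ih h1
      refine ⟨j :: l', by simpa using hl', ?_⟩
      rw [List.map_cons, List.prod_cons, hl, mul_assoc]
    -- The sign changes exactly at the letter `j`, which forces this equality; deleting `j` then has
    -- the effect of multiplying by `s_i` on the right.
    · have h2 : w (α i) = α j := by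
        by_contra hne
        have h3 := rootReflection_simple_mem_posRoots hΦ hα hv j
          ((mem_posRoots_iff hΦ hα hv hwi).2 h1) hne
        exact absurd h (not_lt.2 ((mem_posRoots_iff hΦ hα hv h3.1).1 h3).le)
      refine ⟨l, by simp, ?_⟩
      rw [← h2, rootReflection_map, ← hw]
      simp only [mul_assoc, inv_mul_cancel_left, rootReflection_mul_self, mul_one]

/-- If a word for `w` ends in `i`, then `(v|w α_i) = (v|α_i) > 0`, so the word without its last
letter makes `α i` negative and the exchange property shortens the word. -/
theorem eq_one_of_fixes {w : V ≃ₗᵢ[ℝ] V} (hw : w ∈ weylGroup α) (hwv : w v = v) : w = 1 := by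
  obtain ⟨l, rfl⟩ := exists_list_of_mem_weylGroup hw
  clear hw
  generalize hk : l.length = k
  induction k using Nat.strong_induction_on generalizing l with
  | _ k ih =>
    rcases List.eq_nil_or_concat' l with rfl | ⟨l₀, i, rfl⟩
    · rfl
    · set w := ((l₀ ++ [i]).map fun i => rootReflection (α i)).prod with hw
      have hw' : w = (l₀.map fun i => rootReflection (α i)).prod * rootReflection (α i) := by
        simp [hw]
      have h1 : 0 < ⟪v, w (α i)⟫_ℝ := by
        nth_rewrite 1 [← hwv]
        rw [LinearIsometryEquiv.inner_map_map]
        exact hv i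
      rw [hw', isometry_mul_apply, rootReflection_self, map_neg, inner_neg_right] at h1
      obtain ⟨l', hl', hl⟩ := exchange hΦ hα hv l₀ i (by linarith)
      rw [← hw'] at hl
      rw [← hl]
      refine ih l'.length ?_ l' (by rw [hl]; exact hwv) rfl
      rw [← hk, List.length_append]
      omega

open Classical in
omit hΦ hα hv in
/-- The reflection in `r` on the positive roots it keeps positive. -/
noncomputable def reflectPos (Φ : Set V) (α : Fin n → V) (r β : posRoots Φ α) : posRoots Φ α :=
  if h : rootReflection r.1 β.1 ∈ posRoots Φ α then ⟨_, h⟩ else β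

omit hΦ hα hv in
theorem reflectPos_involutive (r : posRoots Φ α) : Function.Involutive (reflectPos Φ α r) := by
  intro β
  by_cases h : rootReflection r.1 β.1 ∈ posRoots Φ α
  · have h1 : reflectPos Φ α r β = ⟨_, h⟩ := dif_pos h
    have h2 : rootReflection r.1 (reflectPos Φ α r β).1 ∈ posRoots Φ α := by
      rw [h1, rootReflection_rootReflection]; exact β.2
    rw [reflectPos, dif_pos h2]
    refine Subtype.ext ?_
    change rootReflection r.1 (reflectPos Φ α r β).1 = β.1
    rw [h1, rootReflection_rootReflection]
  · have h1 : reflectPos Φ α r β = β := dif_neg h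
    rw [h1, h1]

theorem reflectPos_of_ne {i : Fin n} {r β : posRoots Φ α} (hr : r.1 = α i) (h : β ≠ r) :
    (reflectPos Φ α r β).1 = rootReflection r.1 β.1 := by
  have : rootReflection r.1 β.1 ∈ posRoots Φ α := by
    rw [hr]
    exact rootReflection_simple_mem_posRoots hΦ hα hv i β.2 fun h' => h (Subtype.ext (h'.trans hr.symm))
  rw [reflectPos, dif_pos this]

theorem reflectPos_self (r : posRoots Φ α) : reflectPos Φ α r r = r := by
  refine dif_neg fun h => ?_
  have h1 := (mem_posRoots_iff hΦ hα hv h.1).1 h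
  have h2 := (mem_posRoots_iff hΦ hα hv r.2.1).1 r.2
  rw [rootReflection_self, inner_neg_right] at h1
  linarith

/-- The reflection datum of a root system. -/
noncomputable def weylDatum : ReflectionDatum V (weylGroup α) (posRoots Φ α) where
  act :=
    { toFun := fun w => w.1.toLinearEquiv.toLinearMap
      map_one' := rfl
      map_mul' := fun _ _ => rfl }
  root r := r.1
  co r := corootForm r.1
  s r := ⟨rootReflection r.1, rootReflection_mem_weylGroup_of_mem hΦ hα hv r.2⟩
  act_s r x := rootReflection_apply r.1 x
  s_mul_self r := Subtype.ext (rootReflection_mul_self r.1)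
  co_root r := corootForm_self (hΦ.ne_zero r.2.1)
  simple := {r | ∃ i, r.1 = α i}
  perm r := (reflectPos_involutive r).toPerm
  perm_self i _ := reflectPos_self hΦ hα hv i
  s_perm := by
    rintro i ⟨j, hj⟩ r
    apply Subtype.ext
    change rootReflection (reflectPos Φ α i r).1 =
      rootReflection i.1 * rootReflection r.1 * rootReflection i.1
    by_cases hr : r = i
    · rw [hr, reflectPos_self hΦ hα hv i, rootReflection_mul_self, one_mul]
    · rw [reflectPos_of_ne hΦ hα hv hj hr, rootReflection_map,
        inv_eq_of_mul_eq_one_left (rootReflection_mul_self _)]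
  co_perm := by
    rintro i ⟨j, hj⟩ r hr x
    change corootForm (reflectPos Φ α i r).1 x = corootForm r.1 (rootReflection i.1 x)
    rw [reflectPos_of_ne hΦ hα hv hj hr, ← corootForm_map (rootReflection i.1) r.1,
      rootReflection_rootReflection]
  closure_simple := by
    have h : Subgroup.closure (Subtype.val ⁻¹' Set.range fun i => rootReflection (α i) :
        Set (weylGroup α)) = ⊤ := Subgroup.closure_closure_coe_preimage
    refine (congrArg Subgroup.closure ?_).trans h
    ext w
    constructor
    · rintro ⟨r, ⟨i, hi⟩, rfl⟩
      exact ⟨i, congrArg rootReflection hi.symm⟩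
    · rintro ⟨i, hi⟩
      refine ⟨⟨α i, (mem_posRoots_iff hΦ hα hv (hα.mem i)).2 (hv i)⟩, ⟨i, rfl⟩, Subtype.ext hi⟩

theorem isRegularFunctional_weylDatum :
    IsRegularFunctional (weylDatum hΦ hα hv) (innerSL ℝ v : V →ₗ[ℝ] ℝ)
      {β ∈ posRoots Φ α | ⟪v, β⟫_ℝ = 1} where
  pos := by
    rintro i -
    exact (mem_posRoots_iff hΦ hα hv i.2.1).1 i.2
  ne_zero := by
    rintro i - w
    exact inner_root_ne_zero hΦ hα hv (weylGroup_apply_mem hΦ hα w.2 i.2.1)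
  separating := by
    intro w w' h
    have h1 : ∀ x, ⟪v, w.1 x⟫_ℝ = ⟪v, w'.1 x⟫_ℝ := h
    have e3 : ∀ (u : V ≃ₗᵢ[ℝ] V) x, ⟪v, u x⟫_ℝ = ⟪u⁻¹ v, x⟫_ℝ := by
      intro u x
      rw [← u.inner_map_map (u⁻¹ v) x]
      congr 1
      exact (u.apply_symm_apply v).symm
    have h2 : w.1⁻¹ v = w'.1⁻¹ v := ext_inner_right ℝ fun x => by rw [← e3, ← e3, h1]
    have h3 : (w'.1 * w.1⁻¹) v = v := by
      rw [isometry_mul_apply, h2]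
      exact w'.1.apply_symm_apply v
    have h4 := eq_one_of_fixes hΦ hα hv (mul_mem w'.2 (inv_mem w.2)) h3
    exact Subtype.ext (mul_inv_eq_one.1 h4).symm
  eq_one β hβ := hβ.2
  sign := by
    rintro i ⟨j, hj⟩ w β hβ h1 h2
    have hw := weylGroup_apply_mem hΦ hα w.2 hβ.1.1
    change w.1 β ≠ i.1 at h1
    change w.1 β ≠ -i.1 at h2
    change 0 < ⟪v, rootReflection i.1 (w.1 β)⟫_ℝ ↔ 0 < ⟪v, w.1 β⟫_ℝ
    rw [hj] at h1 h2 ⊢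
    have hsw := hΦ.rootReflection_mem (hα.mem j) hw
    rw [← mem_posRoots_iff hΦ hα hv hw, ← mem_posRoots_iff hΦ hα hv hsw]
    refine ⟨fun h => ?_, fun h => rootReflection_simple_mem_posRoots hΦ hα hv j h h1⟩
    have := rootReflection_simple_mem_posRoots hΦ hα hv j h fun h' => h2 (by
      rw [← rootReflection_rootReflection (α j) (w.1 β), h', rootReflection_self])
    rwa [rootReflection_rootReflection] at this
  exists_neg := by
    intro β hβ
    refine ⟨⟨rootReflection β, rootReflection_mem_weylGroup_of_mem hΦ hα hv hβ.1⟩, ?_⟩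
    change ⟪v, rootReflection β β⟫_ℝ < 0
    rw [rootReflection_self, inner_neg_right, hβ.2]
    norm_num

/-- Every sign pattern on the positive roots of value `1` at a dominant vector is realised. -/
theorem exists_inner_signs [FiniteDimensional ℝ V] {T : Set V}
    (hT : T ⊆ {β ∈ posRoots Φ α | ⟪v, β⟫_ℝ = 1}) :
    ∃ u : V, ∀ β ∈ posRoots Φ α, ⟪v, β⟫_ℝ = 1 →
      (β ∈ T → ⟪u, β⟫_ℝ < 0) ∧ (β ∉ T → 0 < ⟪u, β⟫_ℝ) := by
  have := finite_weylGroup hΦ hα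
  have := Fintype.ofFinite (weylGroup α)
  have := (posRoots_finite (α := α) hΦ).fintype
  obtain ⟨w, hw⟩ := exists_sign_pattern (isRegularFunctional_weylDatum hΦ hα hv)
    ((posRoots_finite hΦ).subset fun _ h => h.1) hT
  -- Since `(w⁻¹v|β) = (v|wβ)`, the signs are those of `w`, and no root is orthogonal to `v`.
  refine ⟨w.1⁻¹ v, fun β hβ hβ1 => ?_⟩
  have h1 : ⟪w.1⁻¹ v, β⟫_ℝ = ⟪v, w.1 β⟫_ℝ := by
    rw [← w.1.inner_map_map (w.1⁻¹ v) β]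
    congr 1
    exact w.1.apply_symm_apply v
  have h2 : ¬ (β ∈ T ↔ 0 < ⟪v, w.1 β⟫_ℝ) := hw β ⟨hβ, hβ1⟩
  have h3 := inner_root_ne_zero hΦ hα hv (weylGroup_apply_mem hΦ hα w.2 hβ.1)
  rw [h1]
  constructor
  · intro hT
    exact lt_of_le_of_ne (not_lt.1 fun h => h2 ⟨fun _ => h, fun _ => hT⟩) h3
  · intro hT
    by_contra h
    exact h2 ⟨fun h' => absurd h' hT, fun h' => absurd h' h⟩

end Reflections

end RootRegions

namespace RootRegions

open Module

/-! ### Dominant regions and points of the chamber -/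

section Regions

variable {V : Type*} [NormedAddCommGroup V] [InnerProductSpace ℝ V] {n : ℕ} {Φ : Set V}
  {α : Fin n → V}

theorem IsNonnegComb.add {x y : V} (hx : IsNonnegComb α x) (hy : IsNonnegComb α y) :
    IsNonnegComb α (x + y) := by
  obtain ⟨c, hc, rfl⟩ := hx
  obtain ⟨d, hd, rfl⟩ := hy
  exact ⟨fun i => c i + d i, fun i => add_nonneg (hc i) (hd i), by
    simp [add_smul, Finset.sum_add_distrib]⟩

theorem rootLE_refl (β : V) : rootLE α β β := ⟨0, fun _ => le_rfl, by simp⟩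

theorem rootLE_trans {β γ δ : V} (h1 : rootLE α β γ) (h2 : rootLE α γ δ) : rootLE α β δ := by
  have := IsNonnegComb.add h2 h1
  rwa [sub_add_sub_cancel] at this

theorem simple_mem_posRoots (hα : IsSimpleSystem Φ α) (i : Fin n) : α i ∈ posRoots Φ α := by
  classical
  refine ⟨hα.mem i, Pi.single i 1, fun j => ?_, ?_⟩
  · by_cases h : j = i
    · subst h; simp
    · simp [h]
  · rw [Finset.sum_eq_single i] <;> simp +contextual

theorem inner_ne_of_mem_arrangementCompl {x : V} (hx : x ∈ arrangementCompl Φ α) {β : V}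
    (hβ : β ∈ posRoots Φ α) : ⟪x, β⟫_ℝ ≠ -1 ∧ ⟪x, β⟫_ℝ ≠ 0 ∧ ⟪x, β⟫_ℝ ≠ 1 := by
  simp only [arrangementCompl, hyperplane, Set.mem_compl_iff, Set.mem_iUnion, not_exists] at hx
  exact ⟨hx β hβ (-1) (by simp), hx β hβ 0 (by simp), hx β hβ 1 (by simp)⟩

/-- On a component of the complement, the position relative to a wall is constant. -/
theorem lt_inner_of_mem_component {x y : V} {c : ℝ} {β : V}
    (hne : ∀ z ∈ arrangementCompl Φ α, ⟪z, β⟫_ℝ ≠ c)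
    (hx : x ∈ arrangementCompl Φ α) (hc : c < ⟪x, β⟫_ℝ)
    (hy : y ∈ connectedComponentIn (arrangementCompl Φ α) x) : c < ⟪y, β⟫_ℝ := by
  by_contra! h
  obtain ⟨z, hz, hzc⟩ := isPreconnected_connectedComponentIn.intermediate_value hy
    (mem_connectedComponentIn hx) (f := fun z => ⟪z, β⟫_ℝ) (by fun_prop) ⟨h, hc.le⟩
  exact hne z (connectedComponentIn_subset _ _ hz) hzc

theorem component_mem_dominantRegions (hα : IsSimpleSystem Φ α) {x : V}
    (hx : x ∈ arrangementCompl Φ α) (hxC : x ∈ chamber α) :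
    connectedComponentIn (arrangementCompl Φ α) x ∈ dominantRegions Φ α :=
  ⟨⟨x, hx, rfl⟩, fun _ hy i => lt_inner_of_mem_component
    (fun _ hz => (inner_ne_of_mem_arrangementCompl hz (simple_mem_posRoots hα i)).2.1) hx (hxC i) hy⟩

theorem mem_rootsAbove_component {x : V} (hx : x ∈ arrangementCompl Φ α) {β : V} :
    β ∈ rootsAbove Φ α (connectedComponentIn (arrangementCompl Φ α) x) ↔
      β ∈ posRoots Φ α ∧ 1 < ⟪x, β⟫_ℝ :=
  ⟨fun h => ⟨h.1, h.2 (mem_connectedComponentIn hx)⟩, fun h => ⟨h.1, fun _ hy =>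
    lt_inner_of_mem_component (fun _ hz => (inner_ne_of_mem_arrangementCompl hz h.1).2.2) hx h.2 hy⟩⟩

theorem regionMap_injective (hΦ : IsRootSystem Φ) : Function.Injective (regionMap Φ α) := by
  rintro ⟨_, ⟨x, hx, rfl⟩, hxC⟩ ⟨_, ⟨y, hy, rfl⟩, hyC⟩ h
  have h1 : rootsAbove Φ α (connectedComponentIn (arrangementCompl Φ α) x) =
      rootsAbove Φ α (connectedComponentIn (arrangementCompl Φ α) y) := congrArg Subtype.val h
  have hxc := hxC (mem_connectedComponentIn hx)
  have hyc := hyC (mem_connectedComponentIn hy)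
  refine Subtype.ext ?_
  refine connectedComponentIn_eq ?_
  refine (convex_segment x y).isPreconnected.subset_connectedComponentIn (left_mem_segment ℝ x y) ?_
    (right_mem_segment ℝ x y)
  rintro z ⟨a, b, ha, hb, hab, rfl⟩
  simp only [arrangementCompl, hyperplane, Set.mem_compl_iff, Set.mem_iUnion, not_exists,
    Set.mem_ofPred_eq]
  intro β hβ c hc
  rw [inner_add_left, real_inner_smul_left, real_inner_smul_left]
  have hx0 := inner_pos_of_isNonnegComb hxc hβ.2 (hΦ.ne_zero hβ.1)
  have hy0 := inner_pos_of_isNonnegComb hyc hβ.2 (hΦ.ne_zero hβ.1)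
  have hx1 := (inner_ne_of_mem_arrangementCompl hx hβ).2.2
  have hy1 := (inner_ne_of_mem_arrangementCompl hy hβ).2.2
  have hb' : b = 1 - a := by linarith
  have hconv : ∀ p q : ℝ, 0 < p → 0 < q → 0 < a * p + b * q := by
    intro p q hp hq
    rcases ha.eq_or_lt with rfl | ha
    · rw [zero_add] at hab
      rw [hab]; linarith
    · have := mul_pos ha hp
      have := mul_nonneg hb hq.le
      linarith
  have h0 := hconv _ _ hx0 hy0
  by_cases hβx : 1 < ⟪x, β⟫_ℝ
  · have hβy : 1 < ⟪y, β⟫_ℝ :=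
      ((mem_rootsAbove_component hy).1 (h1 ▸ (mem_rootsAbove_component hx).2 ⟨hβ, hβx⟩)).2
    have := hconv _ _ (sub_pos.2 hβx) (sub_pos.2 hβy)
    rcases hc with rfl | rfl | rfl <;> intro h2 <;> nlinarith
  · have hβy : ¬ 1 < ⟪y, β⟫_ℝ := fun h' => hβx
      ((mem_rootsAbove_component hx).1 (h1 ▸ (mem_rootsAbove_component hy).2 ⟨hβ, h'⟩)).2
    have := hconv _ _ (sub_pos.2 (lt_of_le_of_ne (not_lt.1 hβx) hx1))
      (sub_pos.2 (lt_of_le_of_ne (not_lt.1 hβy) hy1))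
    rcases hc with rfl | rfl | rfl <;> intro h2 <;> nlinarith

/-- Surjectivity of the region map in terms of points of the chamber. -/
theorem regionMap_surjective_iff (hΦ : IsRootSystem Φ) (hα : IsSimpleSystem Φ α) :
    Function.Surjective (regionMap Φ α) ↔ ∀ I ∈ increasingSets Φ α, ∃ x ∈ chamber α,
      (∀ β ∈ I, 1 < ⟪x, β⟫_ℝ) ∧ ∀ β ∈ posRoots Φ α, β ∉ I → ⟪x, β⟫_ℝ < 1 := by
  constructor
  · intro h I hI
    obtain ⟨⟨_, ⟨x, hx, rfl⟩, hxC⟩, hR⟩ := h ⟨I, hI⟩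
    have h1 : rootsAbove Φ α (connectedComponentIn (arrangementCompl Φ α) x) = I :=
      congrArg Subtype.val hR
    refine ⟨x, hxC (mem_connectedComponentIn hx), fun β hβ => ?_, fun β hβ hβI => ?_⟩
    · rw [← h1] at hβ
      exact ((mem_rootsAbove_component hx).1 hβ).2
    · refine lt_of_le_of_ne (not_lt.1 fun h2 => hβI ?_)
        (inner_ne_of_mem_arrangementCompl hx hβ).2.2
      rw [← h1]
      exact (mem_rootsAbove_component hx).2 ⟨hβ, h2⟩
  · rintro h ⟨I, hI⟩
    obtain ⟨x, hxC, h1, h2⟩ := h I hI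
    have hx : x ∈ arrangementCompl Φ α := by
      simp only [arrangementCompl, hyperplane, Set.mem_compl_iff, Set.mem_iUnion, not_exists,
        Set.mem_ofPred_eq]
      intro β hβ c hc
      have h0 := inner_pos_of_isNonnegComb hxC hβ.2 (hΦ.ne_zero hβ.1)
      by_cases hβI : β ∈ I
      · have := h1 β hβI
        rcases hc with rfl | rfl | rfl <;> linarith
      · have := h2 β hβ hβI
        rcases hc with rfl | rfl | rfl <;> linarith
    refine ⟨⟨_, component_mem_dominantRegions hα hx hxC⟩, Subtype.ext ?_⟩
    ext β
    refine (mem_rootsAbove_component hx).trans ⟨fun h3 => ?_, fun h3 => ⟨hI.1 h3, h1 β h3⟩⟩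
    by_contra h4
    exact absurd h3.2 (not_lt.2 (h2 β h3.1 h4).le)

end Regions

/-- Gordan's alternative. -/
theorem gordan {κ E : Type*} [Fintype κ] [NormedAddCommGroup E] [NormedSpace ℝ E] (p : κ → E) :
    (∃ f : E →L[ℝ] ℝ, ∀ k, 0 < f (p k)) ∨
      ∃ w : κ → ℝ, (∀ k, 0 ≤ w k) ∧ ∑ k, w k = 1 ∧ ∑ k, w k • p k = 0 := by
  classical
  let L : (κ → ℝ) →ₗ[ℝ] E := Fintype.linearCombination ℝ p
  have hL : ∀ w, L w = ∑ k, w k • p k := fun w => Fintype.linearCombination_apply ℝ p w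
  have hLc : Continuous L := L.continuous_of_finiteDimensional
  -- Either 0 is a convex combination of the `p k`, or it is strictly separated from their compact
  -- convex hull.
  by_cases h0 : (0 : E) ∈ L '' stdSimplex ℝ κ
  · obtain ⟨w, hw, hw0⟩ := h0
    exact Or.inr ⟨w, hw.1, hw.2, by rw [← hL, hw0]⟩
  · left
    obtain ⟨f, u, hu, hf⟩ := geometric_hahn_banach_point_closed
      ((convex_stdSimplex ℝ κ).linear_image L)
      ((isCompact_stdSimplex ℝ κ).image hLc).isClosed h0
    rw [map_zero] at hu
    refine ⟨f, fun k => hu.trans (hf _ ⟨Pi.single k 1, single_mem_stdSimplex ℝ k, ?_⟩)⟩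
    rw [hL, Finset.sum_eq_single k] <;> simp +contextual

/-! ### The criterion by antichains -/

section Criterion

variable {V : Type*} [NormedAddCommGroup V] [InnerProductSpace ℝ V] {n : ℕ} {Φ : Set V}
  {α : Fin n → V}

theorem intC_nonempty_of_surjective (hΦ : IsRootSystem Φ) (hα : IsSimpleSystem Φ α)
    (hs : Function.Surjective (regionMap Φ α)) {Λ : Set V} (hΛ : Λ ⊆ posRoots Φ α)
    (hanti : IsAntichain (rootLE α) Λ) : (intC α Λ).Nonempty := by
  classical
  rw [regionMap_surjective_iff hΦ hα] at hs
  have := ((posRoots_finite hΦ).subset hΛ).fintype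
  have hv : ∀ F : Finset Λ, ∃ x ∈ chamber α, (∀ β ∈ F, 1 < ⟪x, β.1⟫_ℝ) ∧
      ∀ β ∉ F, ⟪x, β.1⟫_ℝ < 1 := by
    intro F
    -- The increasing set generated by `F`; as `Λ` is an antichain, it meets `Λ` only in `F`.
    obtain ⟨x, hxC, h1, h2⟩ := hs {γ ∈ posRoots Φ α | ∃ β ∈ F, rootLE α β.1 γ}
      ⟨fun γ hγ => hγ.1, fun γ _ δ hδ hγδ hγ => ⟨hδ, hγ.2.imp fun β hβ =>
        ⟨hβ.1, rootLE_trans hβ.2 hγδ⟩⟩⟩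
    refine ⟨x, hxC, fun β hβ => h1 _ ⟨hΛ β.2, β, hβ, rootLE_refl _⟩, fun β hβ =>
      h2 _ (hΛ β.2) ?_⟩
    rintro ⟨-, γ, hγ, hγβ⟩
    have hne : γ.1 ≠ β.1 := fun h => hβ (Subtype.ext h ▸ hγ)
    exact hanti γ.2 β.2 hne hγβ
  choose x hxC hx1 hx2 using hv
  rcases gordan fun (F : Finset Λ) (β : Λ) => ⟪x F, β.1⟫_ℝ - 1 with ⟨f, hf⟩ | ⟨w, hw, hw1, hw0⟩
  · exfalso
    -- For this `F` each coordinate of the point and the corresponding coefficient of `f` have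
    -- opposite signs, so `f` cannot be positive there.
    let F : Finset Λ := {β | f (Pi.single β 1) < 0}
    have h1 := hf F
    have h2 := (f : (Λ → ℝ) →ₗ[ℝ] ℝ).pi_apply_eq_sum_univ fun β : Λ => ⟪x F, β.1⟫_ℝ - 1
    have h3 : f (fun β : Λ => ⟪x F, β.1⟫_ℝ - 1) ≤ 0 := by
      refine h2.trans_le (Finset.sum_nonpos fun β _ => ?_)
      have hsingle : (fun j : Λ => if β = j then (1 : ℝ) else 0) = Pi.single β 1 := by
        ext j
        simp [Pi.single_apply, eq_comm]
      rw [hsingle, smul_eq_mul]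
      by_cases hβ : f (Pi.single β 1) < 0
      · have := hx1 F β (by simp [F, hβ])
        exact mul_nonpos_of_nonneg_of_nonpos (by linarith) hβ.le
      · have := hx2 F β (by simp [F, not_lt.1 hβ])
        exact mul_nonpos_of_nonpos_of_nonneg (by linarith) (not_lt.1 hβ)
    linarith
  · refine ⟨∑ F, w F • x F, fun i => ?_, fun β hβ => ?_⟩
    · rw [sum_inner]
      have h1 : ∀ F ∈ Finset.univ, 0 ≤ ⟪w F • x F, α i⟫_ℝ := fun F _ => by
        rw [real_inner_smul_left]
        exact mul_nonneg (hw F) (hxC F i).le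
      refine lt_of_le_of_ne (Finset.sum_nonneg h1) fun h => ?_
      have h2 : ∀ F, w F = 0 := fun F => by
        have h3 := (Finset.sum_eq_zero_iff_of_nonneg h1).1 h.symm F (Finset.mem_univ F)
        rw [real_inner_smul_left] at h3
        exact (mul_eq_zero.1 h3).resolve_right (hxC F i).ne'
      simp [h2] at hw1
    · have h1 := congrFun hw0 ⟨β, hβ⟩
      simp only [Finset.sum_apply, Pi.smul_apply, smul_eq_mul, Pi.zero_apply, mul_sub, mul_one,
        Finset.sum_sub_distrib, hw1] at h1
      rw [sum_inner]
      simp only [real_inner_smul_left]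
      linarith

variable [FiniteDimensional ℝ V]

/-- If all antichains have solutions, no nontrivial linear relation obstructs an increasing set. -/
theorem no_obstruction (hΦ : IsRootSystem Φ) (hα : IsSimpleSystem Φ α)
    (hint : ∀ Λ : Set V, Λ ⊆ posRoots Φ α → Λ.Nonempty → IsAntichain (rootLE α) Λ →
      (intC α Λ).Nonempty) {I : Set V} (hI : I ∈ increasingSets Φ α) [Fintype (posRoots Φ α)]
    (ε : posRoots Φ α → ℝ) (hε1 : ∀ β, β.1 ∈ I → ε β = 1) (hε2 : ∀ β, β.1 ∉ I → ε β = -1) (k : ℕ) :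
    ∀ (a : Fin n → ℝ) (b : posRoots Φ α → ℝ), (∀ i, 0 ≤ a i) → (∀ β, 0 ≤ b β) → b ≠ 0 →
      0 ≤ ∑ β, b β * ε β → ∑ i, a i • α i + ∑ β, (b β * ε β) • β.1 = 0 →
      (Function.support b).ncard = k → False := by
  classical
  induction k using Nat.strong_induction_on with
  | _ k ih =>
  intro a b ha hb hb0 hd hrel hk
  set Λ : Set V := Subtype.val '' Function.support b with hΛ
  have hΛpos : Λ ⊆ posRoots Φ α := by rintro _ ⟨β, -, rfl⟩; exact β.2
  have hεne : ∀ β, ε β = 1 ∨ ε β = -1 := fun β => by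
    by_cases h : β.1 ∈ I
    exacts [Or.inl (hε1 β h), Or.inr (hε2 β h)]
  by_cases hanti : IsAntichain (rootLE α) Λ
  · have hne : Λ.Nonempty := (Function.support_nonempty_iff.2 hb0).image _
    obtain ⟨v, hv, hvΛ⟩ := hint Λ hΛpos hne hanti
    have hvb : ∀ β : posRoots Φ α, b β * ε β * ⟪v, β.1⟫_ℝ = b β * ε β := by
      intro β
      by_cases h : b β = 0
      · simp [h]
      · rw [hvΛ β.1 ⟨β, h, rfl⟩, mul_one]
    have h1 := congrArg (fun y => ⟪v, y⟫_ℝ) hrel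
    simp only [inner_add_right, inner_sum, real_inner_smul_right, inner_zero_right, hvb] at h1
    have h2 : ∀ i ∈ Finset.univ, 0 ≤ a i * ⟪v, α i⟫_ℝ := fun i _ => mul_nonneg (ha i) (hv i).le
    have h3 := Finset.sum_nonneg h2
    have h4 : ∀ i, a i = 0 := fun i => by
      have := (Finset.sum_eq_zero_iff_of_nonneg h2).1 (by linarith) i (Finset.mem_univ i)
      exact (mul_eq_zero.1 this).resolve_right (hv i).ne'
    simp only [h4, zero_smul, Finset.sum_const_zero, zero_add] at hrel
    -- With these signs every term of the relation on the support of `b` pairs negatively with `u`.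
    obtain ⟨u, hu⟩ := exists_inner_signs hΦ hα hv (T := {β ∈ Λ | β ∈ I}) (by
      rintro β ⟨hβ, -⟩
      exact ⟨hΛpos hβ, hvΛ β hβ⟩)
    have h5 : ∀ β, b β ≠ 0 → b β * ε β * ⟪u, β.1⟫_ℝ < 0 := by
      intro β hβ
      have hβΛ : β.1 ∈ Λ := ⟨β, hβ, rfl⟩
      have hbpos : 0 < b β := lt_of_le_of_ne (hb β) hβ.symm
      obtain ⟨h6, h7⟩ := hu β.1 β.2 (hvΛ _ hβΛ)
      by_cases hβI : β.1 ∈ I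
      · rw [hε1 β hβI, mul_one]
        exact mul_neg_of_pos_of_neg hbpos (h6 ⟨hβΛ, hβI⟩)
      · rw [hε2 β hβI]
        have := mul_pos hbpos (h7 fun h => hβI h.2)
        linarith
    have h6 := congrArg (fun y => ⟪u, y⟫_ℝ) hrel
    simp only [inner_sum, real_inner_smul_right, inner_zero_right] at h6
    obtain ⟨β, hβ⟩ := Function.ne_iff.1 hb0
    refine absurd h6 (ne_of_lt (Finset.sum_neg' (fun γ _ => ?_) ⟨β, Finset.mem_univ β, h5 β hβ⟩))
    by_cases hγ : b γ = 0
    · simp [hγ]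
    · exact (h5 γ hγ).le
  · simp only [IsAntichain, Set.Pairwise, not_forall] at hanti
    obtain ⟨_, ⟨β, hβ, rfl⟩, _, ⟨γ, hγ, rfl⟩, hne, hle⟩ := hanti
    have hle : rootLE α β.1 γ.1 := not_not.1 hle
    have hβγ : β ≠ γ := fun h => hne (congrArg Subtype.val h)
    obtain ⟨c, hc, hcγ⟩ := hle
    have hbβ : 0 < b β := lt_of_le_of_ne (hb β) (Ne.symm hβ)
    have hbγ : 0 < b γ := lt_of_le_of_ne (hb γ) (Ne.symm hγ)
    -- Adding `t (γ - β)` to the simple part and compensating in the coefficients of `β` and `γ`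
    -- keeps the relation and `∑ b ε`. Take the first `t` at which a coefficient vanishes. It exists
    -- since `β ∈ I`, `γ ∉ I`, the one case where both would grow, is impossible for an increasing
    -- set.
    obtain ⟨t, ht, htβ, htγ, htz⟩ : ∃ t, 0 < t ∧ 0 ≤ b β + t * ε β ∧ 0 ≤ b γ - t * ε γ ∧
        (b β + t * ε β = 0 ∨ b γ - t * ε γ = 0) := by
      by_cases hγI : γ.1 ∈ I
      · rw [hε1 γ hγI]
        by_cases hβI : β.1 ∈ I
        · rw [hε1 β hβI]
          exact ⟨b γ, hbγ, by linarith, by linarith, Or.inr (by ring)⟩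
        · rw [hε2 β hβI]
          rcases le_total (b β) (b γ) with h | h
          · exact ⟨b β, hbβ, by linarith, by linarith, Or.inl (by ring)⟩
          · exact ⟨b γ, hbγ, by linarith, by linarith, Or.inr (by ring)⟩
      · have hβI : β.1 ∉ I := fun h => hγI (hI.2 _ β.2 _ γ.2 ⟨c, hc, hcγ⟩ h)
        rw [hε2 γ hγI, hε2 β hβI]
        exact ⟨b β, hbβ, by linarith, by linarith, Or.inl (by ring)⟩
    set b' : posRoots Φ α → ℝ :=
      b + Pi.single β (t * ε β) - Pi.single γ (t * ε γ) with hb'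
    have hb'β : b' β = b β + t * ε β := by simp [hb', Pi.single_eq_of_ne hβγ]
    have hb'γ : b' γ = b γ - t * ε γ := by simp [hb', Pi.single_eq_of_ne hβγ.symm]
    have hb'δ : ∀ δ, δ ≠ β → δ ≠ γ → b' δ = b δ := fun δ h1 h2 => by
      simp [hb', Pi.single_eq_of_ne h1, Pi.single_eq_of_ne h2]
    have hεsq : ∀ δ, ε δ * ε δ = 1 := fun δ => by
      rcases hεne δ with h | h <;> rw [h] <;> norm_num
    have hcoef : ∀ δ, b' δ * ε δ =
        b δ * ε δ + (if δ = β then t else 0) - (if δ = γ then t else 0) := by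
      intro δ
      have e1 : ∀ δ, t * ε δ * ε δ = t := fun δ => by rw [mul_assoc, hεsq, mul_one]
      by_cases h1 : δ = β
      · subst h1
        rw [hb'β, if_pos rfl, if_neg hβγ, add_mul, e1, sub_zero]
      · by_cases h2 : δ = γ
        · subst h2
          rw [hb'γ, if_neg h1, if_pos rfl, sub_mul, e1, add_zero]
        · rw [hb'δ δ h1 h2, if_neg h1, if_neg h2, add_zero, sub_zero]
    have hrel' : ∑ i, (a i + t * c i) • α i + ∑ δ, (b' δ * ε δ) • δ.1 = 0 := by
      simp only [hcoef, add_smul, sub_smul, ite_smul, zero_smul, mul_smul t, Finset.sum_add_distrib,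
        Finset.sum_sub_distrib, Finset.sum_ite_eq', Finset.mem_univ, if_true, ← Finset.smul_sum]
      rw [← hcγ, ← hrel, smul_sub]
      abel
    refine ih (Function.support b').ncard ?_ (fun i => a i + t * c i) b'
      (fun i => add_nonneg (ha i) (mul_nonneg ht.le (hc i))) (fun δ => ?_) (fun h0 => ?_) ?_ hrel' rfl
    · rw [← hk]
      refine Set.ncard_lt_ncard (Set.ssubset_iff_exists.2 ⟨fun δ hδ => ?_, ?_⟩) (Set.toFinite _)
      · by_cases h1 : δ = β
        · rwa [h1]
        · by_cases h2 : δ = γ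
          · rwa [h2]
          · rwa [Function.mem_support, ← hb'δ δ h1 h2]
      · rcases htz with h | h
        · exact ⟨β, hβ, fun h' => h' (hb'β.trans h)⟩
        · exact ⟨γ, hγ, fun h' => h' (hb'γ.trans h)⟩
    · by_cases h1 : δ = β
      · rw [h1, hb'β]; exact htβ
      · by_cases h2 : δ = γ
        · rw [h2, hb'γ]; exact htγ
        · rw [hb'δ δ h1 h2]; exact hb δ
    · simp only [h0, Pi.zero_apply, zero_mul, zero_smul, Finset.sum_const_zero, add_zero] at hrel'
      have h1 := Fintype.linearIndependent_iff.1 hα.linearIndependent _ hrel'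
      have h2 : ∀ i, c i = 0 := fun i => by
        have e1 := mul_nonneg ht.le (hc i)
        have e2 : t * c i = 0 := by linarith [h1 i, ha i]
        exact (mul_eq_zero.1 e2).resolve_left ht.ne'
      simp only [h2, zero_smul, Finset.sum_const_zero] at hcγ
      exact hne (sub_eq_zero.1 hcγ).symm
    · simpa only [hcoef, Finset.sum_add_distrib, Finset.sum_sub_distrib, Finset.sum_ite_eq',
        Finset.mem_univ, if_true, add_sub_cancel_right] using hd

theorem surjective_of_intC_nonempty (hΦ : IsRootSystem Φ) (hα : IsSimpleSystem Φ α)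
    (hint : ∀ Λ : Set V, Λ ⊆ posRoots Φ α → Λ.Nonempty → IsAntichain (rootLE α) Λ →
      (intC α Λ).Nonempty) : Function.Surjective (regionMap Φ α) := by
  classical
  rw [regionMap_surjective_iff hΦ hα]
  intro I hI
  have := (posRoots_finite (α := α) hΦ).fintype
  let ε : posRoots Φ α → ℝ := fun β => if β.1 ∈ I then 1 else -1
  have hε1 : ∀ β, β.1 ∈ I → ε β = 1 := fun β h => if_pos h
  have hε2 : ∀ β, β.1 ∉ I → ε β = -1 := fun β h => if_neg h
  -- The affine conditions made homogeneous: a functional `(y, c)` positive on these vectors has `c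
  -- > 0`, and `x = y / c` is the required point.
  let p : (Fin n ⊕ posRoots Φ α) ⊕ Unit → V × ℝ :=
    Sum.elim (Sum.elim (fun i => (α i, 0)) fun β => (ε β • β.1, -ε β)) fun _ => (0, 1)
  rcases gordan p with ⟨f, hf⟩ | ⟨w, hw, hw1, hw0⟩
  · let y := (InnerProductSpace.toDual ℝ V).symm (f.comp (ContinuousLinearMap.inl ℝ V ℝ))
    have hy : ∀ z, ⟪y, z⟫_ℝ = f (z, 0) := fun z => by
      simp [y]
    set c := f (0, 1) with hc
    have hc0 : 0 < c := hf (Sum.inr ())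
    have hfz : ∀ z t, f (z, t) = ⟪y, z⟫_ℝ + t * c := by
      intro z t
      have : ((z, t) : V × ℝ) = (z, 0) + t • ((0, 1) : V × ℝ) := by simp
      rw [this, map_add, map_smul, hy, smul_eq_mul]
    have hβ : ∀ β : posRoots Φ α, 0 < ε β * ⟪y, β.1⟫_ℝ - ε β * c := by
      intro β
      have := hf (Sum.inl (Sum.inr β))
      change 0 < f (ε β • β.1, -ε β) at this
      rw [hfz, real_inner_smul_right] at this
      linarith
    refine ⟨c⁻¹ • y, fun i => ?_, fun β hβI => ?_, fun β hβp hβI => ?_⟩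
    · have := hf (Sum.inl (Sum.inl i))
      change 0 < f (α i, 0) at this
      rw [real_inner_smul_left, hy]
      exact mul_pos (inv_pos.2 hc0) this
    · have := hβ ⟨β, hI.1 hβI⟩
      rw [hε1 _ hβI] at this
      rw [real_inner_smul_left, inv_mul_eq_div, lt_div_iff₀ hc0]
      linarith
    · have := hβ ⟨β, hβp⟩
      rw [hε2 _ hβI] at this
      rw [real_inner_smul_left, inv_mul_eq_div, div_lt_iff₀ hc0]
      linarith
  · exfalso
    simp only [Fintype.sum_sum_type] at hw0 hw1
    have h1 := congrArg Prod.fst hw0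
    have h2 := congrArg Prod.snd hw0
    simp only [p, Sum.elim_inl, Sum.elim_inr, Prod.smul_mk, Prod.fst_add, Prod.snd_add, Prod.fst_sum,
      Prod.snd_sum, smul_zero, Finset.sum_const_zero, add_zero, zero_add, Prod.fst_zero,
      Prod.snd_zero, smul_eq_mul, mul_neg, mul_one, mul_zero, Finset.sum_neg_distrib, Finset.univ_unique,
      Finset.sum_singleton] at h1 h2
    have hd := hw (Sum.inr ())
    refine no_obstruction hΦ hα hint hI ε hε1 hε2 _ (fun i => w (Sum.inl (Sum.inl i)))
      (fun β => w (Sum.inl (Sum.inr β))) (fun i => hw _) (fun β => hw _) (fun h0 => ?_) ?_ ?_ rfl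
    -- If `b = 0`, independence of the simple roots gives `a = 0` and the last coordinate kills the
    -- remaining weight, against total weight 1.
    · have hb : ∀ β, w (Sum.inl (Sum.inr β)) = 0 := congrFun h0
      simp only [hb, zero_smul, zero_mul, Finset.sum_const_zero, add_zero, neg_zero, zero_add]
        at h1 h2
      have ha := Fintype.linearIndependent_iff.1 hα.linearIndependent _ h1
      simp only [hb, ha, Finset.sum_const_zero, Finset.univ_unique, Finset.sum_singleton,
        zero_add] at hw1
      exact zero_ne_one (h2.symm.trans hw1)
    · change 0 ≤ ∑ x, w (Sum.inl (Sum.inr x)) * ε x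
      have h3 : w (Sum.inr default) = w (Sum.inr ()) := rfl
      linarith
    · simpa only [mul_smul] using h1

end Criterion

end RootRegions

theorem theorem5p1 {V : Type*} [NormedAddCommGroup V] [InnerProductSpace ℝ V]
    [FiniteDimensional ℝ V] (Φ : Set V) (hΦ : RootRegions.IsRootSystem Φ)
    {n : ℕ} (α : Fin n → V) (hα : RootRegions.IsSimpleSystem Φ α) :
    Function.Injective (RootRegions.regionMap Φ α) ∧
    (Function.Bijective (RootRegions.regionMap Φ α) ↔
      ∀ Λ : Set V, Λ ⊆ RootRegions.posRoots Φ α → Λ.Nonempty →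
        IsAntichain (RootRegions.rootLE α) Λ → (RootRegions.intC α Λ).Nonempty) := by
  have hinj := RootRegions.regionMap_injective (α := α) hΦ
  refine ⟨hinj, fun h Λ hΛ _ hanti => RootRegions.intC_nonempty_of_surjective hΦ hα h.2 hΛ hanti,
    fun h => ⟨hinj, RootRegions.surjective_of_intC_nonempty hΦ hα h⟩⟩
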